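/- Conventions. Identify $(S^1)^n$ with the maximal compact subgroup of $(\mathbb{C}^*)^n$, and let $\mathrm{Log}(z)=(-\log|z_1|,\dots,-\log|z_n|)$. A rational polyhedron $\sigma\subseteq\mathbb{R}^n$ is a finite intersection of half-spaces $\langle x,m\rangle\ge c$ with $m\in\mathbb{Z}^n$, $c\in\mathbb{R}$; $H_\sigma$ is the linear subspace parallel to its affine span, $N(\sigma)=\mathbb{Z}^n/(H_\sigma\cap\mathbb{Z}^n)$, $S_{N(\sigma)}=S^1\otimes_{\mathbb Z} N(\sigma)$ and $N(\sigma)_{\mathbb{C}}=\mathbb{C}\otimes_{\mathbb Z} N(\sigma)$. Let $\pi_\sigma:\mathrm{Log}^{-1}(\mathrm{aff}\,\sigma)\to S_{N(\sigma)}$ send $z$ to the class of $(z_i/|z_i|)_i$; its fibers are complex submanifolds of dimension $p=\dim\sigma$ (translates of the subtorus $\mathbb{C}^*\otimes(H_\sigma\cap\mathbb{Z}^n)$). Define the $(p,p)$-dimensional current $$\mathscr{T}_\sigma=\int_{x\in S_{N(\sigma)}}\big[\pi_\sigma^{-1}(x)\cap\mathrm{Log}^{-1}(\sigma)\big]\,dx$$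 on $(\mathbb{C}^*)^n$, with $dx$ the normalized Haar measure. A $p$-dimensional weighted complex $\mathscr{C}$ in $\mathbb{R}^n$ is a locally finite polyhedral complex all of whose inclusion-maximal cells are rational and $p$-dimensional, with a complex weight $w(\sigma)$ for each maximal cell $\sigma$. Put $\mathscr{T}_{\mathscr{C}}=\sum_{\sigma}w(\sigma)\mathscr{T}_\sigma$, the sum over the $p$-dimensional cells. If $\tau$ is a codimension one face of a $p$-dimensional cell $\sigma$, let $u_{\sigma/\tau}\in N(\tau)$ be the primitive generator of the ray $\mathrm{cone}(\sigma-\tau)/H_\tau\subseteq\mathbb{R}^n/H_\tau$. The complex $\mathscr{C}$ is balanced if $\sum_{\sigma\supset\tau}w(\sigma)u_{\sigma/\tau}=0$ in $N(\tau)_{\mathbb{C}}$ for every $(p-1)$-dimensional cell $\tau$, the sum being over the $p$-dimensional cells $\sigma$ having $\tau$ as a face. For a rational polyhedron $\tau$ and $u\in N(\tau)$, let $\mathscr{A}_\tau(u)$ be the current on $(\mathbb{C}^*)^n$ obtained as follows: average the one-parameter subgroup $\lambda^u:S^1\to S_{N(\tau)}$, $t\mapsto t\otimes u$, viewed as a $1$-dimensional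 current ($S^1$ oriented counterclockwise), over all its translates with respect to the normalized Haar measure of $S_{N(\tau)}$, pull it back along $\pi_\tau$ (whose fibers have their complex orientation), restrict it to $\mathrm{Log}^{-1}(\tau)$, and extend it by zero. **Theorem.** Let $\mathscr{C}$ be a $p$-dimensional weighted complex in $\mathbb{R}^n$. 1. $\mathscr{C}$ is balanced if and only if the current $\mathscr{T}_{\mathscr{C}}$ is closed, $d\mathscr{T}_{\mathscr{C}}=0$. 2. If $p\ge1$, then for every $(p-1)$-dimensional cell $\tau$ of $\mathscr{C}$ the map $u\mapsto\mathscr{A}_\tau(u)$ extends to an injective $\mathbb{C}$-linear map on $N(\tau)_{\mathbb{C}}$, again denoted $\mathscr{A}_\tau$, and $$d\mathscr{T}_{\mathscr{C}}=-\sum_{\tau}\mathscr{A}_\tau\Big(\sum_{\sigma\supset\tau}w(\sigma)\,u_{\sigma/\tau}\Big),$$ where the outer sum is over the $(p-1)$-dimensional cells $\tau$ of $\mathscr{C}$ and is locally finite. Here the exterior derivative of a current $T$ of degree $r$ is $\langle dT,\varphi\rangle=(-1)^{r+1}\langle T,d\varphi\rangle$. -/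

import Mathlib

open MeasureTheory TopologicalSpace
open scoped Distributions TensorProduct Pointwise

noncomputable section

namespace TropCurr

/-! ### Test forms and currents on the complex torus -/

/-- The complex torus `(ℂ^*)^n`, as an open subset of `ℂ^n`. -/
def torus (n : ℕ) : Opens (Fin n → ℂ) where
  carrier := {z | ∀ i, z i ≠ 0}
  is_open' := by
    simp only [Set.ofPred_forall]
    exact isOpen_iInter_of_finite fun i => isOpen_ne_fun (continuous_apply i) continuous_const

/-- The space of test forms of degree `k` on `(ℂ^*)^n`: smooth complex-valued differential `k`-forms
on the real manifold `(ℂ^*)^n` with compact support in `(ℂ^*)^n`, with the usual LF topology. -/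
abbrev TestForm (n k : ℕ) : Type := 𝓓(torus n, (Fin n → ℂ) [⋀^Fin k]→L[ℝ] ℂ)

/-- Currents of (real) dimension `k` on `(ℂ^*)^n`: continuous linear functionals on the space of
test forms of degree `k`. -/
abbrev Current (n k : ℕ) : Type := TestForm n k →L[ℂ] ℂ

/-- The alternatization map underlying the exterior derivative, as a complex linear map. -/
def alternatize (n k : ℕ) : ((Fin n → ℂ) →L[ℝ] (Fin n → ℂ) [⋀^Fin k]→L[ℝ] ℂ) →L[ℂ]
    ((Fin n → ℂ) [⋀^Fin (k + 1)]→L[ℝ] ℂ) where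
  toFun := ContinuousAlternatingMap.alternatizeUncurryFinCLM ℝ (Fin n → ℂ) ℂ
  map_add' := map_add _
  map_smul' c f := by
    ext v
    simp [ContinuousAlternatingMap.alternatizeUncurryFin_apply, Finset.mul_sum]
  cont := (ContinuousAlternatingMap.alternatizeUncurryFinCLM ℝ (Fin n → ℂ) ℂ).cont

/-- The exterior derivative `φ ↦ dφ` on test forms. -/
def TestForm.d (n k : ℕ) : TestForm n k →L[ℂ] TestForm n (k + 1) :=
  (TestFunction.postcompCLM (alternatize n k)).comp (TestFunction.fderivCLM ℂ ⊤ ⊤)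

theorem TestForm.d_apply {n k : ℕ} (φ : TestForm n k) (z : Fin n → ℂ) :
    TestForm.d n k φ z = extDeriv φ z := by
  simp [TestForm.d, extDeriv, alternatize]

/-- The exterior derivative of a current of dimension `k + 1` on `(ℂ^*)^n`, which is a current of
degree `2n - (k + 1)`: `⟨dT, φ⟩ = (-1) ^ (deg T + 1) ⟨T, dφ⟩ = (-1) ^ k ⟨T, dφ⟩`. -/
def Current.d {n k : ℕ} (T : Current n (k + 1)) : Current n k :=
  (-1 : ℂ) ^ k • T.comp (TestForm.d n k)

/-- A current `T` is closed if `dT = 0`. Currents of dimension `0` are closed for degree reasons. -/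
def Current.IsClosed {n : ℕ} : {k : ℕ} → Current n k → Prop
  | 0, _ => True
  | _ + 1, T => T.d = 0

/-! ### Currents defined by averaging integrals over parametrized chains -/

section Average

set_option linter.unusedSectionVars false

variable {n k : ℕ} {P X : Type*}
  [TopologicalSpace P] [CompactSpace P] [SecondCountableTopology P] [MeasurableSpace P]
  [BorelSpace P] [TopologicalSpace X] [SecondCountableTopology X] [MeasurableSpace X] [BorelSpace X]

/-- A map to `ℂ^n` is proper over the complex torus. -/
def ProperOver (F : P × X → (Fin n → ℂ)) : Prop :=
  ∀ K : Set (Fin n → ℂ), IsCompact K → K ⊆ torus n →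
    ∃ L : Set X, IsCompact L ∧ ∀ q, F q ∈ K → q.2 ∈ L

variable {F : P × X → (Fin n → ℂ)} {ξ : P × X → Fin k → (Fin n → ℂ)}

theorem continuous_integrand (hF : Continuous F) (hξ : Continuous ξ) (φ : TestForm n k) :
    Continuous fun q => φ (F q) (ξ q) := by
  have h1 : Continuous fun q => φ (F q) := φ.continuous.comp hF
  fun_prop

theorem hasCompactSupport_integrand [T2Space X] [T2Space P] (hFp : ProperOver F)
    (φ : TestForm n k) :
    HasCompactSupport fun q => φ (F q) (ξ q) := by
  obtain ⟨L, hL, h⟩ := hFp (tsupport φ) φ.hasCompactSupport φ.tsupport_subset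
  refine HasCompactSupport.intro (K := Set.univ ×ˢ L) (isCompact_univ.prod hL) ?_
  intro q hq
  have : φ (F q) = 0 := by
    by_contra hne
    exact hq ⟨trivial, h q (subset_tsupport _ hne)⟩
  simp [this]

theorem integrable_integrand [T2Space X] [T2Space P] (hF : Continuous F) (hξ : Continuous ξ)
    (hFp : ProperOver F) (μ : Measure P) [IsFiniteMeasure μ] (ν : Measure X)
    [IsLocallyFiniteMeasure ν] [SFinite ν] (φ : TestForm n k) :
    Integrable (fun q => φ (F q) (ξ q)) (μ.prod ν) :=
  (continuous_integrand hF hξ φ).integrable_of_hasCompactSupport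
    (hasCompactSupport_integrand hFp φ)

theorem integral_integrand [T2Space X] [T2Space P] (hF : Continuous F) (hξ : Continuous ξ)
    (hFp : ProperOver F) (μ : Measure P) [IsFiniteMeasure μ] (ν : Measure X)
    [IsLocallyFiniteMeasure ν] [SFinite ν] (φ : TestForm n k) :
    ∫ x, ∫ y, φ (F (x, y)) (ξ (x, y)) ∂ν ∂μ = ∫ q, φ (F q) (ξ q) ∂(μ.prod ν) :=
  integral_integral (f := fun x y => φ (F (x, y)) (ξ (x, y)))
    (integrable_integrand hF hξ hFp μ ν φ)

/-- The functional `φ ↦ ∫_{x ∈ P} (∫_{y ∈ X} φ_{F(x, y)}(ξ_1, …, ξ_k) dν(y)) dμ(x)`, as a current.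
-/
def averageCurrent [T2Space X] [T2Space P] (hF : Continuous F) (hξ : Continuous ξ)
    (hFp : ProperOver F) (μ : Measure P) [IsFiniteMeasure μ] (ν : Measure X)
    [IsLocallyFiniteMeasure ν] [SFinite ν] : Current n k :=
  TestFunction.mkCLM ℂ (fun φ => ∫ x, ∫ y, φ (F (x, y)) (ξ (x, y)) ∂ν ∂μ)
    (fun φ ψ => by
      have hi := integrable_integrand hF hξ hFp μ ν
      have e := integral_integrand hF hξ hFp μ ν
      rw [e φ, e ψ, e (φ + ψ), ← integral_add (hi φ) (hi ψ)]
      simp)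
    (fun c φ => by
      have e := integral_integrand hF hξ hFp μ ν
      rw [e φ, e (c • φ), ← integral_smul]
      simp)
    (fun K hK => by
      obtain ⟨L, hL, h⟩ := hFp K K.isCompact hK
      have hcomp : IsCompact (Set.univ ×ˢ L : Set (P × X)) := isCompact_univ.prod hL
      obtain ⟨C, hC⟩ := hcomp.exists_bound_of_continuousOn (f := fun q => ∏ i, ‖ξ q i‖)
        (by fun_prop)
      set M := (μ.prod ν).real (Set.univ ×ˢ L)
      have hM : (μ.prod ν) (Set.univ ×ˢ L) < ⊤ := hcomp.measure_lt_top
      let G : TestForm n k → ℂ := fun φ => ∫ x, ∫ y, φ (F (x, y)) (ξ (x, y)) ∂ν ∂μ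
      have hi := integrable_integrand hF hξ hFp μ ν
      let B := ContDiffMapSupportedIn.toBoundedContinuousFunctionCLM ℂ (n := ⊤) (K := K)
        (E := Fin n → ℂ) (F := (Fin n → ℂ) [⋀^Fin k]→L[ℝ] ℂ)
      have key : ∀ f g, dist (G (TestFunction.ofSupportedIn hK f))
          (G (TestFunction.ofSupportedIn hK g)) ≤ M * (C * dist (B f) (B g)) := by
        intro f g
        have hsub : G (TestFunction.ofSupportedIn hK f) - G (TestFunction.ofSupportedIn hK g) =
            ∫ q in Set.univ ×ˢ L, (f (F q) - g (F q)) (ξ q) ∂(μ.prod ν) := by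
          simp only [G]
          rw [integral_integral (hi _), integral_integral (hi _), ← integral_sub (hi _) (hi _),
            setIntegral_eq_integral_of_forall_compl_eq_zero]
          · simp
          · intro q hq
            have hq' : F q ∉ (K : Set _) := fun hh => hq ⟨trivial, h q hh⟩
            simp [f.zero_on_compl hq', g.zero_on_compl hq']
        rw [dist_eq_norm, hsub, mul_comm]
        refine norm_setIntegral_le_of_norm_le_const hM fun q hq => ?_
        refine (ContinuousAlternatingMap.le_opNorm _ _).trans ?_
        rw [mul_comm C]
        refine mul_le_mul ?_ ((le_abs_self _).trans (hC q hq)) (by positivity) dist_nonneg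
        rw [← dist_eq_norm]
        exact (B f).dist_coe_le_dist (g := B g) (F q)
      refine continuous_iff_continuousAt.2 fun g => ?_
      refine tendsto_iff_dist_tendsto_zero.2 ?_
      refine squeeze_zero (fun _ => dist_nonneg) (fun f => key f g) ?_
      have : Continuous fun f => M * (C * dist (B f) (B g)) := by
        have := B.continuous
        fun_prop
      simpa using this.tendsto g)

end Average

/-! ### Rational polyhedra -/

/-- The inclusion `ℤ^n ⊆ ℝ^n`. -/
def intCast (n : ℕ) : (Fin n → ℤ) →ₗ[ℤ] (Fin n → ℝ) :=
  (Int.castAddHom ℝ).toIntLinearMap.compLeft (Fin n)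

@[simp] theorem intCast_apply {n : ℕ} (w : Fin n → ℤ) (i : Fin n) : intCast n w i = w i := rfl

/-- A polyhedron: an intersection of finitely many closed half-spaces of `ℝ^n`. -/
def IsPolyhedron {n : ℕ} (σ : Set (Fin n → ℝ)) : Prop :=
  ∃ (N : ℕ) (m : Fin N → Fin n → ℝ) (c : Fin N → ℝ), σ = {x | ∀ j, c j ≤ m j ⬝ᵥ x}

/-- A rational polyhedron: an intersection of finitely many half-spaces `⟨x, m⟩ ≥ c` with `m`
integral and `c` real. -/
def IsRationalPolyhedron {n : ℕ} (σ : Set (Fin n → ℝ)) : Prop :=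
  ∃ (N : ℕ) (m : Fin N → Fin n → ℤ) (c : Fin N → ℝ), σ = {x | ∀ j, c j ≤ intCast n (m j) ⬝ᵥ x}

/-- The nonempty faces of a polyhedron: its nonempty subsets that maximize a linear functional. -/
def IsFace {n : ℕ} (τ σ : Set (Fin n → ℝ)) : Prop := τ.Nonempty ∧ IsExposed ℝ σ τ

/-- The dimension of a polyhedron, that is, of its affine span. -/
def dim {n : ℕ} (σ : Set (Fin n → ℝ)) : ℕ := Module.finrank ℝ (vectorSpan ℝ σ)

/-- The lattice `H_σ ∩ ℤ^n`, for `H_σ` the linear subspace parallel to the affine span of `σ`. -/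
def lattice {n : ℕ} (σ : Set (Fin n → ℝ)) : Submodule ℤ (Fin n → ℤ) :=
  ((vectorSpan ℝ σ).restrictScalars ℤ).comap (intCast n)

/-- The normal lattice `N(σ) = ℤ^n / (H_σ ∩ ℤ^n)`. -/
abbrev NormalLattice {n : ℕ} (σ : Set (Fin n → ℝ)) : Type := (Fin n → ℤ) ⧸ lattice σ

/-- The complex vector space `N(σ)_ℂ = ℂ ⊗_ℤ N(σ)`. -/
abbrev NormalSpace {n : ℕ} (σ : Set (Fin n → ℝ)) : Type := ℂ ⊗[ℤ] NormalLattice σ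

/-- `v_1, …, v_p` is a `ℤ`-basis of `H_σ ∩ ℤ^n`. (For integral vectors, linear independence over `ℤ`
and over `ℝ` are the same.) -/
structure IsLatticeBasis {n p : ℕ} (σ : Set (Fin n → ℝ)) (v : Fin p → Fin n → ℤ) : Prop where
  linearIndependent : LinearIndependent ℝ fun j => intCast n (v j)
  span_eq : Submodule.span ℤ (Set.range v) = lattice σ

/-- A real vector on which finitely many integral linear forms vanish is a real combination of
integral vectors on which they vanish. -/
theorem mem_span_integral_ker {n N : ℕ} (m : Fin N → Fin n → ℤ) (J : Set (Fin N)) (h : Fin n → ℝ)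
    (hh : ∀ j ∈ J, intCast n (m j) ⬝ᵥ h = 0) :
    h ∈ Submodule.span ℝ (intCast n '' {w | ∀ j ∈ J, intCast n (m j) ⬝ᵥ intCast n w = 0}) := by
  let V : Submodule ℚ ℝ := Submodule.span ℚ (Set.range h)
  have : Module.Finite ℚ V := Module.Finite.span_of_finite ℚ (Set.finite_range h)
  let b := Module.finBasis ℚ V
  let q : Fin n → V := fun i => ⟨h i, Submodule.subset_span ⟨i, rfl⟩⟩
  obtain ⟨D, hD⟩ := IsLocalization.exist_integer_multiples_of_finite (nonZeroDivisors ℤ)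
    (fun x : Fin n × Fin (Module.finrank ℚ V) => b.repr (q x.1) x.2)
  choose w hw using fun x => hD x
  have hD0 : ((D : ℤ) : ℝ) ≠ 0 := by
    exact_mod_cast nonZeroDivisors.coe_ne_zero D
  have hw' : ∀ i k, (w (i, k) : ℝ) = (D : ℤ) * (b.repr (q i) k : ℚ) := by
    intro i k
    have := hw (i, k)
    simp only [algebraMap_int_eq, eq_intCast, zsmul_eq_mul] at this
    exact_mod_cast this
  have hrepr : ∀ i, h i = ∑ k, (b.repr (q i) k : ℝ) * (b k : ℝ) := by
    intro i
    have := congrArg (Subtype.val) (b.sum_repr (q i))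
    simp only [Submodule.coe_sum, Submodule.coe_smul, q, Rat.smul_def] at this
    exact this.symm
  have hker : ∀ k, ∀ j ∈ J, intCast n (m j) ⬝ᵥ intCast n (fun i => w (i, k)) = 0 := by
    intro k j hj
    have h1 : ∑ i, (m j i : ℤ) • q i = 0 := by
      apply Subtype.ext
      simpa [dotProduct, q, zsmul_eq_mul] using hh j hj
    have h2 := congrArg (fun x => b.repr x k) h1
    simp only [map_sum, map_zsmul, Finsupp.coe_finsetSum, Finset.sum_apply, Finsupp.smul_apply,
      map_zero, Finsupp.zero_apply, zsmul_eq_mul] at h2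
    have h3 : ∑ i, (m j i : ℝ) * (b.repr (q i) k : ℝ) = 0 := by exact_mod_cast h2
    calc intCast n (m j) ⬝ᵥ intCast n (fun i => w (i, k))
        = (D : ℤ) * ∑ i, (m j i : ℝ) * (b.repr (q i) k : ℝ) := by
          simp only [dotProduct, intCast_apply, hw', Finset.mul_sum]
          exact Finset.sum_congr rfl fun i _ => by ring
      _ = 0 := by rw [h3, mul_zero]
  have hsum : h = ∑ k, ((b k : ℝ) / (D : ℤ)) • intCast n (fun i => w (i, k)) := by
    ext i
    rw [hrepr i, Finset.sum_apply]
    refine Finset.sum_congr rfl fun k _ => ?_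
    simp only [Pi.smul_apply, intCast_apply, hw', smul_eq_mul]
    field_simp
  rw [hsum]
  exact Submodule.sum_mem _ fun k _ => Submodule.smul_mem _ _
    (Submodule.subset_span ⟨_, hker k, rfl⟩)

/-- For a rational polyhedron `σ`, the subspace `H_σ` is rational. -/
theorem span_lattice {n : ℕ} {σ : Set (Fin n → ℝ)} (hσ : IsRationalPolyhedron σ)
    (hne : σ.Nonempty) :
    Submodule.span ℝ (intCast n '' (lattice σ : Set (Fin n → ℤ))) = vectorSpan ℝ σ := by
  refine le_antisymm (Submodule.span_le.2 ?_) ?_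
  · rintro _ ⟨w, hw, rfl⟩
    exact hw
  obtain ⟨N, m, c, hmc⟩ := hσ
  have hmem : ∀ x, x ∈ σ ↔ ∀ j, c j ≤ intCast n (m j) ⬝ᵥ x := fun x => by rw [hmc]; rfl
  let J : Set (Fin N) := {j | ∀ x ∈ σ, intCast n (m j) ⬝ᵥ x = c j}
  have h1 : ∀ g ∈ vectorSpan ℝ σ, ∀ j ∈ J, intCast n (m j) ⬝ᵥ g = 0 := by
    intro g hg j hj
    refine Submodule.span_induction (p := fun g _ => intCast n (m j) ⬝ᵥ g = 0) ?_ ?_ ?_ ?_ hg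
    · rintro _ ⟨x, hx, y, hy, rfl⟩
      change intCast n (m j) ⬝ᵥ (x - y) = 0
      rw [dotProduct_sub, hj x hx, hj y hy, sub_self]
    · simp
    · intro x y _ _ hx hy
      rw [dotProduct_add, hx, hy, add_zero]
    · intro t x _ hx
      rw [dotProduct_smul, hx, smul_zero]
  have h2 : ∀ g, (∀ j ∈ J, intCast n (m j) ⬝ᵥ g = 0) → g ∈ vectorSpan ℝ σ := by
    intro g hg
    obtain ⟨x₀, hx₀⟩ := hne
    have hconv : Convex ℝ σ := by
      rw [hmc]
      simp only [Set.ofPred_forall]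
      refine convex_iInter fun j => ?_
      exact convex_halfSpace_ge ⟨fun x y => dotProduct_add _ _ _, fun t x => dotProduct_smul _ _ _⟩ _
    have hex : ∀ S : Finset (Fin N), ∃ x ∈ σ, ∀ j ∈ S, j ∉ J → c j < intCast n (m j) ⬝ᵥ x := by
      intro S
      induction S using Finset.induction_on with
      | empty => exact ⟨x₀, hx₀, by simp⟩
      | insert k S hk ih =>
        obtain ⟨x, hx, hxS⟩ := ih
        by_cases hkJ : k ∈ J
        · refine ⟨x, hx, fun j hj hjJ => ?_⟩
          rcases Finset.mem_insert.1 hj with rfl | hj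
          · exact absurd hkJ hjJ
          · exact hxS j hj hjJ
        · have : ∃ y ∈ σ, intCast n (m k) ⬝ᵥ y ≠ c k := by
            by_contra! hcon
            exact hkJ hcon
          obtain ⟨y, hy, hyk⟩ := this
          refine ⟨(1 / 2 : ℝ) • x + (1 / 2 : ℝ) • y, hconv hx hy (by norm_num) (by norm_num)
            (by norm_num), fun j hj hjJ => ?_⟩
          rw [dotProduct_add, dotProduct_smul, dotProduct_smul, smul_eq_mul, smul_eq_mul]
          have hxj := (hmem x).1 hx j
          have hyj := (hmem y).1 hy j
          rcases Finset.mem_insert.1 hj with rfl | hj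
          · have := lt_of_le_of_ne hyj (Ne.symm hyk)
            linarith
          · have := hxS j hj hjJ
            linarith
    obtain ⟨x, hx, hxs⟩ := hex Finset.univ
    have hev : ∀ j, ∀ᶠ ε in nhdsWithin (0 : ℝ) (Set.Ioi 0),
        c j ≤ intCast n (m j) ⬝ᵥ (x + ε • g) := by
      intro j
      by_cases hj : j ∈ J
      · refine Filter.Eventually.of_forall fun ε => ?_
        rw [dotProduct_add, dotProduct_smul, hg j hj, smul_zero, add_zero]
        exact (hmem x).1 hx j
      · have hcont : Continuous fun ε : ℝ => intCast n (m j) ⬝ᵥ (x + ε • g) := by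
          simp only [dotProduct_add, dotProduct_smul]
          fun_prop
        have hlt : c j < intCast n (m j) ⬝ᵥ (x + (0 : ℝ) • g) := by
          simpa using hxs j (Finset.mem_univ j) hj
        exact ((hcont.tendsto 0).eventually_const_le hlt).filter_mono nhdsWithin_le_nhds
    obtain ⟨ε, hε, hε0⟩ := ((Filter.eventually_all.2 hev).and self_mem_nhdsWithin).exists
    have hmem' := vsub_mem_vectorSpan ℝ ((hmem _).2 hε) hx
    rw [vsub_eq_sub, add_sub_cancel_left] at hmem'
    have := (vectorSpan ℝ σ).smul_mem ε⁻¹ hmem'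
    rwa [smul_smul, inv_mul_cancel₀ (ne_of_gt hε0), one_smul] at this
  intro g hg
  refine Submodule.span_mono (Set.image_mono ?_) (mem_span_integral_ker m J g (h1 g hg))
  intro w hw
  exact h2 _ hw

/-- A `p`-dimensional rational polyhedron has a lattice basis with `p` elements. -/
theorem exists_isLatticeBasis {n p : ℕ} {σ : Set (Fin n → ℝ)} (hσ : IsRationalPolyhedron σ)
    (hne : σ.Nonempty) (hp : dim σ = p) : ∃ v : Fin p → Fin n → ℤ, IsLatticeBasis σ v := by
  have hinj : Function.Injective (intCast n) := fun x y h => by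
    ext i
    have := congrFun h i
    simpa using this
  let b := Module.finBasis ℤ (lattice σ)
  let r := Module.finrank ℤ (lattice σ)
  let v : Fin r → Fin n → ℤ := fun k => b k
  have hvspan : Submodule.span ℤ (Set.range v) = lattice σ := by
    have : Set.range v = (lattice σ).subtype '' Set.range b := by
      rw [← Set.range_comp]
      rfl
    rw [this, Submodule.span_image, b.span_eq, Submodule.map_top, Submodule.range_subtype]
  have hvZ : LinearIndependent ℤ fun k => intCast n (v k) :=
    (b.linearIndependent.map' (lattice σ).subtype (Submodule.ker_subtype _)).map' (intCast n)
      (LinearMap.ker_eq_bot.2 hinj)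
  have hspanR : Submodule.span ℝ (Set.range fun k => intCast n (v k)) = vectorSpan ℝ σ := by
    rw [← span_lattice hσ hne, ← hvspan]
    refine le_antisymm (Submodule.span_mono ?_) (Submodule.span_le.2 ?_)
    · rintro _ ⟨k, rfl⟩
      exact ⟨v k, Submodule.subset_span ⟨k, rfl⟩, rfl⟩
    · rintro _ ⟨w, hw, rfl⟩
      refine Submodule.span_induction (p := fun w _ => intCast n w ∈
        Submodule.span ℝ (Set.range fun k => intCast n (v k))) ?_ ?_ ?_ ?_ hw
      · rintro _ ⟨k, rfl⟩
        exact Submodule.subset_span ⟨k, rfl⟩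
      · simp
      · intro x y _ _ hx hy
        rw [map_add]
        exact Submodule.add_mem _ hx hy
      · intro t x _ hx
        rw [map_zsmul]
        exact zsmul_mem hx t
  have hdisc : DiscreteTopology (Submodule.span ℤ (Set.range fun k => intCast n (v k))) := by
    have hd : DiscreteTopology
        (Submodule.span ℤ (Set.range (Pi.basisFun ℝ (Fin n)))) := inferInstance
    refine DiscreteTopology.of_subset (s := (Submodule.span ℤ (Set.range (Pi.basisFun ℝ (Fin n))) :
      Set (Fin n → ℝ))) hd ?_
    refine Submodule.span_le.2 ?_
    rintro _ ⟨k, rfl⟩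
    have : intCast n (v k) = ∑ i, v k i • Pi.basisFun ℝ (Fin n) i := by
      ext i
      simp [Finset.sum_apply, Pi.single_apply]
    change intCast n (v k) ∈ Submodule.span ℤ (Set.range (Pi.basisFun ℝ (Fin n)))
    rw [this]
    exact Submodule.sum_mem _ fun i _ => zsmul_mem (Submodule.subset_span (Set.mem_range_self i)) _
  have hrank := Real.finrank_eq_int_finrank_of_discrete hdisc
  have hZ : Set.finrank ℤ (Set.range fun k => intCast n (v k)) = r := by
    rw [Set.finrank, finrank_span_eq_card hvZ, Fintype.card_fin]
  have hr : r = p := by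
    rw [← hp, dim, ← hspanR]
    exact hZ.symm.trans hrank.symm
  have hvR : LinearIndependent ℝ fun k => intCast n (v k) := by
    rw [linearIndependent_iff_card_eq_finrank_span, hrank, hZ, Fintype.card_fin]
  refine ⟨fun k => v (Fin.cast hr.symm k), ?_, ?_⟩
  · exact hvR.comp _ (Fin.cast_injective hr.symm)
  · rw [← hvspan, ← (finCongr hr.symm).surjective.range_comp v]
    rfl

/-- `u` is the primitive generator in `N(τ)` of the ray `cone(σ - τ) / H_τ ⊆ ℝ^n / H_τ`: it is
primitive (so nonzero), and it has a representative in the cone `cone(σ - τ)`, which contains `H_τ`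
when `τ` is a codimension one face of `σ`. -/
structure IsPrimitiveGenerator {n : ℕ} (σ τ : Set (Fin n → ℝ)) (u : NormalLattice τ) : Prop where
  primitive : ∀ (k : ℤ) (u' : NormalLattice τ), u = k • u' → IsUnit k
  mem_cone : ∃ w : Fin n → ℤ, Submodule.Quotient.mk w = u ∧ intCast n w ∈ PointedCone.hull ℝ (σ - τ)

/-- The primitive generator `u_{σ/τ} ∈ N(τ)`, for a codimension one face `τ` of a rational
polyhedron `σ`. -/
def primitiveGenerator {n : ℕ} (σ τ : Set (Fin n → ℝ)) : NormalLattice τ :=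
  Classical.epsilon (IsPrimitiveGenerator σ τ)

/-! ### The currents attached to polyhedra

The real torus `(S^1)^n` is written additively as `(ℝ/ℤ)^n`, with its normalized Haar measure
`volume`; the point `θ` of `ℝ/ℤ` corresponds to `e^{2πiθ}`. Thus the angular measure on `S^1`, of total
mass `2π`, is `2π` times the normalized Haar measure. -/

/-- The point of `(ℂ^*)^n` with image `r` under `Log = (-log|z_1|, …, -log|z_n|)`, and with argument
`θ ∈ (S^1)^n`. -/
def polarPoint {n : ℕ} (r : Fin n → ℝ) (θ : UnitAddTorus (Fin n)) : Fin n → ℂ :=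
  fun i => (Real.exp (-r i) : ℂ) * (AddCircle.toCircle (θ i) : ℂ)

/-- The value at `z` of the invariant holomorphic vector field `∑ w_i z_i ∂/∂z_i`. -/
def invariantField {n : ℕ} (w : Fin n → ℤ) (z : Fin n → ℂ) : Fin n → ℂ := fun i => (w i : ℂ) * z i

/-- The parametrization of a fiber of `π_A : Log⁻¹(A) → S_{N(σ)}` for the affine subspace
`A = a + ℝv_1 + ⋯ + ℝv_p`, where `v` is a lattice basis. It is the monomial map
`(ℂ^*)^p → (ℂ^*)^n`, `z ↦ e^{-a} · x · z^{[v_1, …, v_p]}`, in polar coordinates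
`z_j = e^{-s_j + 2πi y_j}`; the fiber is the one over the image of `x ∈ (S^1)^n` in `S_{N(σ)}`. -/
def fiberPoint {n p : ℕ} (v : Fin p → Fin n → ℤ) (a : Fin n → ℝ) (x : UnitAddTorus (Fin n))
    (y : (Fin p → ℝ) × UnitAddTorus (Fin p)) : Fin n → ℂ :=
  polarPoint (a + ∑ j, y.1 j • intCast n (v j)) (fun i => x i + ∑ j, v j i • y.2 j)

/-- The positively oriented frame `(R_1, iR_1, …, R_p, iR_p)` of the fiber at its point `z`, where
`R_j = -∂/∂s_j` and `iR_j = (2π)⁻¹ ∂/∂y_j` are tangent to the `j`-th coordinate `z_j = e^{-s_j + 2πi y_j}`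
of the monomial parametrization. -/
def fiberFrame {n p : ℕ} (v : Fin p → Fin n → ℤ) (z : Fin n → ℂ) : Fin (2 * p) → Fin n → ℂ :=
  fun k => Complex.I ^ (k % 2 : ℕ) • invariantField (v ⟨k / 2, by omega⟩) z

/-- The part of the parameter space of a fiber which lies over `σ`. -/
def fiberDomain {n p : ℕ} (v : Fin p → Fin n → ℤ) (a : Fin n → ℝ) (σ : Set (Fin n → ℝ)) :
    Set ((Fin p → ℝ) × UnitAddTorus (Fin p)) :=
  {y | a + ∑ j, y.1 j • intCast n (v j) ∈ σ}

/-- The coordinatewise logarithm map. -/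
def Log {n : ℕ} (z : Fin n → ℂ) : Fin n → ℝ := fun i => -Real.log ‖z i‖

@[simp] theorem Log_polarPoint {n : ℕ} (r : Fin n → ℝ) (θ : UnitAddTorus (Fin n)) :
    Log (polarPoint r θ) = r := by
  ext i
  have h : ‖(AddCircle.toCircle (θ i) : ℂ)‖ = 1 := Circle.norm_coe _
  rw [Log, polarPoint, norm_mul, h, Complex.norm_real]
  simp

theorem continuousOn_Log (n : ℕ) : ContinuousOn (Log (n := n)) (torus n) := by
  unfold Log
  refine continuousOn_pi.2 fun i => (ContinuousOn.log (by fun_prop) ?_).neg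
  intro z hz
  exact norm_ne_zero_iff.2 (hz i)

theorem continuous_polarPoint {n : ℕ} :
    Continuous fun q : (Fin n → ℝ) × UnitAddTorus (Fin n) => polarPoint q.1 q.2 := by
  unfold polarPoint
  refine continuous_pi fun i => ?_
  have h : Continuous fun q : (Fin n → ℝ) × UnitAddTorus (Fin n) =>
      (AddCircle.toCircle (q.2 i) : ℂ) :=
    continuous_subtype_val.comp (AddCircle.continuous_toCircle.comp (by fun_prop))
  have h' : Continuous fun q : (Fin n → ℝ) × UnitAddTorus (Fin n) => (Real.exp (-q.1 i) : ℂ) := by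
    fun_prop
  exact h'.mul h

theorem exists_isCompact_of_linearIndependent {n p : ℕ} {v : Fin p → Fin n → ℤ}
    (hv : LinearIndependent ℝ fun j => intCast n (v j)) (a : Fin n → ℝ) {K : Set (Fin n → ℂ)}
    (hK : IsCompact K) (hKt : K ⊆ torus n) :
    ∃ L : Set (Fin p → ℝ), IsCompact L ∧
      ∀ s θ, polarPoint (a + ∑ j, s j • intCast n (v j)) θ ∈ K → s ∈ L := by
  let f : (Fin p → ℝ) →ₗ[ℝ] (Fin n → ℝ) := Fintype.linearCombination ℝ fun j => intCast n (v j)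
  have hf : Topology.IsClosedEmbedding f :=
    LinearMap.isClosedEmbedding_of_injective
      (LinearMap.ker_eq_bot.2 hv.fintypeLinearCombination_injective)
  have hK' : IsCompact (Log '' K) := hK.image_of_continuousOn ((continuousOn_Log n).mono hKt)
  have hK'' : IsCompact ((fun r => r - a) '' (Log '' K)) := hK'.image (by fun_prop)
  refine ⟨f ⁻¹' _, hf.isCompact_preimage hK'', ?_⟩
  intro s θ h
  refine ⟨_, ⟨_, h, Log_polarPoint _ _⟩, ?_⟩
  simp [f, Fintype.linearCombination_apply]

theorem continuous_fiberPoint {n p : ℕ} (v : Fin p → Fin n → ℤ) (a : Fin n → ℝ) :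
    Continuous fun q : UnitAddTorus (Fin n) × ((Fin p → ℝ) × UnitAddTorus (Fin p)) =>
      fiberPoint v a q.1 q.2 := by
  have h : Continuous fun q : UnitAddTorus (Fin n) × ((Fin p → ℝ) × UnitAddTorus (Fin p)) =>
      ((a + ∑ j, q.2.1 j • intCast n (v j), fun i => q.1 i + ∑ j, v j i • q.2.2 j) :
        (Fin n → ℝ) × UnitAddTorus (Fin n)) := by
    fun_prop
  exact continuous_polarPoint.comp h

@[fun_prop]
theorem continuous_invariantField {n : ℕ} (w : Fin n → ℤ) : Continuous (invariantField w) := by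
  unfold invariantField
  fun_prop

theorem continuous_fiberFrame {n p : ℕ} (v : Fin p → Fin n → ℤ) :
    Continuous (fiberFrame (n := n) v) := by
  unfold fiberFrame
  fun_prop

theorem properOver_fiberPoint {n p : ℕ} {v : Fin p → Fin n → ℤ}
    (hv : LinearIndependent ℝ fun j => intCast n (v j)) (a : Fin n → ℝ) :
    ProperOver fun q : UnitAddTorus (Fin n) × ((Fin p → ℝ) × UnitAddTorus (Fin p)) =>
      fiberPoint v a q.1 q.2 := by
  intro K hK hKt
  obtain ⟨L, hL, h⟩ := exists_isCompact_of_linearIndependent hv a hK hKt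
  exact ⟨L ×ˢ Set.univ, hL.prod isCompact_univ, fun q hq => ⟨h _ _ hq, trivial⟩⟩

/-- The current `φ ↦ ∫_{x ∈ (S^1)^n} (∫_{F_x ∩ Log⁻¹(σ)} φ) dx`, where `F_x` is the `p`-dimensional
complex submanifold parametrized by `fiberPoint v a x`. -/
def fiberAverage {n p : ℕ} (v : Fin p → Fin n → ℤ)
    (hv : LinearIndependent ℝ fun j => intCast n (v j)) (a : Fin n → ℝ) (σ : Set (Fin n → ℝ)) :
    Current n (2 * p) :=
  (2 * Real.pi : ℂ) ^ p • averageCurrent (continuous_fiberPoint v a)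
    ((continuous_fiberFrame v).comp (continuous_fiberPoint v a)) (properOver_fiberPoint hv a)
    volume (volume.restrict (fiberDomain v a σ))

theorem fiberAverage_apply {n p : ℕ} (v : Fin p → Fin n → ℤ)
    (hv : LinearIndependent ℝ fun j => intCast n (v j)) (a : Fin n → ℝ) (σ : Set (Fin n → ℝ))
    (φ : TestForm n (2 * p)) :
    fiberAverage v hv a σ φ = (2 * Real.pi : ℂ) ^ p * ∫ x, ∫ y in fiberDomain v a σ,
      φ (fiberPoint v a x y) (fiberFrame v (fiberPoint v a x y)) := rfl

open Classical in
/-- The `(p,p)`-dimensional current `𝒯_σ` on `(ℂ^*)^n` of a `p`-dimensional rational polyhedron `σ`: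
the average, over the compact torus `S_{N(σ)}` with its normalized Haar measure, of the integration
currents along the closures of the fibers of `π_σ : Log⁻¹(σ°) → S_{N(σ)}`. The normalized Haar measure
of `S_{N(σ)} = (S^1)^n / S_{H_σ ∩ ℤ^n}` is the image of that of `(S^1)^n`, so the average is taken over
`x ∈ (S^1)^n` of the integral along the fiber through `x`.
The result depends neither on the base point `a ∈ σ` nor on the lattice basis `v`, which exists by
`exists_isLatticeBasis`. -/
def polyhedronCurrent {n : ℕ} (p : ℕ) (σ : Set (Fin n → ℝ)) : Current n (2 * p) :=
  if h : σ.Nonempty ∧ ∃ v : Fin p → Fin n → ℤ, IsLatticeBasis σ v then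
    fiberAverage h.2.choose h.2.choose_spec.linearIndependent h.1.some σ
  else 0

theorem polyhedronCurrent_eq_zero {n p : ℕ} {σ : Set (Fin n → ℝ)} {K : Set (Fin n → ℂ)}
    (φ : TestForm n (2 * p)) (hφ : tsupport φ ⊆ K) (hσ : σ ∩ Log '' K = ∅) :
    polyhedronCurrent p σ φ = 0 := by
  unfold polyhedronCurrent
  split_ifs with h
  · rw [fiberAverage_apply]
    have (x : UnitAddTorus (Fin n)) (y) (hy : y ∈ fiberDomain h.2.choose h.1.some σ) :
        φ (fiberPoint h.2.choose h.1.some x y)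
          (fiberFrame h.2.choose (fiberPoint h.2.choose h.1.some x y)) = 0 := by
      have : φ (fiberPoint h.2.choose h.1.some x y) = 0 := by
        by_contra hne
        have hmem : h.1.some + ∑ j, y.1 j • intCast n (h.2.choose j) ∈ σ ∩ Log '' K :=
          ⟨hy, _, hφ (subset_tsupport _ hne), Log_polarPoint _ _⟩
        rw [hσ] at hmem
        exact hmem
      simp [this]
    simp only [fun x => setIntegral_eq_zero_of_forall_eq_zero (μ := volume) (this x)]
    simp
  · rfl

/-- The parametrization, by `t ∈ S^1` and a parameter `y` of the fiber, of the inverse image under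
`π_A` of the translate by `x` of the one-parameter subgroup `λ^w`. -/
def circlePoint {n q : ℕ} (v : Fin q → Fin n → ℤ) (a : Fin n → ℝ) (w : Fin n → ℤ)
    (x : UnitAddTorus (Fin n)) (y : UnitAddCircle × ((Fin q → ℝ) × UnitAddTorus (Fin q))) :
    Fin n → ℂ :=
  fiberPoint v a (fun i => x i + w i • y.1) y.2

/-- The positively oriented frame consisting of the velocity of `λ^w` followed by the frame of the
fiber. -/
def circleFrame {n q : ℕ} (v : Fin q → Fin n → ℤ) (w : Fin n → ℤ) (z : Fin n → ℂ) :
    Fin (2 * q + 1) → Fin n → ℂ :=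
  Fin.cons (Complex.I • invariantField w z) (fiberFrame v z)

theorem continuous_circlePoint {n q : ℕ} (v : Fin q → Fin n → ℤ) (a : Fin n → ℝ)
    (w : Fin n → ℤ) :
    Continuous fun r : UnitAddTorus (Fin n) ×
      (UnitAddCircle × ((Fin q → ℝ) × UnitAddTorus (Fin q))) => circlePoint v a w r.1 r.2 := by
  have h1 : Continuous fun r : UnitAddTorus (Fin n) ×
      (UnitAddCircle × ((Fin q → ℝ) × UnitAddTorus (Fin q))) =>
      (fun i => r.1 i + w i • r.2.1 : UnitAddTorus (Fin n)) :=
    continuous_pi fun i => ((continuous_apply i).comp continuous_fst).add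
      ((continuous_zsmul (w i)).comp (continuous_fst.comp continuous_snd))
  have h2 : Continuous fun r : UnitAddTorus (Fin n) ×
      (UnitAddCircle × ((Fin q → ℝ) × UnitAddTorus (Fin q))) => r.2.2 :=
    continuous_snd.comp continuous_snd
  have h3 := (continuous_fiberPoint v a).comp (h1.prodMk h2)
  unfold circlePoint
  exact h3

theorem continuous_circleFrame {n q : ℕ} (v : Fin q → Fin n → ℤ) (w : Fin n → ℤ) :
    Continuous (circleFrame v w) := by
  refine continuous_pi fun k => ?_
  unfold circleFrame
  refine Fin.cases ?_ (fun j => ?_) k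
  · simp only [Fin.cons_zero]
    fun_prop
  · simp only [Fin.cons_succ]
    exact (continuous_apply j).comp (continuous_fiberFrame v)

theorem properOver_circlePoint {n q : ℕ} {v : Fin q → Fin n → ℤ}
    (hv : LinearIndependent ℝ fun j => intCast n (v j)) (a : Fin n → ℝ) (w : Fin n → ℤ) :
    ProperOver fun r : UnitAddTorus (Fin n) ×
      (UnitAddCircle × ((Fin q → ℝ) × UnitAddTorus (Fin q))) => circlePoint v a w r.1 r.2 := by
  intro K hK hKt
  obtain ⟨L, hL, h⟩ := exists_isCompact_of_linearIndependent hv a hK hKt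
  exact ⟨Set.univ ×ˢ (L ×ˢ Set.univ), isCompact_univ.prod (hL.prod isCompact_univ),
    fun r hr => ⟨trivial, h _ _ hr, trivial⟩⟩

/-- The current `φ ↦ ∫_{x ∈ (S^1)^n} (∫_{G_x ∩ Log⁻¹(τ)} φ) dx`, where `G_x` is the
`(2q + 1)`-dimensional chain parametrized by `circlePoint v a w x`. -/
def circleAverage {n q : ℕ} (v : Fin q → Fin n → ℤ)
    (hv : LinearIndependent ℝ fun j => intCast n (v j)) (a : Fin n → ℝ) (w : Fin n → ℤ)
    (τ : Set (Fin n → ℝ)) : Current n (2 * q + 1) :=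
  (2 * Real.pi : ℂ) ^ (q + 1) • averageCurrent (continuous_circlePoint v a w)
    ((continuous_circleFrame v w).comp (continuous_circlePoint v a w))
    (properOver_circlePoint hv a w)
    volume (volume.restrict (Set.univ ×ˢ fiberDomain v a τ))

theorem circleAverage_apply {n q : ℕ} (v : Fin q → Fin n → ℤ)
    (hv : LinearIndependent ℝ fun j => intCast n (v j)) (a : Fin n → ℝ) (w : Fin n → ℤ)
    (τ : Set (Fin n → ℝ)) (φ : TestForm n (2 * q + 1)) :
    circleAverage v hv a w τ φ = (2 * Real.pi : ℂ) ^ (q + 1) *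
      ∫ x, ∫ y in Set.univ ×ˢ fiberDomain v a τ,
        φ (circlePoint v a w x y) (circleFrame v w (circlePoint v a w x y)) := rfl

open Classical in
/-- The current `𝒜_τ(u)` on `(ℂ^*)^n` of a `q`-dimensional rational polyhedron `τ` and `u ∈ N(τ)`: the
trivial extension of the pullback, along the submersion `π_τ : Log⁻¹(τ°) → S_{N(τ)}` with complex
fibers, of the average of the translates of the one-parameter subgroup `λ^u : S^1 → S_{N(τ)}`. The
result does not depend on the representative of `u` in `ℤ^n`. -/
def boundaryCurrent {n : ℕ} (q : ℕ) (τ : Set (Fin n → ℝ)) (u : NormalLattice τ) :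
    Current n (2 * q + 1) :=
  if h : τ.Nonempty ∧ ∃ v : Fin q → Fin n → ℤ, IsLatticeBasis τ v then
    circleAverage h.2.choose h.2.choose_spec.linearIndependent h.1.some (Quotient.out u) τ
  else 0

/-! ### Weighted complexes -/

/-- A `p`-dimensional weighted complex in `ℝ^n`: a locally finite polyhedral complex all of whose
inclusion-maximal cells are rational and `p`-dimensional, together with a complex weight for each of
its maximal cells. These are exactly its `p`-dimensional cells; only the values of `weight` on them
are ever used. -/
structure WeightedComplex (n p : ℕ) where
  /-- The cells. -/
  cells : Set (Set (Fin n → ℝ))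
  nonempty : ∀ σ ∈ cells, σ.Nonempty
  isPolyhedron : ∀ σ ∈ cells, IsPolyhedron σ
  face_mem : ∀ σ ∈ cells, ∀ τ, IsFace τ σ → τ ∈ cells
  inter_isFace : ∀ σ ∈ cells, ∀ τ ∈ cells, (σ ∩ τ).Nonempty → IsFace (σ ∩ τ) σ ∧ IsFace (σ ∩ τ) τ
  locallyFinite : ∀ K, IsCompact K → {σ ∈ cells | (σ ∩ K).Nonempty}.Finite
  isRational_of_maximal : ∀ σ, Maximal (· ∈ cells) σ → IsRationalPolyhedron σ
  dim_of_maximal : ∀ σ, Maximal (· ∈ cells) σ → dim σ = p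
  /-- The weights of the maximal cells. -/
  weight : Set (Fin n → ℝ) → ℂ

namespace WeightedComplex

variable {n p : ℕ} (C : WeightedComplex n p)

/-- The cells of dimension `d`. -/
def cellsOfDim (d : ℕ) : Set (Set (Fin n → ℝ)) := {σ ∈ C.cells | dim σ = d}

/-- The sum `∑_{σ ⊃ τ} w(σ) u_{σ/τ}` in `N(τ)_ℂ`, over the `p`-dimensional cells `σ` which contain
`τ` as a face. -/
def balancingSum (τ : Set (Fin n → ℝ)) : NormalSpace τ :=
  ∑ᶠ (σ) (_ : σ ∈ C.cellsOfDim p ∧ IsFace τ σ), C.weight σ ⊗ₜ[ℤ] primitiveGenerator σ τ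

/-- `C` satisfies the balancing condition at each of its cells of codimension one. -/
def IsBalanced : Prop := ∀ τ ∈ C.cells, dim τ + 1 = p → C.balancingSum τ = 0

theorem finite_meeting {K : Set (Fin n → ℂ)} (hK : IsCompact K) (hKt : K ⊆ torus n) :
    {σ ∈ C.cellsOfDim p | (σ ∩ Log '' K).Nonempty}.Finite :=
  (C.locallyFinite _ (hK.image_of_continuousOn ((continuousOn_Log n).mono hKt))).subset
    fun _ h => ⟨h.1.1, h.2⟩

/-- The current `𝒯_C = ∑ w(σ) 𝒯_σ`, a sum over the `p`-dimensional cells of `C`. By local finiteness,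
the sum is finite on each test form. -/
def current : Current n (2 * p) :=
  TestFunction.limitCLM ℂ
    (fun φ => ∑ᶠ (σ) (_ : σ ∈ C.cellsOfDim p), C.weight σ * polyhedronCurrent p σ φ)
    (fun K hK => ∑ σ ∈ (C.finite_meeting K.isCompact hK).toFinset,
      C.weight σ • (polyhedronCurrent p σ).comp (TestFunction.ofSupportedInCLM ℂ hK))
    (fun K hK f => by
      rw [sum_apply]
      simp only [smul_apply, ContinuousLinearMap.comp_apply, smul_eq_mul]
      refine finsum_mem_eq_sum_of_inter_support_eq _ ?_
      ext σ
      simp only [Set.mem_inter_iff, Function.mem_support, Finset.mem_coe, Set.Finite.mem_toFinset,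
        Set.mem_ofPred_eq]
      refine ⟨fun h => ⟨⟨h.1, ?_⟩, h.2⟩, fun h => ⟨h.1.1, h.2⟩⟩
      by_contra hne
      refine h.2 ?_
      change C.weight σ * polyhedronCurrent p σ (TestFunction.ofSupportedIn hK f) = 0
      rw [polyhedronCurrent_eq_zero (K := K), mul_zero]
      · exact f.tsupport_subset
      · exact Set.not_nonempty_iff_eq_empty.1 hne)

theorem current_apply (φ : TestForm n (2 * p)) :
    C.current φ = ∑ᶠ (σ) (_ : σ ∈ C.cellsOfDim p), C.weight σ * polyhedronCurrent p σ φ := rfl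

end WeightedComplex

end TropCurr

end

/-!
The current of a polyhedron `σ` with lattice basis `v` is an average over all translates by the
compact torus, so its value on a form `φ` is, up to a power of `2π`, the integral over `σ`, with the
lattice measure, of the function `mean (invEval φ X)`: here `X = (v_1, iv_1, …, v_p, iv_p)`,
`invEval φ X` is the value of `φ` on the corresponding invariant vector fields and `mean` is the
average over the fibers of `Log` (`fiberAverage_eq`). The currents `𝒜_τ(w)` have the same shape for
the frame `(iw, v_1, iv_1, …, v_q, iv_q)` (`circleAverage_eq`).

*The boundary formula.* Invariant fields commute, so `invEval (dφ) X` is an alternating sum of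
derivatives of functions `invEval φ X'` along invariant fields (`invEval_d`). Derivatives along the
compact torus have mean zero, hence taking means turns these into derivatives along `σ` in the real
directions of `X` (`hasLineDerivAt_mean`). Integration by parts against a product of smooth cutoff
functions, one for each facet of `σ` (`FacetSystem.cutoff`), gives Stokes' theorem in the limit
(`FacetSystem.setIntegral_mean_d`): the derivative of the cutoff concentrates on the facets, and in
a lattice basis `(w, v)` of `σ` adapted to the facet `τ` the surviving term is the integral over `τ`
for the frame `(iw, v_1, iv_1, …)`, that is, `𝒜_τ(u_{σ/τ})` (`polyhedronCurrent_d`). Summing over the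
cells of a complex yields its boundary (`WeightedComplex.current_d`).

*Injectivity and the balancing condition.* Testing `𝒜_τ(c)` against a bump function times the
invariant decomposable form dual to the frame returns a nonzero multiple of any given coordinate of
`c`. The bump function may be supported over an arbitrarily small neighbourhood of a relative
interior point of `τ` (`eq_zero_of_boundaryMap`), where no other cell of the same dimension
interferes; so the currents of distinct cells `τ` are independent, and `d𝒯_C = 0` forces each
balancing sum to vanish.
-/

noncomputable section

namespace TropCurr

/-! ### Averages over the compact torus -/

instance isProbabilityMeasure_unitAddCircle :
    IsProbabilityMeasure (volume : Measure UnitAddCircle) :=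
  ⟨UnitAddCircle.measure_univ⟩

instance isProbabilityMeasure_unitAddTorus (n : ℕ) :
    IsProbabilityMeasure (volume : Measure (UnitAddTorus (Fin n))) := by
  rw [volume_pi]
  infer_instance

/-- Differentiation under the integral sign over a compact space. -/
theorem hasDerivAt_integral_of_compactSpace {T : Type*} [TopologicalSpace T] [CompactSpace T]
    [SecondCountableTopology T] [MeasurableSpace T] [BorelSpace T] (μ : Measure T)
    [IsFiniteMeasure μ] {F F' : ℝ → T → ℂ} (hF : Continuous F.uncurry)
    (hF' : Continuous F'.uncurry) (hd : ∀ t x, HasDerivAt (fun t => F t x) (F' t x) t) (t₀ : ℝ) :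
    HasDerivAt (fun t => ∫ x, F t x ∂μ) (∫ x, F' t₀ x ∂μ) t₀ := by
  have hc : ∀ {G : ℝ → T → ℂ}, Continuous G.uncurry → ∀ t, Continuous (G t) := fun hG t =>
    hG.comp (by fun_prop : Continuous fun x : T => (t, x))
  obtain ⟨C, hC⟩ := ((isCompact_Icc (a := t₀ - 1) (b := t₀ + 1)).prod
    (isCompact_univ (X := T))).exists_bound_of_continuousOn hF'.continuousOn
  refine (hasDerivAt_integral_of_dominated_loc_of_deriv_le (μ := μ) (bound := fun _ => C)
    (Icc_mem_nhds (by linarith) (by linarith) : Set.Icc (t₀ - 1) (t₀ + 1) ∈ nhds t₀)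
    (Filter.Eventually.of_forall fun t => (hc hF t).aestronglyMeasurable) ?_
    (hc hF' t₀).aestronglyMeasurable
    (Filter.Eventually.of_forall fun x t ht => hC (t, x) ⟨ht, trivial⟩)
    (integrable_const _) (Filter.Eventually.of_forall fun x t _ => hd t x)).2
  exact (hc hF t₀).integrable_of_hasCompactSupport (HasCompactSupport.of_compactSpace _)

theorem polarPoint_mem_torus {n : ℕ} (r : Fin n → ℝ) (x : UnitAddTorus (Fin n)) :
    polarPoint r x ∈ torus n := fun i =>
  mul_ne_zero (by exact_mod_cast (Real.exp_pos _).ne') (Circle.coe_ne_zero _)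

theorem hasDerivAt_polarPoint_add_smul {n : ℕ} (r h : Fin n → ℝ) (x : UnitAddTorus (Fin n))
    (t : ℝ) :
    HasDerivAt (fun t : ℝ => polarPoint (r + t • h) x)
      (-((fun i => (h i : ℂ)) * polarPoint (r + t • h) x)) t := by
  refine hasDerivAt_pi.2 fun i => ?_
  have h1 : HasDerivAt (fun t : ℝ => Real.exp (-(r i + t * h i)))
      (Real.exp (-(r i + t * h i)) * -(h i)) t := by
    have := (((hasDerivAt_id t).mul_const (h i)).const_add (r i)).neg.exp
    simpa using this
  have h2 := h1.ofReal_comp.mul_const (AddCircle.toCircle (x i) : ℂ)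
  refine h2.congr_deriv ?_
  simp only [Pi.neg_apply, Pi.mul_apply, polarPoint, Pi.add_apply, Pi.smul_apply, smul_eq_mul]
  push_cast
  ring

/-- Rotation by the angles `t h`, for the normalization `θ ↦ e^{2πiθ}` of the circle. -/
def rotation {n : ℕ} (h : Fin n → ℝ) (t : ℝ) : UnitAddTorus (Fin n) :=
  fun i => ((t * h i / (2 * Real.pi) : ℝ) : UnitAddCircle)

theorem continuous_rotation {n : ℕ} (h : Fin n → ℝ) : Continuous (rotation h) := by
  unfold rotation
  refine continuous_pi fun i => (AddCircle.continuous_mk' 1).comp ?_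
  fun_prop

theorem polarPoint_add_rotation {n : ℕ} (r h : Fin n → ℝ) (x : UnitAddTorus (Fin n)) (t : ℝ) :
    polarPoint r (x + rotation h t) =
      (fun i => Complex.exp (t * h i * Complex.I)) * polarPoint r x := by
  ext i
  have : (AddCircle.toCircle (rotation h t i) : ℂ) = Complex.exp (t * h i * Complex.I) := by
    rw [rotation, AddCircle.toCircle_apply_mk, Circle.coe_exp]
    congr 2
    have := Real.pi_ne_zero
    push_cast
    field_simp
  simp only [polarPoint, Pi.add_apply, Pi.mul_apply, AddCircle.toCircle_add, Circle.coe_mul, this]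
  ring

theorem hasDerivAt_polarPoint_add_rotation {n : ℕ} (r h : Fin n → ℝ) (x : UnitAddTorus (Fin n))
    (t : ℝ) :
    HasDerivAt (fun t : ℝ => polarPoint r (x + rotation h t))
      ((fun i => (h i : ℂ) * Complex.I) * polarPoint r (x + rotation h t)) t := by
  simp only [polarPoint_add_rotation]
  refine hasDerivAt_pi.2 fun i => ?_
  have h1 : HasDerivAt (fun t : ℝ => Complex.exp ((t : ℂ) * h i * Complex.I))
      (Complex.exp ((t : ℂ) * h i * Complex.I) * (h i * Complex.I)) t := by
    have h0 : HasDerivAt (fun t : ℝ => (t : ℂ) * h i * Complex.I) (1 * h i * Complex.I) t :=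
      ((Complex.ofRealCLM.hasDerivAt (x := t)).mul_const _).mul_const _
    simpa using h0.cexp
  have h2 := h1.mul_const (polarPoint r x i)
  refine h2.congr_deriv ?_
  simp only [Pi.mul_apply]
  ring

/-- The mean of a function over the fiber of `Log` over `r`, a translate of the compact torus. -/
def mean {n : ℕ} (f : (Fin n → ℂ) → ℂ) (r : Fin n → ℝ) : ℂ :=
  ∫ x : UnitAddTorus (Fin n), f (polarPoint r x)

@[fun_prop]
theorem continuous_polarPoint_right {n : ℕ} (r : Fin n → ℝ) :
    Continuous fun x : UnitAddTorus (Fin n) => polarPoint r x :=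
  continuous_polarPoint.comp (by fun_prop : Continuous fun x : UnitAddTorus (Fin n) => (r, x))

theorem continuous_mean {n : ℕ} {f : (Fin n → ℂ) → ℂ} (hf : Continuous f) :
    Continuous (mean f) := by
  have := continuous_parametric_integral_of_continuous (μ := volume)
    (f := fun (r : Fin n → ℝ) (x : UnitAddTorus (Fin n)) => f (polarPoint r x))
    (hf.comp continuous_polarPoint) isCompact_univ
  simp only [Measure.restrict_univ] at this
  exact this

theorem integrable_polarPoint {n : ℕ} {f : (Fin n → ℂ) → ℂ} (hf : Continuous f)
    (r : Fin n → ℝ) : Integrable fun x : UnitAddTorus (Fin n) => f (polarPoint r x) :=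
  (hf.comp (continuous_polarPoint_right r)).integrable_of_hasCompactSupport
    (HasCompactSupport.of_compactSpace _)

theorem mean_add {n : ℕ} {f g : (Fin n → ℂ) → ℂ} (hf : Continuous f) (hg : Continuous g)
    (r : Fin n → ℝ) : mean (fun z => f z + g z) r = mean f r + mean g r :=
  integral_add (integrable_polarPoint hf r) (integrable_polarPoint hg r)

theorem mean_sum {n : ℕ} {ι : Type*} (s : Finset ι) {f : ι → (Fin n → ℂ) → ℂ}
    (hf : ∀ i, Continuous (f i)) (r : Fin n → ℝ) :
    mean (fun z => ∑ i ∈ s, f i z) r = ∑ i ∈ s, mean (f i) r :=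
  integral_finsetSum s fun i _ => integrable_polarPoint (hf i) r

theorem mean_const_mul {n : ℕ} (c : ℂ) (f : (Fin n → ℂ) → ℂ) (r : Fin n → ℝ) :
    mean (fun z => c * f z) r = c * mean f r := integral_const_mul _ _

/-- The mean vanishes over points outside the image of the support. -/
theorem mean_eq_zero {n : ℕ} {f : (Fin n → ℂ) → ℂ} {K : Set (Fin n → ℂ)}
    (hf : ∀ z ∉ K, f z = 0) {r : Fin n → ℝ} (hr : r ∉ Log '' K) : mean f r = 0 := by
  have : ∀ x : UnitAddTorus (Fin n), f (polarPoint r x) = 0 := fun x =>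
    hf _ fun hx => hr ⟨_, hx, Log_polarPoint _ _⟩
  simp [mean, this]

theorem isCompact_Log_image {n : ℕ} {K : Set (Fin n → ℂ)} (hK : IsCompact K)
    (hKt : K ⊆ torus n) : IsCompact (Log '' K) :=
  hK.image_of_continuousOn ((continuousOn_Log n).mono hKt)

theorem hasCompactSupport_mean {n : ℕ} {f : (Fin n → ℂ) → ℂ} {K : Set (Fin n → ℂ)}
    (hK : IsCompact K) (hKt : K ⊆ torus n) (hf : ∀ z ∉ K, f z = 0) :
    HasCompactSupport (mean f) :=
  HasCompactSupport.intro (isCompact_Log_image hK hKt) fun _ hr => mean_eq_zero hf hr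

theorem continuous_fderiv_invariant {n : ℕ} {f : (Fin n → ℂ) → ℂ} (hf : ContDiff ℝ 1 f)
    (X : Fin n → ℂ) : Continuous fun z => fderiv ℝ f z (X * z) :=
  (hf.continuous_fderiv one_ne_zero).clm_apply (by fun_prop)

theorem hasDerivAt_mean {n : ℕ} {f : (Fin n → ℂ) → ℂ} (hf : ContDiff ℝ 1 f) (r h : Fin n → ℝ)
    (t : ℝ) :
    HasDerivAt (fun t : ℝ => mean f (r + t • h))
      (-mean (fun z => fderiv ℝ f z ((fun i => (h i : ℂ)) * z)) (r + t • h)) t := by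
  have hp : Continuous fun q : ℝ × UnitAddTorus (Fin n) => polarPoint (r + q.1 • h) q.2 :=
    continuous_polarPoint.comp (by fun_prop :
      Continuous fun q : ℝ × UnitAddTorus (Fin n) => (r + q.1 • h, q.2))
  have key := hasDerivAt_integral_of_compactSpace (volume : Measure (UnitAddTorus (Fin n)))
    (F := fun t x => f (polarPoint (r + t • h) x))
    (F' := fun t x => -fderiv ℝ f (polarPoint (r + t • h) x)
      ((fun i => (h i : ℂ)) * polarPoint (r + t • h) x))
    (hf.continuous.comp hp) ((continuous_fderiv_invariant hf _).comp hp).neg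
    (fun t x => by
      have := ((hf.differentiable one_ne_zero _).hasFDerivAt).comp_hasDerivAt t
        (hasDerivAt_polarPoint_add_smul r h x t)
      rwa [map_neg] at this) t
  simpa only [mean, integral_neg] using key

/-- Derivatives in the angular directions have mean zero. -/
theorem mean_fderiv_angular {n : ℕ} {f : (Fin n → ℂ) → ℂ} (hf : ContDiff ℝ 1 f)
    (r h : Fin n → ℝ) :
    mean (fun z => fderiv ℝ f z ((fun i => (h i : ℂ) * Complex.I) * z)) r = 0 := by
  have hp : Continuous fun q : ℝ × UnitAddTorus (Fin n) => polarPoint r (q.2 + rotation h q.1) :=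
    (continuous_polarPoint_right r).comp
      (continuous_snd.add ((continuous_rotation h).comp continuous_fst))
  have key := hasDerivAt_integral_of_compactSpace (volume : Measure (UnitAddTorus (Fin n)))
    (F := fun t x => f (polarPoint r (x + rotation h t)))
    (F' := fun t x => fderiv ℝ f (polarPoint r (x + rotation h t))
      ((fun i => (h i : ℂ) * Complex.I) * polarPoint r (x + rotation h t)))
    (hf.continuous.comp hp) ((continuous_fderiv_invariant hf _).comp hp)
    (fun t x => ((hf.differentiable one_ne_zero _).hasFDerivAt).comp_hasDerivAt t
        (hasDerivAt_polarPoint_add_rotation r h x t)) 0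
  have e1 : ∀ t, ∫ x, f (polarPoint r (x + rotation h t)) = mean f r := fun t =>
    integral_add_right_eq_self (fun x => f (polarPoint r x)) (rotation h t)
  have e2 := integral_add_right_eq_self (μ := (volume : Measure (UnitAddTorus (Fin n))))
    (fun x => fderiv ℝ f (polarPoint r x)
      ((fun i => (h i : ℂ) * Complex.I) * polarPoint r x)) (rotation h 0)
  simp only [e1] at key
  exact e2.symm.trans (key.unique (hasDerivAt_const 0 _))

/-- The mean of the derivative along an invariant vector field only sees its radial part. -/
theorem mean_fderiv_eq {n : ℕ} {f : (Fin n → ℂ) → ℂ} (hf : ContDiff ℝ 1 f) (X : Fin n → ℂ)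
    (r : Fin n → ℝ) :
    mean (fun z => fderiv ℝ f z (X * z)) r =
      mean (fun z => fderiv ℝ f z ((fun i => ((X i).re : ℂ)) * z)) r := by
  have hX : ∀ z : Fin n → ℂ, fderiv ℝ f z (X * z) =
      fderiv ℝ f z ((fun i => ((X i).re : ℂ)) * z) +
        fderiv ℝ f z ((fun i => ((X i).im : ℂ) * Complex.I) * z) := by
    intro z
    rw [← map_add, ← add_mul]
    congr 2
    ext i
    exact (Complex.re_add_im _).symm
  simp only [hX]
  rw [mean_add (continuous_fderiv_invariant hf _) (continuous_fderiv_invariant hf _),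
    mean_fderiv_angular hf r (fun i => (X i).im), add_zero]

/-- The derivative of the mean in the direction `Re X` is the mean of the derivative along the
invariant field of `X`. The sign comes from `|z| = e^{-r}` at points `z` with `Log z = r`. -/
theorem hasLineDerivAt_mean {n : ℕ} {f : (Fin n → ℂ) → ℂ} (hf : ContDiff ℝ 1 f)
    (X : Fin n → ℂ) (r : Fin n → ℝ) :
    HasLineDerivAt ℝ (mean f) (-mean (fun z => fderiv ℝ f z (X * z)) r) r
      (fun i => (X i).re) := by
  have := hasDerivAt_mean hf r (fun i => (X i).re) 0
  rw [mean_fderiv_eq hf]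
  simpa [HasLineDerivAt] using this

/-! ### Forms evaluated on invariant vector fields -/

/-- The function `z ↦ φ_z(X_1 z, …, X_k z)`: the values of a form on the invariant vector fields
`∑ X_{ji} z_i ∂/∂z_i`. -/
def invEval {n k : ℕ} (φ : (Fin n → ℂ) → (Fin n → ℂ) [⋀^Fin k]→L[ℝ] ℂ)
    (X : Fin k → Fin n → ℂ) (z : Fin n → ℂ) : ℂ := φ z fun j => X j * z

theorem contDiff_invEval {n k : ℕ} (φ : TestForm n k) (X : Fin k → Fin n → ℂ) :
    ContDiff ℝ 1 (invEval φ X) := by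
  have hφ : ContDiff ℝ 1 φ := φ.contDiff.of_le (by exact_mod_cast le_top)
  have hm : ContDiff ℝ 1 fun z : Fin n → ℂ => fun j => X j * z := by
    refine contDiff_pi.2 fun j => contDiff_const.mul contDiff_id
  have hev : ContDiff ℝ 1 fun q : ((Fin n → ℂ) [⋀^Fin k]→L[ℝ] ℂ) × (Fin k → Fin n → ℂ) =>
      q.1 q.2 := by
    refine contDiff_iff_contDiffAt.2 fun q => AnalyticAt.contDiffAt ?_
    exact ContinuousLinearMap.analyticAt_uncurry_of_multilinear
      (ContinuousAlternatingMap.toContinuousMultilinearMapLI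
        (𝕜 := ℝ) (E := Fin n → ℂ) (F := ℂ) (ι := Fin k)).toContinuousLinearMap
  exact hev.comp (hφ.prodMk hm)

theorem invEval_eq_zero {n k : ℕ} (φ : TestForm n k) (X : Fin k → Fin n → ℂ) {z : Fin n → ℂ}
    (hz : z ∉ tsupport φ) : invEval φ X z = 0 := by
  rw [invEval, image_eq_zero_of_notMem_tsupport hz]
  rfl

/-- The exterior derivative on invariant vector fields: they commute, so the terms with Lie brackets
are absent. -/
theorem invEval_d {n k : ℕ} (φ : TestForm n k) (X : Fin (k + 1) → Fin n → ℂ) (z : Fin n → ℂ) :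
    invEval (TestForm.d n k φ) X z =
      ∑ i, (-1) ^ i.val * fderiv ℝ (invEval φ (i.removeNth X)) z (X i * z) := by
  rw [invEval, TestForm.d_apply]
  have h := extDeriv_apply_vectorField_of_pairwise_commute (𝕜 := ℝ) (x := z) (ω := φ)
    (V := fun i z => X i * z)
    ((φ.contDiff.differentiable (by simp)) z) (fun i => by fun_prop) (by
      intro i j _
      have hd : ∀ i, fderiv ℝ (fun z => X i * z) z = ContinuousLinearMap.mul ℝ _ (X i) := fun i =>
        (ContinuousLinearMap.mul ℝ (Fin n → ℂ) (X i)).fderiv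
      rw [VectorField.lieBracket, hd, hd]
      simp only [ContinuousLinearMap.mul_apply']
      ring)
  rw [h]
  refine Finset.sum_congr rfl fun i _ => ?_
  rw [zsmul_eq_mul]
  push_cast
  rfl

/-! ### The currents as integrals over polyhedra -/

/-- The point of the affine space `a + ℝv_1 + ⋯ + ℝv_p` with coordinates `s`. -/
def chart {n p : ℕ} (v : Fin p → Fin n → ℤ) (a : Fin n → ℝ) (s : Fin p → ℝ) : Fin n → ℝ :=
  a + ∑ j, s j • intCast n (v j)

@[fun_prop]
theorem continuous_chart {n p : ℕ} (v : Fin p → Fin n → ℤ) (a : Fin n → ℝ) :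
    Continuous (chart v a) := by
  unfold chart
  fun_prop

/-- The constant frame `(v_1, iv_1, …, v_p, iv_p)`. -/
def latticeFrame {n p : ℕ} (v : Fin p → Fin n → ℤ) : Fin (2 * p) → Fin n → ℂ :=
  fun k i => Complex.I ^ (k % 2 : ℕ) * (v ⟨k / 2, by omega⟩ i : ℂ)

theorem fiberFrame_eq {n p : ℕ} (v : Fin p → Fin n → ℤ) (z : Fin n → ℂ) :
    fiberFrame v z = fun k => latticeFrame v k * z := by
  ext k i
  simp [fiberFrame, latticeFrame, invariantField, mul_assoc]

/-- The constant vector `iw`. -/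
def imVec {n : ℕ} (w : Fin n → ℤ) : Fin n → ℂ := fun i => Complex.I * (w i : ℂ)

theorem circleFrame_eq {n q : ℕ} (v : Fin q → Fin n → ℤ) (w : Fin n → ℤ) (z : Fin n → ℂ) :
    circleFrame v w z = fun k => (Fin.cons (imVec w) (latticeFrame v) :
      Fin (2 * q + 1) → Fin n → ℂ) k * z := by
  ext k i
  refine Fin.cases ?_ (fun k => ?_) k
  · simp [circleFrame, imVec, invariantField, mul_assoc]
  · simp [circleFrame, fiberFrame_eq]

/-- Averaging over all translates in the torus removes the angular parameters of a chain. -/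
theorem integral_integral_translate {n : ℕ} {S Y : Type*} [MeasurableSpace S] [MeasurableSpace Y]
    {ν : Measure S} {μ : Measure Y} [SFinite μ] {π : Y → S}
    (hπ : MeasurePreserving π μ ν) (c : Y → UnitAddTorus (Fin n))
    (f : S → UnitAddTorus (Fin n) → ℂ)
    (hm : AEStronglyMeasurable (fun s => ∫ x, f s x) ν)
    (hf : Integrable (fun q : UnitAddTorus (Fin n) × Y => f (π q.2) (q.1 + c q.2))
      (volume.prod μ)) :
    ∫ x, ∫ y, f (π y) (x + c y) ∂μ = ∫ s, (∫ x, f s x) ∂ν := by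
  rw [integral_integral_swap hf]
  have : ∀ y, ∫ x, f (π y) (x + c y) = ∫ x, f (π y) x := fun y =>
    integral_add_right_eq_self (fun x => f (π y) x) (c y)
  simp only [this]
  conv_rhs => rw [← hπ.map_eq]
  rw [integral_map hπ.measurable.aemeasurable]
  rwa [hπ.map_eq]

/-- The current of a polyhedron as an integral of means over the fibers of `Log`. -/
theorem fiberAverage_eq {n p : ℕ} (v : Fin p → Fin n → ℤ)
    (hv : LinearIndependent ℝ fun j => intCast n (v j)) (a : Fin n → ℝ) (σ : Set (Fin n → ℝ))
    (φ : TestForm n (2 * p)) :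
    fiberAverage v hv a σ φ = (2 * Real.pi : ℂ) ^ p *
      ∫ s in chart v a ⁻¹' σ, mean (invEval φ (latticeFrame v)) (chart v a s) := by
  rw [fiberAverage_apply]
  congr 1
  have hdom : fiberDomain v a σ = (chart v a ⁻¹' σ) ×ˢ Set.univ := by
    ext y
    simp [fiberDomain, chart]
  have hcont := (contDiff_invEval φ (latticeFrame v)).continuous
  have hμ : (volume : Measure ((Fin p → ℝ) × UnitAddTorus (Fin p))).restrict (fiberDomain v a σ) =
      (volume.restrict (chart v a ⁻¹' σ)).prod volume := by
    rw [hdom, Measure.volume_eq_prod, ← Measure.prod_restrict, Measure.restrict_univ]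
  have key := integral_integral_translate (n := n)
    (π := (Prod.fst : (Fin p → ℝ) × UnitAddTorus (Fin p) → (Fin p → ℝ)))
    (measurePreserving_fst (μ := volume.restrict (chart v a ⁻¹' σ))
      (ν := (volume : Measure (UnitAddTorus (Fin p)))))
    (fun y i => ∑ j, v j i • y.2 j)
    (fun s x => invEval φ (latticeFrame v) (polarPoint (chart v a s) x))
    ((continuous_mean hcont).comp (continuous_chart v a)).aestronglyMeasurable (by
      rw [← hμ]
      have := integrable_integrand (continuous_fiberPoint v a)
        ((continuous_fiberFrame v).comp (continuous_fiberPoint v a)) (properOver_fiberPoint hv a)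
        volume (volume.restrict (fiberDomain v a σ)) φ
      simp only [Function.comp_def, fiberFrame_eq] at this
      exact this)
  rw [hμ]
  simp only [fiberFrame_eq]
  exact key

/-- The analogue of `fiberAverage_eq` for the chains swept out by translates of a one-parameter
subgroup, whose angular parameter is removed by the averaging as well. -/
theorem circleAverage_eq {n q : ℕ} (v : Fin q → Fin n → ℤ)
    (hv : LinearIndependent ℝ fun j => intCast n (v j)) (a : Fin n → ℝ) (w : Fin n → ℤ)
    (τ : Set (Fin n → ℝ)) (φ : TestForm n (2 * q + 1)) :
    circleAverage v hv a w τ φ = (2 * Real.pi : ℂ) ^ (q + 1) *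
      ∫ s in chart v a ⁻¹' τ,
        mean (invEval φ (Fin.cons (imVec w) (latticeFrame v))) (chart v a s) := by
  rw [circleAverage_apply]
  congr 1
  have hdom : fiberDomain v a τ = (chart v a ⁻¹' τ) ×ˢ Set.univ := by
    ext y
    simp [fiberDomain, chart]
  have hcont := (contDiff_invEval φ (Fin.cons (imVec w) (latticeFrame v))).continuous
  have hμ : (volume : Measure (UnitAddCircle × ((Fin q → ℝ) × UnitAddTorus (Fin q)))).restrict
      (Set.univ ×ˢ fiberDomain v a τ) =
      volume.prod ((volume.restrict (chart v a ⁻¹' τ)).prod volume) := by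
    rw [hdom, Measure.volume_eq_prod, ← Measure.prod_restrict, Measure.restrict_univ,
      Measure.volume_eq_prod, ← Measure.prod_restrict, Measure.restrict_univ]
  have key := integral_integral_translate (n := n)
    (π := fun y : UnitAddCircle × ((Fin q → ℝ) × UnitAddTorus (Fin q)) => y.2.1)
    ((measurePreserving_fst (μ := volume.restrict (chart v a ⁻¹' τ))
      (ν := (volume : Measure (UnitAddTorus (Fin q))))).comp
      (measurePreserving_snd (μ := (volume : Measure UnitAddCircle))))
    (fun y i => w i • y.1 + ∑ j, v j i • y.2.2 j)
    (fun s x => invEval φ (Fin.cons (imVec w) (latticeFrame v)) (polarPoint (chart v a s) x))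
    ((continuous_mean hcont).comp (continuous_chart v a)).aestronglyMeasurable (by
      rw [← hμ]
      have := integrable_integrand (continuous_circlePoint v a w)
        ((continuous_circleFrame v w).comp (continuous_circlePoint v a w))
        (properOver_circlePoint hv a w)
        volume (volume.restrict (Set.univ ×ˢ fiberDomain v a τ)) φ
      simp only [Function.comp_def, circleFrame_eq] at this
      simp only [circlePoint, fiberPoint, add_assoc] at this
      exact this)
  rw [hμ]
  simp only [circleFrame_eq]
  refine Eq.trans ?_ key
  simp only [circlePoint, fiberPoint, add_assoc]
  rfl

/-! ### Change of lattice basis -/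

/-- The values of a form at `z` on invariant vector fields, as an alternating form on `ℂ^n`. -/
def invForm {n k : ℕ} (φ : (Fin n → ℂ) → (Fin n → ℂ) [⋀^Fin k]→L[ℝ] ℂ) (z : Fin n → ℂ) :
    (Fin n → ℂ) [⋀^Fin k]→L[ℝ] ℂ :=
  (φ z).compContinuousLinearMap ((ContinuousLinearMap.mul ℝ (Fin n → ℂ)).flip z)

theorem invForm_apply {n k : ℕ} (φ : (Fin n → ℂ) → (Fin n → ℂ) [⋀^Fin k]→L[ℝ] ℂ)
    (X : Fin k → Fin n → ℂ) (z : Fin n → ℂ) : invForm φ z X = invEval φ X z := rfl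

/-- On linear combinations of the vectors `b`, an alternating map takes its value at `b` times the
determinant of the coefficients. -/
theorem alternating_map_matrix {E : Type*} [AddCommGroup E] [Module ℝ E] {ι : Type*} [Fintype ι]
    [DecidableEq ι] (Ψ : E [⋀^ι]→ₗ[ℝ] ℂ) (M : Matrix ι ι ℝ) (b : ι → E) :
    Ψ (fun i => ∑ j, M i j • b j) = M.det • Ψ b := by
  let L : (ι → ℝ) →ₗ[ℝ] E := Fintype.linearCombination ℝ b
  have h : Ψ.compLinearMap L =
      (LinearMap.toSpanSingleton ℝ ℂ (Ψ b)).compAlternatingMap (Pi.basisFun ℝ ι).det := by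
    refine Module.Basis.ext_alternating (Pi.basisFun ℝ ι) fun σ hσ => ?_
    obtain ⟨σ, rfl⟩ : ∃ e : Equiv.Perm ι, ⇑e = σ :=
      ⟨Equiv.ofBijective σ (Finite.injective_iff_bijective.1 hσ), rfl⟩
    have h1 : ∀ i, L (Pi.basisFun ℝ ι i) = b i := fun i => by
      simp [L, Fintype.linearCombination_apply, Pi.single_apply]
    have h2 : (Ψ.compLinearMap L) (fun i => Pi.basisFun ℝ ι (σ i)) = Ψ (b ∘ σ) := by
      rw [AlternatingMap.compLinearMap_apply]
      simp only [h1]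
      rfl
    have h3 : (Pi.basisFun ℝ ι).det (fun i => Pi.basisFun ℝ ι (σ i)) =
        (Equiv.Perm.sign σ : ℤ) := by
      have := (Pi.basisFun ℝ ι).det.map_perm (Pi.basisFun ℝ ι) σ
      rw [Module.Basis.det_self] at this
      refine Eq.trans this ?_
      rw [Units.smul_def, zsmul_one]
    rw [h2, AlternatingMap.map_perm, LinearMap.compAlternatingMap_apply, h3,
      LinearMap.toSpanSingleton_apply, Int.cast_smul_eq_zsmul, Units.smul_def]
  have h4 : Ψ.compLinearMap L (fun i => M i) = (Pi.basisFun ℝ ι).det (fun i => M i) • Ψ b :=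
    congrArg (fun f => f fun i => M i) h
  have h5 : (Pi.basisFun ℝ ι).det (fun i => M i) = M.det := Pi.basisFun_det_apply M
  rw [h5] at h4
  exact h4

/-- The frame `(v_1, iv_1, …, v_p, iv_p)` changes by `A ⊗ 1` under a change of basis `A`, and the
determinant of this matrix is `(det A)^2`. -/
theorem latticeFrame_matrix {n p : ℕ} (Ψ : (Fin n → ℂ) [⋀^Fin (2 * p)]→L[ℝ] ℂ)
    (v v' : Fin p → Fin n → ℤ) (A : Matrix (Fin p) (Fin p) ℤ)
    (h : ∀ j, v' j = ∑ k, A j k • v k) (hA : A.det ^ 2 = 1) :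
    Ψ (latticeFrame v') = Ψ (latticeFrame v) := by
  let e : Fin p × Fin 2 ≃ Fin (2 * p) := finProdFinEquiv.trans (finCongr (mul_comm p 2))
  -- The index `2j + k` of the frame corresponds to the pair `(j, k)`.
  let M : Matrix (Fin p × Fin 2) (Fin p × Fin 2) ℝ :=
    Matrix.kroneckerMap (· * ·) (A.map (Int.cast : ℤ → ℝ)) 1
  have hdet : M.det = 1 := by
    have h1 : (A.map (Int.cast : ℤ → ℝ)).det = (A.det : ℝ) := (Int.cast_det A).symm
    rw [Matrix.det_kronecker, h1]
    simp only [Fintype.card_fin, Matrix.det_one, one_pow, mul_one]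
    exact_mod_cast hA
  have hdiv : ∀ x : Fin p × Fin 2, ((e x : ℕ) / 2 = x.1) ∧ ((e x : ℕ) % 2 = x.2) := by
    intro x
    have : (e x : ℕ) = x.2 + 2 * x.1 := rfl
    have := x.2.2
    omega
  have hv : ∀ (v : Fin p → Fin n → ℤ) x,
      latticeFrame v (e x) = fun i => Complex.I ^ (x.2 : ℕ) * (v x.1 i : ℂ) := by
    intro v x
    ext i
    have : (⟨(e x : ℕ) / 2, by omega⟩ : Fin p) = x.1 := Fin.ext (hdiv x).1
    simp only [latticeFrame, (hdiv x).2, this]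
  have hframe : ∀ k, latticeFrame v' k =
      ∑ l, (M.reindex e e) k l • latticeFrame v l := by
    intro k
    obtain ⟨x, rfl⟩ := e.surjective k
    rw [← e.sum_comp]
    simp only [Matrix.reindex_apply, Matrix.submatrix_apply, Equiv.symm_apply_apply, hv, M,
      Matrix.kroneckerMap_apply, Fintype.sum_prod_type, Matrix.map_apply]
    ext i
    simp only [Finset.sum_apply, Pi.smul_apply, Matrix.one_apply, h, mul_ite, mul_one, mul_zero,
      ite_smul, zero_smul, Finset.sum_ite_eq, Finset.mem_univ, if_true, smul_eq_mul]
    push_cast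
    rw [Finset.mul_sum]
    refine Finset.sum_congr rfl fun j _ => ?_
    rw [Complex.real_smul]
    push_cast
    ring
  have := alternating_map_matrix Ψ.toAlternatingMap (M.reindex e e) (latticeFrame v)
  rw [Matrix.det_reindex_self, hdet, one_smul] at this
  rw [funext hframe]
  exact this

theorem intCast_sum_smul {n p : ℕ} (c : Fin p → ℤ) (v : Fin p → Fin n → ℤ) :
    intCast n (∑ k, c k • v k) = ∑ k, (c k : ℝ) • intCast n (v k) := by
  simp only [map_sum, map_zsmul, Int.cast_smul_eq_zsmul]

/-- Two lattice bases differ by a unimodular matrix. -/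
theorem exists_unimodular {n p : ℕ} {v v' : Fin p → Fin n → ℤ}
    (hv : LinearIndependent ℝ fun j => intCast n (v j))
    (hspan : Submodule.span ℤ (Set.range v) = Submodule.span ℤ (Set.range v')) :
    ∃ A : Matrix (Fin p) (Fin p) ℤ, (∀ j, v' j = ∑ k, A j k • v k) ∧ A.det ^ 2 = 1 := by
  have h1 : ∀ j, ∃ c : Fin p → ℤ, ∑ k, c k • v k = v' j := fun j =>
    Submodule.mem_span_range_iff_exists_fun ℤ |>.1
      (hspan ▸ Submodule.subset_span (Set.mem_range_self j))
  have h2 : ∀ j, ∃ c : Fin p → ℤ, ∑ k, c k • v' k = v j := fun j =>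
    Submodule.mem_span_range_iff_exists_fun ℤ |>.1
      (hspan ▸ Submodule.subset_span (Set.mem_range_self j))
  choose A hA using h1
  choose B hB using h2
  have hBA : (Matrix.of B) * (Matrix.of A) = 1 := by
    ext j l
    have h3 : v j = ∑ l, (Matrix.of B * Matrix.of A) j l • v l := by
      rw [← hB j]
      simp only [← hA, Finset.smul_sum, smul_smul, Matrix.mul_apply, Matrix.of_apply,
        Finset.sum_smul]
      exact Finset.sum_comm
    have h4 : ∑ l, (((Matrix.of B * Matrix.of A) j l : ℝ) - (1 : Matrix _ _ ℝ) j l) •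
        intCast n (v l) = 0 := by
      have := congrArg (intCast n) h3
      rw [intCast_sum_smul] at this
      simp only [sub_smul, Finset.sum_sub_distrib, ← this, Matrix.one_apply, ite_smul, one_smul,
        zero_smul, Finset.sum_ite_eq, Finset.mem_univ, if_true, sub_self]
    have h5 := Fintype.linearIndependent_iff.1 hv _ h4 l
    rw [sub_eq_zero, Matrix.one_apply] at h5
    rw [Matrix.one_apply]
    exact_mod_cast h5
  refine ⟨Matrix.of A, fun j => (hA j).symm, ?_⟩
  have := congrArg Matrix.det hBA
  rw [Matrix.det_mul, Matrix.det_one] at this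
  rcases Int.isUnit_iff.1 (IsUnit.of_mul_eq_one_right _ this) with h | h <;> rw [h] <;> norm_num

theorem map_latticeFrame_congr {n p : ℕ} {v v' : Fin p → Fin n → ℤ}
    (hv : LinearIndependent ℝ fun j => intCast n (v j))
    (hspan : Submodule.span ℤ (Set.range v) = Submodule.span ℤ (Set.range v'))
    (Ψ : (Fin n → ℂ) [⋀^Fin (2 * p)]→L[ℝ] ℂ) :
    Ψ (latticeFrame v') = Ψ (latticeFrame v) := by
  obtain ⟨A, hA, hdet⟩ := exists_unimodular hv hspan
  exact latticeFrame_matrix Ψ v v' A hA hdet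

/-- The lattice measure on an affine space depends neither on the base point nor on the lattice
basis. -/
theorem integral_chart_congr {n p : ℕ} {v v' : Fin p → Fin n → ℤ}
    (hv : LinearIndependent ℝ fun j => intCast n (v j))
    (hspan : Submodule.span ℤ (Set.range v) = Submodule.span ℤ (Set.range v'))
    {a a' : Fin n → ℝ} (ha : a' - a ∈ Submodule.span ℝ (Set.range fun j => intCast n (v j)))
    (f : (Fin n → ℝ) → ℂ) :
    ∫ s, f (chart v' a' s) = ∫ s, f (chart v a s) := by
  obtain ⟨A, hA, hdet⟩ := exists_unimodular hv hspan
  obtain ⟨s₀, hs₀⟩ := Submodule.mem_span_range_iff_exists_fun ℝ |>.1 ha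
  let M : Matrix (Fin p) (Fin p) ℝ := (A.map (Int.cast : ℤ → ℝ)).transpose
  have hM : M.det ^ 2 = 1 := by
    have h1 : (A.map (Int.cast : ℤ → ℝ)).det = (A.det : ℝ) := (Int.cast_det A).symm
    rw [Matrix.det_transpose, h1]
    exact_mod_cast hdet
  have hM0 : M.det ≠ 0 := fun h => by simp [h] at hM
  have habs : |M.det⁻¹| = 1 := by
    rcases sq_eq_one_iff.1 hM with h | h <;> simp [h]
  have hmap : MeasurePreserving (Matrix.toLin' M) volume volume :=
    ⟨(LinearMap.continuous_of_finiteDimensional _).measurable, by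
      rw [Real.map_matrix_volume_pi_eq_smul_volume_pi hM0, habs]; simp⟩
  have hinj : Function.Injective (Matrix.toLin' M) := by
    rw [Matrix.toLin'_apply']
    exact Matrix.mulVec_injective_of_isUnit ((Matrix.isUnit_iff_isUnit_det _).2 hM0.isUnit)
  have hemb : MeasurableEmbedding (Matrix.toLin' M) :=
    (LinearMap.isClosedEmbedding_of_injective (LinearMap.ker_eq_bot.2 hinj)).measurableEmbedding
  have hchart : ∀ s, chart v' a' s = chart v a (s₀ + Matrix.toLin' M s) := by
    intro s
    have h1 : a' = a + ∑ j, s₀ j • intCast n (v j) := by rw [hs₀]; abel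
    simp only [chart, h1, Pi.add_apply, add_smul, Finset.sum_add_distrib, add_assoc]
    congr 2
    simp only [hA, intCast_sum_smul, Finset.smul_sum, Matrix.toLin'_apply, Matrix.mulVec,
      dotProduct, Finset.sum_smul, smul_smul]
    rw [Finset.sum_comm]
    refine Finset.sum_congr rfl fun k _ => Finset.sum_congr rfl fun j _ => ?_
    simp only [M, Matrix.transpose_apply, Matrix.map_apply]
    rw [mul_comm]
  simp only [hchart]
  rw [hmap.integral_comp hemb (fun s => f (chart v a (s₀ + s))),
    integral_add_left_eq_self (fun s => f (chart v a s)) s₀]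

/-! ### Exterior multiplication by a radial covector -/

/-- Coordinatewise real part. -/
def rePart (n : ℕ) : (Fin n → ℂ) →L[ℝ] (Fin n → ℝ) :=
  ContinuousLinearMap.pi fun i => Complex.reCLM.comp (ContinuousLinearMap.proj i)

@[simp] theorem rePart_apply {n : ℕ} (X : Fin n → ℂ) (i : Fin n) : rePart n X i = (X i).re := rfl

@[simp] theorem rePart_imVec {n : ℕ} (w : Fin n → ℤ) : rePart n (imVec w) = 0 := by
  ext i
  simp [imVec]

/-- The exterior product of the covector `m ∘ Re` with an alternating form. -/
def wedgeForm {n k : ℕ} (m : (Fin n → ℝ) →L[ℝ] ℝ) (Ψ : (Fin n → ℂ) [⋀^Fin k]→L[ℝ] ℂ) :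
    (Fin n → ℂ) [⋀^Fin (k + 1)]→L[ℝ] ℂ :=
  ContinuousAlternatingMap.alternatizeUncurryFin ((m.comp (rePart n)).smulRight Ψ)

theorem wedgeForm_apply {n k : ℕ} (m : (Fin n → ℝ) →L[ℝ] ℝ)
    (Ψ : (Fin n → ℂ) [⋀^Fin k]→L[ℝ] ℂ) (X : Fin (k + 1) → Fin n → ℂ) :
    wedgeForm m Ψ X = ∑ i, (-1) ^ i.val * (m (rePart n (X i)) * Ψ (i.removeNth X)) := by
  rw [wedgeForm, ContinuousAlternatingMap.alternatizeUncurryFin_apply]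
  refine Finset.sum_congr rfl fun i _ => ?_
  rw [zsmul_eq_mul]
  push_cast
  simp

/-- The lattice basis `(w, v_1, …, v_q)`. -/
abbrev consBasis {n q : ℕ} (w : Fin n → ℤ) (v : Fin q → Fin n → ℤ) : Fin (q + 1) → Fin n → ℤ :=
  Fin.cons w v

theorem latticeFrame_consBasis {n q : ℕ} (w : Fin n → ℤ) (v : Fin q → Fin n → ℤ) :
    (latticeFrame (consBasis w v) : Fin (2 * q + 1 + 1) → Fin n → ℂ) =
      Fin.cons (fun i => (w i : ℂ)) (Fin.cons (imVec w) (latticeFrame v)) := by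
  have h : ∀ k : Fin (2 * q + 1 + 1), (latticeFrame (consBasis w v) :
      Fin (2 * q + 1 + 1) → Fin n → ℂ) k = (Fin.cons (fun i => (w i : ℂ))
        (Fin.cons (imVec w) (latticeFrame v)) : Fin (2 * q + 1 + 1) → Fin n → ℂ) k := by
    intro k
    refine Fin.cases ?_ (fun k => Fin.cases ?_ (fun k => ?_) k) k
    · ext i
      simp [latticeFrame]
    · ext i
      have h2 : (⟨1 / 2, by omega⟩ : Fin (q + 1)) = 0 := rfl
      have h1 : latticeFrame (consBasis w v) (Fin.succ 0 : Fin (2 * q + 1 + 1)) i =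
        Complex.I ^ (1 % 2) * (consBasis w v ⟨1 / 2, by omega⟩ i : ℂ) := rfl
      rw [h1, h2]
      simp [imVec]
    · ext i
      have hk := k.2
      have h1 : ((k : ℕ) + 1 + 1) % 2 = k % 2 := by omega
      have h2 : (⟨((k : ℕ) + 1 + 1) / 2, by omega⟩ : Fin (q + 1)) =
        Fin.succ ⟨(k : ℕ) / 2, by omega⟩ := Fin.ext (by simp only [Fin.val_succ]; omega)
      have h3 : latticeFrame (consBasis w v) (k.succ.succ : Fin (2 * q + 1 + 1)) i =
        Complex.I ^ (((k : ℕ) + 1 + 1) % 2) *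
          (consBasis w v ⟨((k : ℕ) + 1 + 1) / 2, by omega⟩ i : ℂ) := rfl
      rw [h3, h1, h2, consBasis, Fin.cons_succ, Fin.cons_succ, Fin.cons_succ]
      rfl
  exact funext h

theorem rePart_latticeFrame {n p : ℕ} (v : Fin p → Fin n → ℤ) (k : Fin (2 * p)) :
    rePart n (latticeFrame v k) =
      if (k : ℕ) % 2 = 0 then intCast n (v ⟨k / 2, by omega⟩) else 0 := by
  ext i
  rcases Nat.mod_two_eq_zero_or_one k with h | h <;> simp [latticeFrame, h]

/-- In a lattice basis adapted to the kernel of `m`, only one term of `(m ∘ Re) ∧ Ψ` survives. -/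
theorem wedgeForm_consBasis {n q : ℕ} (m : (Fin n → ℝ) →L[ℝ] ℝ)
    (Ψ : (Fin n → ℂ) [⋀^Fin (2 * q + 1)]→L[ℝ] ℂ) (w : Fin n → ℤ) (v : Fin q → Fin n → ℤ)
    (hm : ∀ j, m (intCast n (v j)) = 0) :
    wedgeForm m Ψ (latticeFrame (consBasis w v)) =
      m (intCast n w) * Ψ (Fin.cons (imVec w) (latticeFrame v)) := by
  rw [wedgeForm_apply, latticeFrame_consBasis, Fin.sum_univ_succ, Finset.sum_eq_zero, add_zero]
  · have : rePart n (fun i => (w i : ℂ)) = intCast n w := by ext i; simp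
    simp [this]
  · intro k _
    have : m (rePart n ((Fin.cons (imVec w) (latticeFrame v) : Fin (2 * q + 1) → Fin n → ℂ) k)) =
        0 := by
      refine Fin.cases ?_ (fun k => ?_) k
      · simp
      · rw [Fin.cons_succ, rePart_latticeFrame]
        split_ifs
        · exact hm _
        · simp
    rw [Fin.cons_succ, this]
    simp

/-! ### Faces of polyhedra -/

/-- The functional `x ↦ ⟨m, x⟩`. -/
def dotCLM {n : ℕ} (m : Fin n → ℝ) : (Fin n → ℝ) →L[ℝ] ℝ :=
  ∑ i, m i • ContinuousLinearMap.proj i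

@[simp] theorem dotCLM_apply {n : ℕ} (m x : Fin n → ℝ) : dotCLM m x = m ⬝ᵥ x := by
  simp [dotCLM, dotProduct]

/-- `x` is a relative interior point of `s`. -/
def IsRelInterior {n : ℕ} (s : Set (Fin n → ℝ)) (x : Fin n → ℝ) : Prop :=
  x ∈ s ∧ ∀ᶠ h in nhds (0 : Fin n → ℝ), h ∈ vectorSpan ℝ s → x + h ∈ s

theorem exists_isRelInterior {n : ℕ} {s : Set (Fin n → ℝ)} (hs : Convex ℝ s) (hne : s.Nonempty) :
    ∃ x, IsRelInterior s x := by
  obtain ⟨x, hx⟩ := hne.intrinsicInterior hs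
  obtain ⟨y, hy, rfl⟩ := mem_intrinsicInterior.1 hx
  refine ⟨y, interior_subset (s := Subtype.val ⁻¹' s) hy, ?_⟩
  rw [mem_interior_iff_mem_nhds, mem_nhds_subtype_iff_nhdsWithin,
    mem_nhdsWithin_iff_eventually] at hy
  have ht : Filter.Tendsto (fun h : Fin n → ℝ => (y : Fin n → ℝ) + h) (nhds 0) (nhds y) := by
    have : Continuous fun h : Fin n → ℝ => (y : Fin n → ℝ) + h := by fun_prop
    simpa using this.tendsto 0
  filter_upwards [ht.eventually hy] with h hh hmem
  have h1 : (y : Fin n → ℝ) + h ∈ affineSpan ℝ s := by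
    rw [add_comm]
    exact AffineSubspace.vadd_mem_of_mem_direction (by rwa [direction_affineSpan]) y.2
  obtain ⟨z, hz, hz'⟩ := hh h1
  rwa [← hz']

theorem IsRelInterior.exists_pos {n : ℕ} {s : Set (Fin n → ℝ)} {x : Fin n → ℝ}
    (hx : IsRelInterior s x) {h : Fin n → ℝ} (hh : h ∈ vectorSpan ℝ s) :
    ∃ ε : ℝ, 0 < ε ∧ x + ε • h ∈ s ∧ x - ε • h ∈ s := by
  have h1 : ∀ g ∈ vectorSpan ℝ s, ∀ᶠ ε in nhdsWithin (0 : ℝ) (Set.Ioi 0), x + ε • g ∈ s := by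
    intro g hg
    have ht : Filter.Tendsto (fun ε : ℝ => ε • g) (nhds 0) (nhds 0) := by
      have : Continuous fun ε : ℝ => ε • g := by fun_prop
      simpa using this.tendsto 0
    filter_upwards [(ht.eventually hx.2).filter_mono nhdsWithin_le_nhds] with ε hε
    exact hε (Submodule.smul_mem _ _ hg)
  obtain ⟨ε, ⟨h2, h3⟩, h4⟩ :=
    ((h1 h hh).and (h1 (-h) (neg_mem hh))).and self_mem_nhdsWithin |>.exists
  exact ⟨ε, h4, h2, by simpa [sub_eq_add_neg] using h3⟩

theorem sub_mem_vectorSpan {n : ℕ} {s : Set (Fin n → ℝ)} {x y : Fin n → ℝ} (hx : x ∈ s)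
    (hy : y ∈ s) : x - y ∈ vectorSpan ℝ s := vsub_mem_vectorSpan ℝ hx hy

theorem IsRelInterior.map_eq_zero {n : ℕ} {s : Set (Fin n → ℝ)} {x : Fin n → ℝ}
    (hx : IsRelInterior s x) (l : (Fin n → ℝ) →L[ℝ] ℝ) (hl : ∀ y ∈ s, l x ≤ l y)
    {h : Fin n → ℝ} (hh : h ∈ vectorSpan ℝ s) : l h = 0 := by
  obtain ⟨ε, hε, h1, h2⟩ := hx.exists_pos hh
  have h3 := hl _ h1
  have h4 := hl _ h2
  rw [map_add, map_smul, smul_eq_mul] at h3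
  rw [map_sub, map_smul, smul_eq_mul] at h4
  have : ε * l h = 0 := by linarith
  exact (mul_eq_zero.1 this).resolve_left hε.ne'

theorem IsRelInterior.map_eq {n : ℕ} {s : Set (Fin n → ℝ)} {x : Fin n → ℝ}
    (hx : IsRelInterior s x) (l : (Fin n → ℝ) →L[ℝ] ℝ) (hl : ∀ y ∈ s, l x ≤ l y)
    {y : Fin n → ℝ} (hy : y ∈ s) : l y = l x := by
  have := hx.map_eq_zero l hl (sub_mem_vectorSpan hy hx.1)
  rw [map_sub] at this
  linarith

theorem IsPolyhedron.convex {n : ℕ} {σ : Set (Fin n → ℝ)} (h : IsPolyhedron σ) : Convex ℝ σ := by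
  obtain ⟨N, m, c, rfl⟩ := h
  simp only [Set.ofPred_forall]
  exact convex_iInter fun j =>
    convex_halfSpace_ge ⟨fun x y => dotProduct_add _ _ _, fun t x => dotProduct_smul _ _ _⟩ _

theorem IsPolyhedron.isClosed {n : ℕ} {σ : Set (Fin n → ℝ)} (h : IsPolyhedron σ) :
    IsClosed σ := by
  obtain ⟨N, m, c, rfl⟩ := h
  simp only [Set.ofPred_forall]
  exact isClosed_iInter fun j => isClosed_le continuous_const
    ((dotCLM (m j)).continuous.congr fun x => dotCLM_apply _ _)

theorem IsRationalPolyhedron.isPolyhedron {n : ℕ} {σ : Set (Fin n → ℝ)}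
    (h : IsRationalPolyhedron σ) : IsPolyhedron σ := by
  obtain ⟨N, m, c, h⟩ := h
  exact ⟨N, fun j => intCast n (m j), c, h⟩

theorem IsFace.subset {n : ℕ} {τ σ : Set (Fin n → ℝ)} (h : IsFace τ σ) : τ ⊆ σ := h.2.subset

theorem IsFace.exists_functional {n : ℕ} {τ σ : Set (Fin n → ℝ)} (h : IsFace τ σ) :
    ∃ l : (Fin n → ℝ) →L[ℝ] ℝ, ∀ x, x ∈ τ ↔ x ∈ σ ∧ ∀ y ∈ σ, l y ≤ l x := by
  obtain ⟨l, hl⟩ := h.2 h.1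
  exact ⟨l, fun x => by rw [hl]; rfl⟩

/-- A face through a relative interior point is the whole polyhedron. -/
theorem IsFace.eq_of_isRelInterior {n : ℕ} {τ σ : Set (Fin n → ℝ)} (h : IsFace τ σ)
    {x : Fin n → ℝ} (hx : IsRelInterior σ x) (hxτ : x ∈ τ) : τ = σ := by
  obtain ⟨l, hl⟩ := h.exists_functional
  refine h.subset.antisymm fun y hy => ?_
  have h1 : ∀ y ∈ σ, (-l) x ≤ (-l) y := fun y hy => by
    simpa using ((hl x).1 hxτ).2 y hy
  have h2 : ∀ y ∈ σ, l y = l x := fun y hy => by simpa using hx.map_eq (-l) h1 hy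
  exact (hl y).2 ⟨hy, fun z hz => by rw [h2 z hz, h2 y hy]⟩

/-- A face of full dimension is the whole polyhedron. -/
theorem IsFace.eq_of_dim_eq {n : ℕ} {τ σ : Set (Fin n → ℝ)} (h : IsFace τ σ)
    (hd : dim τ = dim σ) : τ = σ := by
  have hspan : vectorSpan ℝ τ = vectorSpan ℝ σ :=
    Submodule.eq_of_le_of_finrank_eq (vectorSpan_mono ℝ h.subset) hd
  obtain ⟨l, hl⟩ := h.exists_functional
  obtain ⟨x, hx⟩ := h.1
  have h0 : ∀ g ∈ vectorSpan ℝ τ, l g = 0 := by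
    intro g hg
    refine Submodule.span_induction (p := fun g _ => l g = 0) ?_ (map_zero l) ?_ ?_ hg
    · rintro _ ⟨y, hy, z, hz, rfl⟩
      have h1 := ((hl y).1 hy).2 z (h.subset hz)
      have h2 := ((hl z).1 hz).2 y (h.subset hy)
      change l (y - z) = 0
      rw [map_sub]
      linarith
    · intro a b _ _ ha hb
      rw [map_add, ha, hb, add_zero]
    · intro t a _ ha
      rw [map_smul, ha, smul_zero]
  refine h.subset.antisymm fun y hy => (hl y).2 ⟨hy, fun z hz => ?_⟩
  have h1 := h0 (y - x) (hspan ▸ sub_mem_vectorSpan hy (h.subset hx))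
  rw [map_sub] at h1
  have h2 := ((hl x).1 hx).2 z hz
  linarith

/-- Faces of rational polyhedra are rational. -/
theorem IsFace.isRationalPolyhedron {n : ℕ} {τ σ : Set (Fin n → ℝ)} (h : IsFace τ σ)
    (hσ : IsRationalPolyhedron σ) : IsRationalPolyhedron τ := by
  classical
  obtain ⟨t, ht⟩ := exists_isRelInterior (h.2.convex hσ.isPolyhedron.convex) h.1
  obtain ⟨l, hl⟩ := h.exists_functional
  obtain ⟨N, m, c, hmc⟩ := hσ
  have hmem : ∀ x, x ∈ σ ↔ ∀ j, c j ≤ intCast n (m j) ⬝ᵥ x := fun x => by rw [hmc]; rfl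
  let A : Fin N → Prop := fun j => intCast n (m j) ⬝ᵥ t = c j
  have hA : ∀ j, A j → ∀ x ∈ τ, intCast n (m j) ⬝ᵥ x = c j := by
    intro j hj x hx
    have := ht.map_eq (dotCLM (intCast n (m j))) (fun y hy => by
      rw [dotCLM_apply, dotCLM_apply, hj]
      exact (hmem y).1 (h.subset hy) j) hx
    rw [dotCLM_apply, dotCLM_apply] at this
    rw [this, hj]
  -- For small `ε` the point `t - ε (x - t)` also lies in `σ`, so `l` cannot decrease
  -- from `t` to `x`.
  have hconv : ∀ x ∈ σ, (∀ j, A j → intCast n (m j) ⬝ᵥ x = c j) → x ∈ τ := by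
    intro x hx hxA
    have hev : ∀ j, ∀ᶠ ε in nhdsWithin (0 : ℝ) (Set.Ioi 0),
        c j ≤ intCast n (m j) ⬝ᵥ (t - ε • (x - t)) := by
      intro j
      by_cases hj : A j
      · refine Filter.Eventually.of_forall fun ε => ?_
        rw [dotProduct_sub, dotProduct_smul, dotProduct_sub, hxA j hj, hj]
        simp
      · have hcont : Continuous fun ε : ℝ => intCast n (m j) ⬝ᵥ (t - ε • (x - t)) := by
          simp only [dotProduct_sub, dotProduct_smul]
          fun_prop
        have hlt : c j < intCast n (m j) ⬝ᵥ (t - (0 : ℝ) • (x - t)) := by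
          rw [zero_smul, sub_zero]
          exact lt_of_le_of_ne ((hmem t).1 (h.subset ht.1) j) (Ne.symm hj)
        exact ((hcont.tendsto 0).eventually_const_le hlt).filter_mono nhdsWithin_le_nhds
    obtain ⟨ε, hε, hε0⟩ := ((Filter.eventually_all.2 hev).and self_mem_nhdsWithin).exists
    have hε0 : 0 < ε := hε0
    have h1 := ((hl t).1 ht.1).2 _ ((hmem _).2 hε)
    rw [map_sub, map_smul, map_sub, smul_eq_mul] at h1
    have h2 : l t ≤ l x := by
      by_contra hcon
      push Not at hcon
      nlinarith
    exact (hl x).2 ⟨hx, fun y hy => (((hl t).1 ht.1).2 y hy).trans h2⟩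
  -- Add the negatives of the inequalities that are tight at the point `t`; the others are repeated.
  refine ⟨N + N, Fin.append m (fun j => if A j then -m j else m j),
    Fin.append c (fun j => if A j then -c j else c j), ?_⟩
  ext x
  constructor
  · intro hx j
    have hxσ := (hmem x).1 (h.subset hx)
    refine Fin.addCases (fun j => ?_) (fun j => ?_) j
    · simpa only [Fin.append_left] using hxσ j
    · simp only [Fin.append_right]
      split_ifs with hj
      · rw [map_neg, neg_dotProduct, hA j hj x hx]
      · exact hxσ j
  · intro hx
    have hxσ : x ∈ σ := (hmem x).2 fun j => by
      have := hx (Fin.castAdd N j)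
      simpa only [Fin.append_left] using this
    refine hconv x hxσ fun j hj => le_antisymm ?_ ((hmem x).1 hxσ j)
    have := hx (Fin.natAdd N j)
    simp only [Fin.append_right, if_pos hj, map_neg, neg_dotProduct] at this
    linarith

/-! ### Facets of a rational polyhedron -/

/-- An irredundant description of a rational polyhedron within its affine span, by inequalities
`functional j ≥ bound j` that correspond to its facets. The functionals are primitive on the lattice
`H_σ ∩ ℤ^n`, and `center j` lies on the `j`-th facet and on no other one. -/
structure FacetSystem {n : ℕ} (ι : Type) (σ : Set (Fin n → ℝ)) where
  /-- The inner normal covectors. -/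
  functional : ι → (Fin n → ℝ) →L[ℝ] ℝ
  /-- The right-hand sides of the inequalities. -/
  bound : ι → ℝ
  mem_iff : ∀ a ∈ σ, ∀ x, x ∈ σ ↔ x - a ∈ vectorSpan ℝ σ ∧ ∀ j, bound j ≤ functional j x
  /-- Lattice vectors on which the functionals take the value one. -/
  normal : ι → Fin n → ℤ
  normal_mem : ∀ j, normal j ∈ lattice σ
  functional_normal : ∀ j, functional j (intCast n (normal j)) = 1
  integral : ∀ j, ∀ w ∈ lattice σ, ∃ k : ℤ, functional j (intCast n w) = k
  /-- Points in the relative interiors of the facets. -/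
  center : ι → Fin n → ℝ
  center_mem : ∀ j, center j ∈ σ
  functional_center : ∀ j, functional j (center j) = bound j
  lt_functional_center : ∀ j i, i ≠ j → bound i < functional i (center j)

/-- A facet system comes from an inclusion-minimal set of inequalities that defines `σ` within its
affine span. Minimality gives, for each `j`, a point violating the `j`-th inequality alone; the
segment from a relative interior point to it meets the `j`-th facet and no other. Dividing by the
generator of the ideal of values on the lattice makes the functionals primitive. -/
theorem exists_facetSystem {n : ℕ} {σ : Set (Fin n → ℝ)} (hσ : IsRationalPolyhedron σ)
    (hne : σ.Nonempty) : ∃ (ι : Type) (_ : Fintype ι), Nonempty (FacetSystem ι σ) := by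
  classical
  obtain ⟨a, ha⟩ := hne
  have hspan := span_lattice hσ ⟨a, ha⟩
  obtain ⟨x₀, hx₀⟩ := exists_isRelInterior hσ.isPolyhedron.convex ⟨a, ha⟩
  obtain ⟨N, m, c, hmc⟩ := hσ
  let l : Fin N → (Fin n → ℝ) →L[ℝ] ℝ := fun j => dotCLM (intCast n (m j))
  have hmem : ∀ x, x ∈ σ ↔ ∀ j, c j ≤ l j x := fun x => by
    simp only [l, dotCLM_apply]
    rw [hmc]
    rfl
  let P : Finset (Fin N) → Prop := fun J =>
    ∀ x, x - a ∈ vectorSpan ℝ σ → (∀ j ∈ J, c j ≤ l j x) → x ∈ σ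
  have hP : P Finset.univ := fun x _ hx => (hmem x).2 fun j => hx j (Finset.mem_univ j)
  obtain ⟨J, -, hJ⟩ := exists_minimal_le_of_wellFoundedLT P Finset.univ hP
  -- By minimality, dropping one inequality admits a new point.
  have hout : ∀ j ∈ J, ∃ y, y - a ∈ vectorSpan ℝ σ ∧ (∀ i ∈ J, i ≠ j → c i ≤ l i y) ∧
      l j y < c j := by
    intro j hj
    have : ¬ P (J.erase j) := fun hcon =>
      Finset.notMem_erase j J (hJ.2 hcon (Finset.erase_subset j J) hj)
    simp only [P] at this
    push Not at this
    obtain ⟨y, hy, hyJ, hyσ⟩ := this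
    refine ⟨y, hy, fun i hi hij => hyJ i (Finset.mem_erase.2 ⟨hij, hi⟩), ?_⟩
    by_contra hcon
    push Not at hcon
    refine hyσ (hJ.1 y hy fun i hi => ?_)
    by_cases hij : i = j
    · rwa [hij]
    · exact hyJ i (Finset.mem_erase.2 ⟨hij, hi⟩)
  have hstrict : ∀ j ∈ J, c j < l j x₀ := by
    intro j hj
    refine lt_of_le_of_ne ((hmem x₀).1 hx₀.1 j) fun heq => ?_
    obtain ⟨y, hy, -, hyj⟩ := hout j hj
    have hmin : ∀ y ∈ σ, l j x₀ ≤ l j y := fun y hy => heq ▸ (hmem y).1 hy j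
    have h1 := hx₀.map_eq_zero (l j) hmin hy
    have h2 := hx₀.map_eq (l j) hmin ha
    rw [map_sub] at h1
    linarith
  have hcenter : ∀ j : J, ∃ z ∈ σ, l j z = c j ∧ ∀ i : J, i ≠ j → c i < l i z := by
    rintro ⟨j, hj⟩
    obtain ⟨y, hy, hyJ, hyj⟩ := hout j hj
    have hxj := hstrict j hj
    -- The point of the segment from `x₀` to `y` at which the `j`-th inequality is an equality.
    set t := (l j x₀ - c j) / (l j x₀ - l j y) with ht
    have hpos : 0 < l j x₀ - l j y := by linarith
    have ht0 : 0 < t := div_pos (by linarith) hpos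
    have ht1 : t < 1 := (div_lt_one hpos).2 (by linarith)
    have htm : t * (l j x₀ - l j y) = l j x₀ - c j := div_mul_cancel₀ _ hpos.ne'
    have hl : ∀ i, l i (x₀ + t • (y - x₀)) = (1 - t) * l i x₀ + t * l i y := fun i => by
      rw [map_add, map_smul, map_sub, smul_eq_mul]
      ring
    have hj0 : l j (x₀ + t • (y - x₀)) = c j := by
      rw [hl]
      linarith
    have hi0 : ∀ i ∈ J, i ≠ j → c i < l i (x₀ + t • (y - x₀)) := by
      intro i hi hij
      rw [hl]
      have h1 := hstrict i hi
      have h2 := hyJ i hi hij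
      nlinarith
    refine ⟨x₀ + t • (y - x₀), hJ.1 _ ?_ fun i hi => ?_, hj0,
      fun i hij => hi0 i i.2 fun h => hij (Subtype.ext h)⟩
    · have h1 : x₀ + t • (y - x₀) - a = (x₀ - a) + t • ((y - a) - (x₀ - a)) := by
        rw [sub_sub_sub_cancel_right]
        abel
      rw [h1]
      have h2 := sub_mem_vectorSpan hx₀.1 ha
      exact add_mem h2 (Submodule.smul_mem _ _ (sub_mem hy h2))
    · by_cases hij : i = j
      · rw [hij, hj0]
      · exact (hi0 i hi hij).le
  choose z hzσ hzj hzi using hcenter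
  -- The values of the `j`-th integral functional on the lattice form a nonzero ideal of `ℤ`.
  have hd : ∀ j : J, ∃ (d : ℤ) (w : Fin n → ℤ), 0 < d ∧ w ∈ lattice σ ∧
      l j (intCast n w) = d ∧ ∀ w' ∈ lattice σ, ∃ k : ℤ, l j (intCast n w') = d * k := by
    intro j
    let g : (Fin n → ℤ) →ₗ[ℤ] ℤ := Fintype.linearCombination ℤ (m j)
    have hg : ∀ w, l j (intCast n w) = g w := by
      intro w
      simp only [l, dotCLM_apply, dotProduct, intCast_apply, g, Fintype.linearCombination_apply]
      push_cast
      exact Finset.sum_congr rfl fun i _ => by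
        rw [smul_eq_mul, Int.cast_mul, mul_comm]
    let d := Submodule.IsPrincipal.generator (Submodule.map g (lattice σ))
    obtain ⟨w, hw, hwd⟩ : d ∈ Submodule.map g (lattice σ) :=
      Submodule.IsPrincipal.generator_mem _
    have hdiv : ∀ w' ∈ lattice σ, ∃ k : ℤ, g w' = d * k := by
      intro w' hw'
      obtain ⟨k, hk⟩ := (Submodule.IsPrincipal.mem_iff_eq_smul_generator
        (Submodule.map g (lattice σ))).1 (Submodule.mem_map_of_mem hw')
      exact ⟨k, by rw [hk, smul_eq_mul, mul_comm]⟩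
    have hd0 : d ≠ 0 := by
      intro hd0
      have h0 : ∀ h ∈ vectorSpan ℝ σ, l j h = 0 := by
        rw [← hspan]
        intro h hh
        refine Submodule.span_induction (p := fun h _ => l j h = 0) ?_ (map_zero _) ?_ ?_ hh
        · rintro _ ⟨w', hw', rfl⟩
          obtain ⟨k, hk⟩ := hdiv w' hw'
          rw [hg, hk, hd0]
          simp
        · intro x y _ _ hx hy
          rw [map_add, hx, hy, add_zero]
        · intro t x _ hx
          rw [map_smul, hx, smul_zero]
      have h1 := h0 _ (sub_mem_vectorSpan hx₀.1 (hzσ j))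
      rw [map_sub, hzj] at h1
      have := hstrict j j.2
      linarith
    rcases lt_or_gt_of_ne hd0 with hlt | hgt
    · refine ⟨-d, -w, by omega, neg_mem hw, ?_, fun w' hw' => ?_⟩
      · rw [map_neg, map_neg, hg, hwd]
        push_cast
        rfl
      · obtain ⟨k, hk⟩ := hdiv w' hw'
        refine ⟨-k, ?_⟩
        rw [hg, hk]
        push_cast
        ring
    · refine ⟨d, w, hgt, hw, ?_, fun w' hw' => ?_⟩
      · rw [hg, hwd]
      · obtain ⟨k, hk⟩ := hdiv w' hw'
        exact ⟨k, by rw [hg, hk]; push_cast; rfl⟩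
  choose d w hd0 hw hwd hint using hd
  have hdR : ∀ j, (0 : ℝ) < (d j : ℝ)⁻¹ := fun j => inv_pos.2 (by exact_mod_cast hd0 j)
  have hdR' : ∀ j, (d j : ℝ) ≠ 0 := fun j => by exact_mod_cast (hd0 j).ne'
  refine ⟨J, inferInstance, ⟨{
    functional := fun j => (d j : ℝ)⁻¹ • l j
    bound := fun j => (d j : ℝ)⁻¹ * c j
    mem_iff := ?_
    normal := w
    normal_mem := hw
    functional_normal := fun j => ?_
    integral := fun j w' hw' => ?_
    center := z
    center_mem := hzσ
    functional_center := fun j => ?_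
    lt_functional_center := fun j i hij => ?_ }⟩⟩
  · intro b hb x
    refine ⟨fun hx => ⟨sub_mem_vectorSpan hx hb, fun j => ?_⟩, fun hx => hJ.1 x ?_ fun j hj => ?_⟩
    · exact mul_le_mul_of_nonneg_left ((hmem x).1 hx j) (hdR j).le
    · have := add_mem hx.1 (sub_mem_vectorSpan hb ha)
      rwa [sub_add_sub_cancel] at this
    · exact le_of_mul_le_mul_left (hx.2 ⟨j, hj⟩) (hdR ⟨j, hj⟩)
  · simp [hwd, hdR']
  · obtain ⟨k, hk⟩ := hint j w' hw'
    exact ⟨k, by simp [hk, hdR']⟩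
  · simp [hzj]
  · exact mul_lt_mul_of_pos_left (hzi j i hij) (hdR i)

/-! ### Lattice bases adapted to a facet -/

namespace FacetSystem

variable {n : ℕ} {ι : Type} {σ : Set (Fin n → ℝ)} (S : FacetSystem ι σ)

/-- The facet on which the `j`-th inequality is an equality. -/
def facet (j : ι) : Set (Fin n → ℝ) := {x | x ∈ σ ∧ S.functional j x = S.bound j}

theorem center_mem_facet (j : ι) : S.center j ∈ S.facet j :=
  ⟨S.center_mem j, S.functional_center j⟩

theorem bound_le {x : Fin n → ℝ} (hx : x ∈ σ) (j : ι) : S.bound j ≤ S.functional j x :=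
  ((S.mem_iff x hx x).1 hx).2 j

theorem isFace_facet (j : ι) : IsFace (S.facet j) σ := by
  refine ⟨⟨_, S.center_mem_facet j⟩, fun _ => ⟨-S.functional j, ?_⟩⟩
  ext x
  simp only [facet, neg_apply, neg_le_neg_iff]
  refine ⟨fun hx => ⟨hx.1, fun y hy => hx.2 ▸ S.bound_le hy j⟩, fun hx => ⟨hx.1, ?_⟩⟩
  exact le_antisymm ((hx.2 _ (S.center_mem j)).trans (S.functional_center j).le)
    (S.bound_le hx.1 j)

theorem facet_injective : Function.Injective S.facet := by
  intro i j hij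
  by_contra hne
  have h1 := S.center_mem_facet j
  rw [← hij] at h1
  exact (S.lt_functional_center j i hne).ne' h1.2

/-- The cone of `σ` at a facet lies in the half-space of the normal covector of this facet. -/
theorem functional_nonneg_of_mem_hull (j : ι) (x : Fin n → ℝ)
    (hx : x ∈ PointedCone.hull ℝ (σ - S.facet j)) :
    x ∈ vectorSpan ℝ σ ∧ 0 ≤ S.functional j x := by
  refine Submodule.span_induction (p := fun x _ => x ∈ vectorSpan ℝ σ ∧ 0 ≤ S.functional j x)
    ?_ ⟨zero_mem _, by simp⟩ ?_ ?_ hx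
  · rintro _ ⟨x, hx, y, hy, rfl⟩
    refine ⟨sub_mem_vectorSpan hx hy.1, ?_⟩
    change 0 ≤ S.functional j (x - y)
    rw [map_sub, hy.2, sub_nonneg]
    exact S.bound_le hx j
  · intro x y _ _ hx hy
    exact ⟨add_mem hx.1 hy.1, by rw [map_add]; exact add_nonneg hx.2 hy.2⟩
  · intro t x _ hx
    refine ⟨Submodule.smul_mem _ (t : ℝ) hx.1, ?_⟩
    change 0 ≤ S.functional j ((t : ℝ) • x)
    rw [map_smul]
    exact mul_nonneg t.2 hx.2

variable [Finite ι]

theorem vectorSpan_facet (j : ι) :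
    vectorSpan ℝ (S.facet j) = vectorSpan ℝ σ ⊓ (S.functional j).ker := by
  refine le_antisymm (le_inf (vectorSpan_mono ℝ (S.isFace_facet j).subset) ?_) ?_
  · refine Submodule.span_le.2 ?_
    rintro _ ⟨x, hx, y, hy, rfl⟩
    change S.functional j (x - y) = 0
    rw [map_sub, hx.2, hy.2, sub_self]
  · rintro h ⟨hh, hj⟩
    have hj : S.functional j h = 0 := hj
    have hev : ∀ i, ∀ᶠ ε in nhdsWithin (0 : ℝ) (Set.Ioi 0),
        S.bound i ≤ S.functional i (S.center j + ε • h) := by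
      intro i
      by_cases hij : i = j
      · refine Filter.Eventually.of_forall fun ε => ?_
        rw [hij, map_add, map_smul, hj, smul_zero, add_zero, S.functional_center]
      · have hcont : Continuous fun ε : ℝ => S.functional i (S.center j + ε • h) := by fun_prop
        have hlt : S.bound i < S.functional i (S.center j + (0 : ℝ) • h) := by
          simpa using S.lt_functional_center j i hij
        exact ((hcont.tendsto 0).eventually_const_le hlt).filter_mono nhdsWithin_le_nhds
    obtain ⟨ε, hε, hε0⟩ := ((Filter.eventually_all.2 hev).and self_mem_nhdsWithin).exists
    have hmem : S.center j + ε • h ∈ S.facet j := by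
      refine ⟨(S.mem_iff _ (S.center_mem j) _).2 ⟨?_, hε⟩, ?_⟩
      · rw [add_sub_cancel_left]
        exact Submodule.smul_mem _ _ hh
      · rw [map_add, map_smul, hj, smul_zero, add_zero, S.functional_center]
    have := Submodule.smul_mem _ ε⁻¹ (sub_mem_vectorSpan hmem (S.center_mem_facet j))
    rwa [add_sub_cancel_left, smul_smul, inv_mul_cancel₀ (ne_of_gt hε0), one_smul] at this

theorem mem_lattice_facet_iff (j : ι) (w : Fin n → ℤ) :
    w ∈ lattice (S.facet j) ↔ w ∈ lattice σ ∧ S.functional j (intCast n w) = 0 := by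
  change intCast n w ∈ vectorSpan ℝ (S.facet j) ↔ _
  rw [vectorSpan_facet]
  rfl

theorem mem_facet_iff (j : ι) {a : Fin n → ℝ} (ha : a ∈ S.facet j) (x : Fin n → ℝ) :
    x ∈ S.facet j ↔
      x - a ∈ vectorSpan ℝ (S.facet j) ∧ ∀ i, i ≠ j → S.bound i ≤ S.functional i x := by
  refine ⟨fun hx => ⟨sub_mem_vectorSpan hx ha, fun i _ => S.bound_le hx.1 i⟩, fun hx => ?_⟩
  have h1 := hx.1
  rw [vectorSpan_facet] at h1
  have h2 : S.functional j (x - a) = 0 := h1.2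
  rw [map_sub, ha.2, sub_eq_zero] at h2
  refine ⟨(S.mem_iff a ha.1 x).2 ⟨h1.1, fun i => ?_⟩, h2⟩
  by_cases hij : i = j
  · rw [hij, h2]
  · exact hx.2 i hij

theorem dim_facet (j : ι) : dim (S.facet j) + 1 = dim σ := by
  have hw : intCast n (S.normal j) ∈ vectorSpan ℝ σ := S.normal_mem j
  let f : vectorSpan ℝ σ →ₗ[ℝ] ℝ := (S.functional j).toLinearMap.domRestrict _
  have hf : Function.Surjective f := by
    intro t
    refine ⟨t • ⟨_, hw⟩, ?_⟩
    rw [map_smul]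
    change t • S.functional j (intCast n (S.normal j)) = t
    rw [S.functional_normal, smul_eq_mul, mul_one]
  have h1 := LinearMap.finrank_range_add_finrank_ker f
  rw [LinearMap.range_eq_top.2 hf, finrank_top, Module.finrank_self] at h1
  have h2 : Module.finrank ℝ f.ker = dim (S.facet j) := by
    have : (f.ker).map (vectorSpan ℝ σ).subtype = vectorSpan ℝ (S.facet j) := by
      rw [vectorSpan_facet]
      ext x
      simp only [Submodule.mem_map, LinearMap.mem_ker, Submodule.coe_subtype, Submodule.mem_inf]
      constructor
      · rintro ⟨y, hy, rfl⟩
        exact ⟨y.2, hy⟩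
      · rintro ⟨hx, hx'⟩
        exact ⟨⟨x, hx⟩, hx', rfl⟩
    rw [dim, ← this]
    exact (LinearEquiv.finrank_eq (Submodule.equivMapOfInjective _
      (Submodule.injective_subtype _) _))
  have h3 : dim σ = Module.finrank ℝ (vectorSpan ℝ σ) := rfl
  omega

/-- Every face of codimension one is one of the facets of the system. -/
theorem exists_facet_eq {τ : Set (Fin n → ℝ)} (hσ : Convex ℝ σ) (h : IsFace τ σ)
    (hd : dim τ + 1 = dim σ) : ∃ j, τ = S.facet j := by
  obtain ⟨t, ht⟩ := exists_isRelInterior (h.2.convex hσ) h.1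
  obtain ⟨l, hl⟩ := h.exists_functional
  have htσ := h.subset ht.1
  have hex : ∃ j, S.functional j t = S.bound j := by
    by_contra! hcon
    have hev : ∀ᶠ g in nhds (0 : Fin n → ℝ), ∀ j, S.bound j ≤ S.functional j (t + g) := by
      refine Filter.eventually_all.2 fun j => ?_
      have hcont : Continuous fun g => S.functional j (t + g) := by fun_prop
      have hlt : S.bound j < S.functional j (t + 0) := by
        rw [add_zero]
        exact lt_of_le_of_ne (S.bound_le htσ j) (hcon j).symm
      exact (hcont.tendsto 0).eventually_const_le hlt
    have hrel : IsRelInterior σ t := ⟨htσ, hev.mono fun g hg hgs =>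
      (S.mem_iff t htσ _).2 ⟨by rwa [add_sub_cancel_left], hg⟩⟩
    rw [h.eq_of_isRelInterior hrel ht.1] at hd
    omega
  obtain ⟨j, hj⟩ := hex
  refine ⟨j, ?_⟩
  have hsub : τ ⊆ S.facet j := fun x hx => ⟨h.subset hx, by
    rw [← hj]
    exact ht.map_eq (S.functional j) (fun y hy => hj ▸ S.bound_le (h.subset hy) j) hx⟩
  have hspan : vectorSpan ℝ τ = vectorSpan ℝ (S.facet j) := by
    refine Submodule.eq_of_le_of_finrank_eq (vectorSpan_mono ℝ hsub) ?_
    have := S.dim_facet j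
    simp only [dim] at this hd
    omega
  refine hsub.antisymm fun y hy => (hl y).2 ⟨hy.1, fun z hz => ?_⟩
  have h1 := ht.map_eq_zero (-l) (fun x hx => by simpa using ((hl t).1 ht.1).2 x (h.subset hx))
    (hspan ▸ sub_mem_vectorSpan hy (hsub ht.1))
  rw [map_sub, neg_apply, neg_apply] at h1
  have h2 := ((hl t).1 ht.1).2 z hz
  linarith

/-- A lattice basis of a facet, extended by a vector on which the normal covector is `1`, is a
lattice basis of the polyhedron. -/
theorem isLatticeBasis_consBasis {q : ℕ} (j : ι) {v : Fin q → Fin n → ℤ}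
    (hv : IsLatticeBasis (S.facet j) v) : IsLatticeBasis σ (consBasis (S.normal j) v) := by
  have hv0 : ∀ k, v k ∈ lattice σ ∧ S.functional j (intCast n (v k)) = 0 := fun k =>
    (S.mem_lattice_facet_iff j _).1 (hv.span_eq ▸ Submodule.subset_span (Set.mem_range_self k))
  constructor
  · have : (fun k => intCast n (consBasis (S.normal j) v k)) =
        Fin.cons (intCast n (S.normal j)) fun k => intCast n (v k) := by
      ext k i
      refine Fin.cases ?_ (fun k => ?_) k <;> simp
    rw [this, linearIndependent_finCons]
    refine ⟨hv.linearIndependent, fun hmem => ?_⟩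
    have h0 : S.functional j (intCast n (S.normal j)) = 0 := by
      refine Submodule.span_induction (p := fun h _ => S.functional j h = 0) ?_ (map_zero _)
        ?_ ?_ hmem
      · rintro _ ⟨k, rfl⟩
        exact (hv0 k).2
      · intro x y _ _ hx hy
        rw [map_add, hx, hy, add_zero]
      · intro t x _ hx
        rw [map_smul, hx, smul_zero]
    rw [S.functional_normal] at h0
    exact one_ne_zero h0
  · rw [Fin.range_cons]
    refine le_antisymm (Submodule.span_le.2 ?_) fun x hx => ?_
    · rintro _ (rfl | ⟨k, rfl⟩)
      · exact S.normal_mem j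
      · exact (hv0 k).1
    · obtain ⟨k, hk⟩ := S.integral j x hx
      have h1 : x - k • S.normal j ∈ Submodule.span ℤ (Set.range v) := by
        rw [hv.span_eq, S.mem_lattice_facet_iff]
        refine ⟨sub_mem hx (Submodule.smul_mem _ _ (S.normal_mem j)), ?_⟩
        rw [map_sub, map_sub, map_zsmul, map_zsmul, S.functional_normal, hk]
        simp
      rw [Submodule.mem_span_insert]
      exact ⟨k, _, h1, by abel⟩

theorem mk_eq_of_functional_eq (j : ι) {w : Fin n → ℤ} (hw : w ∈ lattice σ) {k : ℤ}
    (hk : S.functional j (intCast n w) = k) :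
    (Submodule.Quotient.mk w : NormalLattice (S.facet j)) =
      k • Submodule.Quotient.mk (S.normal j) := by
  rw [← Submodule.Quotient.mk_smul, Submodule.Quotient.eq, S.mem_lattice_facet_iff]
  refine ⟨sub_mem hw (Submodule.smul_mem _ _ (S.normal_mem j)), ?_⟩
  rw [map_sub, map_sub, map_zsmul, map_zsmul, S.functional_normal, hk]
  simp

theorem isPrimitiveGenerator_normal (j : ι) :
    IsPrimitiveGenerator σ (S.facet j) (Submodule.Quotient.mk (S.normal j)) := by
  refine ⟨fun k u' hu => ?_, S.normal j, rfl, ?_⟩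
  · obtain ⟨w, rfl⟩ := Submodule.Quotient.mk_surjective _ u'
    rw [← Submodule.Quotient.mk_smul, Submodule.Quotient.eq, S.mem_lattice_facet_iff] at hu
    have hk0 : k ≠ 0 := by
      rintro rfl
      have := hu.2
      rw [zero_smul, sub_zero, S.functional_normal] at this
      exact one_ne_zero this
    have hkw : (k : ℝ) • intCast n w ∈ vectorSpan ℝ σ := by
      have h1 : k • w ∈ lattice σ := by
        have := sub_mem (S.normal_mem j) hu.1
        rwa [sub_sub_cancel] at this
      have h2 : intCast n (k • w) ∈ vectorSpan ℝ σ := h1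
      rwa [map_zsmul, ← Int.cast_smul_eq_zsmul ℝ] at h2
    have hw : w ∈ lattice σ := by
      have := Submodule.smul_mem _ (k : ℝ)⁻¹ hkw
      rwa [smul_smul, inv_mul_cancel₀ (by exact_mod_cast hk0), one_smul] at this
    obtain ⟨m, hm⟩ := S.integral j w hw
    have h3 := hu.2
    rw [map_sub, map_sub, map_zsmul, map_zsmul, S.functional_normal, hm, zsmul_eq_mul,
      sub_eq_zero] at h3
    exact IsUnit.of_mul_eq_one m (by exact_mod_cast h3.symm)
  · -- For small `ε`, the point `center j + ε • normal j` lies in `σ`.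
    have hev : ∀ i, ∀ᶠ ε in nhdsWithin (0 : ℝ) (Set.Ioi 0),
        S.bound i ≤ S.functional i (S.center j + ε • intCast n (S.normal j)) := by
      intro i
      by_cases hij : i = j
      · filter_upwards [self_mem_nhdsWithin] with ε hε
        rw [hij, map_add, map_smul, S.functional_normal, S.functional_center, smul_eq_mul, mul_one]
        exact le_add_of_nonneg_right (le_of_lt hε)
      · have hcont : Continuous fun ε : ℝ =>
          S.functional i (S.center j + ε • intCast n (S.normal j)) := by fun_prop
        have hlt : S.bound i < S.functional i (S.center j + (0 : ℝ) • intCast n (S.normal j)) := by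
          simpa using S.lt_functional_center j i hij
        exact ((hcont.tendsto 0).eventually_const_le hlt).filter_mono nhdsWithin_le_nhds
    obtain ⟨ε, hε, hε0⟩ := ((Filter.eventually_all.2 hev).and self_mem_nhdsWithin).exists
    have hε0 : 0 < ε := hε0
    have hmem : S.center j + ε • intCast n (S.normal j) ∈ σ := by
      refine (S.mem_iff _ (S.center_mem j) _).2 ⟨?_, hε⟩
      rw [add_sub_cancel_left]
      exact Submodule.smul_mem _ _ (S.normal_mem j)
    have h1 : ε • intCast n (S.normal j) ∈ PointedCone.hull ℝ (σ - S.facet j) :=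
      Submodule.subset_span ⟨_, hmem, _, S.center_mem_facet j, by simp⟩
    have h2 := Submodule.smul_mem (PointedCone.hull ℝ (σ - S.facet j))
      (⟨ε⁻¹, (inv_pos.2 hε0).le⟩ : {c : ℝ // 0 ≤ c}) h1
    have h3 : (⟨ε⁻¹, (inv_pos.2 hε0).le⟩ : {c : ℝ // 0 ≤ c}) • ε • intCast n (S.normal j) =
        intCast n (S.normal j) := by
      change ε⁻¹ • ε • intCast n (S.normal j) = _
      rw [smul_smul, inv_mul_cancel₀ hε0.ne', one_smul]
    rwa [h3] at h2

theorem primitiveGenerator_facet (j : ι) :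
    primitiveGenerator σ (S.facet j) = Submodule.Quotient.mk (S.normal j) := by
  have hu : IsPrimitiveGenerator σ (S.facet j) (primitiveGenerator σ (S.facet j)) :=
    Classical.epsilon_spec ⟨_, S.isPrimitiveGenerator_normal j⟩
  obtain ⟨w, hw, hcone⟩ := hu.mem_cone
  obtain ⟨hwσ, hnonneg⟩ := S.functional_nonneg_of_mem_hull j _ hcone
  obtain ⟨k, hk⟩ := S.integral j w hwσ
  have h1 := S.mk_eq_of_functional_eq j hwσ hk
  rw [hw] at h1
  rw [hk] at hnonneg
  have hk0 : 0 ≤ k := by exact_mod_cast hnonneg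
  rcases Int.isUnit_iff.1 (hu.primitive k _ h1) with h | h
  · rw [h1, h, one_smul]
  · omega

end FacetSystem

/-! ### Smooth cutoff functions -/

/-- A smooth step function, equal to `0` on `(-∞, -1]` and to `1` on `[0, ∞)`. With this choice
`step (t / ε)` tends to the indicator function of `t ≥ 0` at every point `t` as `ε → 0`. -/
def step (t : ℝ) : ℝ := Real.smoothTransition (t + 1)

theorem contDiff_step : ContDiff ℝ 1 step :=
  Real.smoothTransition.contDiff.comp (contDiff_id.add contDiff_const)

theorem step_of_nonneg {t : ℝ} (h : 0 ≤ t) : step t = 1 :=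
  Real.smoothTransition.one_of_one_le (by linarith)

theorem step_of_le {t : ℝ} (h : t ≤ -1) : step t = 0 :=
  Real.smoothTransition.zero_of_nonpos (by linarith)

theorem abs_step_le (t : ℝ) : |step t| ≤ 1 := by
  rw [step, abs_of_nonneg (Real.smoothTransition.nonneg _)]
  exact Real.smoothTransition.le_one _

theorem continuous_deriv_step : Continuous (deriv step) := contDiff_step.continuous_deriv le_rfl

theorem deriv_step_eq_zero {t : ℝ} (h : t ∉ Set.Icc (-1 : ℝ) 0) : deriv step t = 0 := by
  rw [Set.mem_Icc, not_and_or, not_le, not_le] at h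
  rcases h with h | h
  · have : step =ᶠ[nhds t] fun _ => 0 := by
      filter_upwards [Iio_mem_nhds h] with s hs using step_of_le (le_of_lt hs)
    rw [this.deriv_eq, deriv_const]
  · have : step =ᶠ[nhds t] fun _ => 1 := by
      filter_upwards [Ioi_mem_nhds h] with s hs using step_of_nonneg (le_of_lt hs)
    rw [this.deriv_eq, deriv_const]

theorem hasCompactSupport_deriv_step : HasCompactSupport (deriv step) :=
  HasCompactSupport.intro isCompact_Icc fun _ h => deriv_step_eq_zero h

theorem integral_deriv_step : ∫ t, deriv step t = 1 := by
  have h := integral_of_hasDerivAt_of_tendsto (f := step) (f' := deriv step) (m := 0) (n := 1)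
    (fun t => (contDiff_step.differentiable one_ne_zero t).hasDerivAt)
    (continuous_deriv_step.integrable_of_hasCompactSupport hasCompactSupport_deriv_step)
    (tendsto_const_nhds.congr' (by
      filter_upwards [Filter.eventually_le_atBot (-1 : ℝ)] with t ht using (step_of_le ht).symm))
    (tendsto_const_nhds.congr' (by
      filter_upwards [Filter.eventually_ge_atTop (0 : ℝ)] with t ht using (step_of_nonneg ht).symm))
  rw [h, sub_zero]

open Classical in
theorem tendsto_step_div (b : ℝ) :
    Filter.Tendsto (fun ε : ℝ => step (b / ε)) (nhdsWithin 0 (Set.Ioi 0))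
      (nhds (if 0 ≤ b then 1 else 0)) := by
  split_ifs with h
  · refine tendsto_const_nhds.congr' ?_
    filter_upwards [self_mem_nhdsWithin] with ε hε
    exact (step_of_nonneg (div_nonneg h (le_of_lt hε))).symm
  · push Not at h
    refine tendsto_const_nhds.congr' ?_
    filter_upwards [self_mem_nhdsWithin,
      mem_nhdsWithin_of_mem_nhds (Iio_mem_nhds (neg_pos.2 h))] with ε hε hε'
    have hε : 0 < ε := hε
    have hε' : ε < -b := hε'
    exact (step_of_le ((div_le_iff₀ hε).2 (by linarith))).symm

open Classical in
theorem tendsto_step_div_add {b : ℝ} (hb : b ≠ 0) (c : ℝ) :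
    Filter.Tendsto (fun ε : ℝ => step ((b + ε * c) / ε)) (nhdsWithin 0 (Set.Ioi 0))
      (nhds (if 0 ≤ b then 1 else 0)) := by
  have hc : Filter.Tendsto (fun ε : ℝ => b + ε * c) (nhds 0) (nhds b) := by
    have : Continuous fun ε : ℝ => b + ε * c := by fun_prop
    simpa using this.tendsto 0
  have hc' : Filter.Tendsto (fun ε : ℝ => b + ε * c + ε) (nhds 0) (nhds b) := by
    have : Continuous fun ε : ℝ => b + ε * c + ε := by fun_prop
    simpa using this.tendsto 0
  rcases lt_or_gt_of_ne hb with h | h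
  · rw [if_neg (not_le.2 h)]
    refine tendsto_const_nhds.congr' ?_
    filter_upwards [self_mem_nhdsWithin,
      (hc'.eventually (Iio_mem_nhds h)).filter_mono nhdsWithin_le_nhds] with ε hε hε'
    have hε : 0 < ε := hε
    have hε' : b + ε * c + ε < 0 := hε'
    exact (step_of_le ((div_le_iff₀ hε).2 (by linarith))).symm
  · rw [if_pos h.le]
    refine tendsto_const_nhds.congr' ?_
    filter_upwards [self_mem_nhdsWithin,
      (hc.eventually (Ioi_mem_nhds h)).filter_mono nhdsWithin_le_nhds] with ε hε hε'
    exact (step_of_nonneg (div_nonneg (le_of_lt hε') (le_of_lt hε))).symm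

open Classical in
theorem prod_indicator {κ : Type*} (s : Finset κ) (b : κ → ℝ) :
    ∏ i ∈ s, (if 0 ≤ b i then (1 : ℝ) else 0) = if ∀ i ∈ s, 0 ≤ b i then 1 else 0 := by
  split_ifs with h
  · exact Finset.prod_eq_one fun i hi => if_pos (h i hi)
  · push Not at h
    obtain ⟨i, hi, hlt⟩ := h
    exact Finset.prod_eq_zero hi (if_neg (not_le.2 hlt))

/-- A family of functions concentrating along `t = 0`: its limit is the integral over the part of
this hyperplane on which the affine functions `b_i + t β_i` are nonnegative. -/
theorem tendsto_integral_concentrate {q : ℕ} {κ : Type*} (J : Finset κ)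
    {b : κ → (Fin q → ℝ) → ℝ} (hb : ∀ i, Continuous (b i)) (β : κ → ℝ)
    (hnull : ∀ i ∈ J, ∀ᵐ y, b i y ≠ 0) {h : ℝ × (Fin q → ℝ) → ℂ} (hh : Continuous h)
    (hc : HasCompactSupport h) :
    Filter.Tendsto (fun ε : ℝ => ∫ x : ℝ × (Fin q → ℝ),
        ((ε⁻¹ * deriv step (x.1 / ε) * ∏ i ∈ J, step ((b i x.2 + x.1 * β i) / ε) : ℝ) : ℂ) * h x)
      (nhdsWithin 0 (Set.Ioi 0)) (nhds (∫ y in {y | ∀ i ∈ J, 0 ≤ b i y}, h (0, y))) := by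
  classical
  have hstep : Continuous step := contDiff_step.continuous
  have hds := continuous_deriv_step
  obtain ⟨C, hC⟩ := hh.bounded_above_of_compact_support hc
  obtain ⟨M, hM⟩ := hds.bounded_above_of_compact_support hasCompactSupport_deriv_step
  let L : Set (Fin q → ℝ) := Prod.snd '' tsupport h
  have hL : IsCompact L := hc.isCompact.image continuous_snd
  -- The substitution `t = ε u`.
  let F : ℝ → ℝ × (Fin q → ℝ) → ℂ := fun ε x =>
    ((deriv step x.1 * ∏ i ∈ J, step ((b i x.2 + ε * x.1 * β i) / ε) : ℝ) : ℂ) * h (ε * x.1, x.2)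
  have hFcont : ∀ ε, Continuous (F ε) := fun ε => by fun_prop
  have hFsupp : ∀ ε x, x ∉ Set.Icc (-1 : ℝ) 0 ×ˢ L → F ε x = 0 := by
    intro ε x hx
    rw [Set.mem_prod, not_and_or] at hx
    rcases hx with hx | hx
    · simp [F, deriv_step_eq_zero hx]
    · have : h (ε * x.1, x.2) = 0 := by
        by_contra hne
        exact hx ⟨_, subset_tsupport _ hne, rfl⟩
      simp [F, this]
  have hFint : ∀ ε, Integrable (F ε) := fun ε =>
    (hFcont ε).integrable_of_hasCompactSupport
      (HasCompactSupport.intro (isCompact_Icc.prod hL) (hFsupp ε))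
  have hsubst : ∀ ε : ℝ, 0 < ε → ∫ x : ℝ × (Fin q → ℝ),
      ((ε⁻¹ * deriv step (x.1 / ε) * ∏ i ∈ J, step ((b i x.2 + x.1 * β i) / ε) : ℝ) : ℂ) * h x =
        ∫ x, F ε x := by
    intro ε hε
    have hint : Integrable fun x : ℝ × (Fin q → ℝ) =>
        ((ε⁻¹ * deriv step (x.1 / ε) * ∏ i ∈ J, step ((b i x.2 + x.1 * β i) / ε) : ℝ) : ℂ) *
          h x := by
      refine Continuous.integrable_of_hasCompactSupport (by fun_prop) ?_
      exact hc.mul_left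
    rw [Measure.volume_eq_prod, integral_prod_symm _ hint, integral_prod_symm _ (hFint ε)]
    refine integral_congr_ae (Filter.Eventually.of_forall fun y => ?_)
    have := Measure.integral_comp_mul_left (fun t : ℝ =>
      ((deriv step (t / ε) * ∏ i ∈ J, step ((b i y + t * β i) / ε) : ℝ) : ℂ) * h (t, y)) ε
    simp only [F]
    simp only [mul_div_cancel_left₀ _ hε.ne'] at this
    rw [this, abs_of_pos (inv_pos.2 hε), ← integral_smul]
    refine integral_congr_ae (Filter.Eventually.of_forall fun t => ?_)
    simp only [Complex.real_smul]
    push_cast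
    ring
  refine Filter.Tendsto.congr' (f₁ := fun ε => ∫ x, F ε x) ?_ ?_
  · filter_upwards [self_mem_nhdsWithin] with ε hε using (hsubst ε hε).symm
  have hmeas : MeasurableSet {y | ∀ i ∈ J, 0 ≤ b i y} := by
    refine IsClosed.measurableSet ?_
    have : {y | ∀ i ∈ J, 0 ≤ b i y} = ⋂ i ∈ J, {y | 0 ≤ b i y} := by ext; simp
    rw [this]
    exact isClosed_biInter fun i _ => isClosed_le continuous_const (hb i)
  let F₀ : ℝ × (Fin q → ℝ) → ℂ := fun x =>
    ((deriv step x.1 : ℝ) : ℂ) * Set.indicator {y | ∀ i ∈ J, 0 ≤ b i y} (fun y => h (0, y)) x.2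
  have hlim : ∫ x, F₀ x = ∫ y in {y | ∀ i ∈ J, 0 ≤ b i y}, h (0, y) := by
    rw [Measure.volume_eq_prod, integral_prod_mul (fun t : ℝ => ((deriv step t : ℝ) : ℂ)),
      integral_indicator hmeas, integral_complex_ofReal, integral_deriv_step]
    simp
  rw [← hlim]
  refine tendsto_integral_filter_of_dominated_convergence
    (Set.indicator (Set.Icc (-1 : ℝ) 0 ×ˢ L) fun _ => M * C)
    (Filter.Eventually.of_forall fun ε => (hFcont ε).aestronglyMeasurable) ?_ ?_ ?_
  · refine Filter.Eventually.of_forall fun ε => Filter.Eventually.of_forall fun x => ?_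
    by_cases hx : x ∈ Set.Icc (-1 : ℝ) 0 ×ˢ L
    · rw [Set.indicator_of_mem hx]
      simp only [F, norm_mul, Complex.norm_real, norm_prod]
      have h1 : ∏ i ∈ J, ‖step ((b i x.2 + ε * x.1 * β i) / ε)‖ ≤ 1 :=
        Finset.prod_le_one (fun _ _ => norm_nonneg _) fun _ _ => abs_step_le _
      have h2 : ‖deriv step x.1‖ * ∏ i ∈ J, ‖step ((b i x.2 + ε * x.1 * β i) / ε)‖ ≤ M * 1 :=
        mul_le_mul (hM _) h1 (Finset.prod_nonneg fun _ _ => norm_nonneg _)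
          ((norm_nonneg _).trans (hM 0))
      rw [mul_one] at h2
      exact mul_le_mul h2 (hC _) (norm_nonneg _) ((norm_nonneg _).trans (hM 0))
    · rw [Set.indicator_of_notMem hx, hFsupp ε x hx, norm_zero]
  · exact (integrable_indicator_iff (isCompact_Icc.prod hL).measurableSet).2
      (integrableOn_const (isCompact_Icc.prod hL).measure_lt_top.ne)
  · have hae : ∀ᵐ x : ℝ × (Fin q → ℝ), ∀ i ∈ J, b i x.2 ≠ 0 := by
      have h1 : ∀ᵐ y : Fin q → ℝ, ∀ i ∈ J, b i y ≠ 0 := (Filter.eventually_all_finset J).2 hnull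
      rw [Measure.volume_eq_prod]
      exact Measure.quasiMeasurePreserving_snd.ae h1
    filter_upwards [hae] with x hx
    have h1 : Filter.Tendsto (fun ε : ℝ => ∏ i ∈ J, step ((b i x.2 + ε * x.1 * β i) / ε))
        (nhdsWithin 0 (Set.Ioi 0)) (nhds (if ∀ i ∈ J, 0 ≤ b i x.2 then 1 else 0)) := by
      rw [← prod_indicator]
      refine tendsto_finsetProd _ fun i hi => ?_
      simpa only [mul_assoc] using tendsto_step_div_add (hx i hi) (x.1 * β i)
    have h2 : Filter.Tendsto (fun ε : ℝ => h (ε * x.1, x.2)) (nhdsWithin 0 (Set.Ioi 0))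
        (nhds (h (0, x.2))) := by
      have : Continuous fun ε : ℝ => h (ε * x.1, x.2) := by fun_prop
      simpa using (this.tendsto 0).mono_left nhdsWithin_le_nhds
    have h3 : F₀ x = ((deriv step x.1 * (if ∀ i ∈ J, 0 ≤ b i x.2 then 1 else 0) : ℝ) : ℂ) *
        h (0, x.2) := by
      simp only [F₀, Set.indicator_apply]
      split_ifs with hc1 hc2 hc2
      · simp
      · exact absurd hc1 hc2
      · exact absurd hc2 hc1
      · simp
    rw [h3]
    exact ((Complex.continuous_ofReal.tendsto _).comp (h1.const_mul _)).mul h2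

/-- The zero set of an affine function that takes a nonzero value is a null set. -/
theorem ae_affine_ne_zero {q : ℕ} (l : (Fin q → ℝ) →ₗ[ℝ] ℝ) (c : ℝ) {y₀ : Fin q → ℝ}
    (hy₀ : l y₀ + c ≠ 0) : ∀ᵐ y, l y + c ≠ 0 := by
  let A : AffineSubspace ℝ (Fin q → ℝ) :=
    { carrier := {y | l y + c = 0}
      smul_vsub_vadd_mem' := by
        intro t x y z hx hy hz
        change l (t • (x - y) + z) + c = 0
        have hx : l x + c = 0 := hx
        have hy : l y + c = 0 := hy
        have hz : l z + c = 0 := hz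
        rw [map_add, map_smul, map_sub, smul_eq_mul]
        linear_combination t * hx - t * hy + hz }
  have hA : A ≠ ⊤ := fun h => hy₀ (h ▸ AffineSubspace.mem_top ℝ _ y₀ : y₀ ∈ A)
  have := Measure.addHaar_affineSubspace volume A hA
  exact measure_eq_zero_iff_ae_notMem.1 this

/-! ### Stokes' theorem for a polyhedron -/

theorem isClosedEmbedding_chart {n p : ℕ} {v : Fin p → Fin n → ℤ}
    (hv : LinearIndependent ℝ fun j => intCast n (v j)) (a : Fin n → ℝ) :
    Topology.IsClosedEmbedding (chart v a) := by
  have hf : Topology.IsClosedEmbedding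
      (Fintype.linearCombination ℝ (fun j => intCast n (v j)) : (Fin p → ℝ) →ₗ[ℝ] Fin n → ℝ) :=
    LinearMap.isClosedEmbedding_of_injective
      (LinearMap.ker_eq_bot.2 hv.fintypeLinearCombination_injective)
  exact (Homeomorph.addLeft a).isClosedEmbedding.comp hf

theorem chart_add_smul {n p : ℕ} (v : Fin p → Fin n → ℤ) (a : Fin n → ℝ) (s e : Fin p → ℝ)
    (t : ℝ) : chart v a (s + t • e) = chart v a s + t • ∑ j, e j • intCast n (v j) := by
  simp only [chart, Pi.add_apply, Pi.smul_apply, add_smul, Finset.sum_add_distrib, smul_eq_mul,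
    mul_smul, Finset.smul_sum, add_assoc]

theorem chart_sub_mem {n p : ℕ} {σ : Set (Fin n → ℝ)} {v : Fin p → Fin n → ℤ}
    (hv : IsLatticeBasis σ v) (a : Fin n → ℝ) (s : Fin p → ℝ) :
    chart v a s - a ∈ vectorSpan ℝ σ := by
  rw [chart, add_sub_cancel_left]
  refine Submodule.sum_mem _ fun j _ => Submodule.smul_mem _ _ ?_
  exact (hv.span_eq ▸ Submodule.subset_span (Set.mem_range_self j) : v j ∈ lattice σ)

/-- A lattice basis of a rational polyhedron spans the parallel linear space. -/
theorem IsLatticeBasis.span_real {n p : ℕ} {σ : Set (Fin n → ℝ)} (hσ : IsRationalPolyhedron σ)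
    (hne : σ.Nonempty) {v : Fin p → Fin n → ℤ} (hv : IsLatticeBasis σ v) :
    Submodule.span ℝ (Set.range fun j => intCast n (v j)) = vectorSpan ℝ σ := by
  rw [← span_lattice hσ hne, ← hv.span_eq]
  refine le_antisymm (Submodule.span_mono ?_) (Submodule.span_le.2 ?_)
  · rintro _ ⟨k, rfl⟩
    exact ⟨v k, Submodule.subset_span ⟨k, rfl⟩, rfl⟩
  · rintro _ ⟨w, hw, rfl⟩
    refine Submodule.span_induction (p := fun w _ => intCast n w ∈
      Submodule.span ℝ (Set.range fun k => intCast n (v k))) ?_ ?_ ?_ ?_ hw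
    · rintro _ ⟨k, rfl⟩
      exact Submodule.subset_span ⟨k, rfl⟩
    · simp
    · intro x y _ _ hx hy
      rw [map_add]
      exact Submodule.add_mem _ hx hy
    · intro t x _ hx
      rw [map_zsmul]
      exact zsmul_mem hx t

theorem integrable_chart {n p : ℕ} {v : Fin p → Fin n → ℤ}
    (hv : LinearIndependent ℝ fun j => intCast n (v j)) (a : Fin n → ℝ) {g : (Fin n → ℝ) → ℂ}
    (hg : Continuous g) (hc : HasCompactSupport g) : Integrable fun s => g (chart v a s) :=
  (hg.comp (continuous_chart v a)).integrable_of_hasCompactSupport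
    (hc.comp_isClosedEmbedding (isClosedEmbedding_chart hv a))

theorem hasCompactSupport_mean_invEval {n k : ℕ} (φ : TestForm n k) (X : Fin k → Fin n → ℂ) :
    HasCompactSupport (mean (invEval φ X)) :=
  hasCompactSupport_mean φ.hasCompactSupport φ.tsupport_subset
    fun _ hz => invEval_eq_zero φ X hz

theorem continuous_mean_invEval {n k : ℕ} (φ : TestForm n k) (X : Fin k → Fin n → ℂ) :
    Continuous (mean (invEval φ X)) := continuous_mean (contDiff_invEval φ X).continuous

theorem mean_wedgeForm {n k : ℕ} (φ : TestForm n k) (m : (Fin n → ℝ) →L[ℝ] ℝ)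
    (X : Fin (k + 1) → Fin n → ℂ) (r : Fin n → ℝ) :
    mean (fun z => wedgeForm m (invForm φ z) X) r =
      ∑ i, (-1) ^ i.val * (m (rePart n (X i)) * mean (invEval φ (i.removeNth X)) r) := by
  simp only [wedgeForm_apply, invForm_apply]
  rw [mean_sum]
  · simp only [mean_const_mul]
  · intro i
    have := (contDiff_invEval φ (i.removeNth X)).continuous
    fun_prop

/-- Integration by parts on a rational affine space against a function `R` of `Log z`. -/
theorem integral_mul_mean_d {n k p : ℕ} {v : Fin p → Fin n → ℤ}
    (hv : LinearIndependent ℝ fun j => intCast n (v j)) (a : Fin n → ℝ) (φ : TestForm n k)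
    (X : Fin (k + 1) → Fin n → ℂ)
    (hX : ∀ i, rePart n (X i) ∈ Submodule.span ℝ (Set.range fun j => intCast n (v j)))
    {R : (Fin n → ℝ) → ℝ} (hR : ContDiff ℝ 1 R) :
    ∫ s, (R (chart v a s) : ℂ) * mean (invEval (TestForm.d n k φ) X) (chart v a s) =
      ∫ s, mean (fun z => wedgeForm (fderiv ℝ R (chart v a s)) (invForm φ z) X) (chart v a s) := by
  let f : Fin (k + 1) → (Fin n → ℂ) → ℂ := fun i => invEval φ (i.removeNth X)
  let D : Fin (k + 1) → (Fin n → ℂ) → ℂ := fun i z => fderiv ℝ (f i) z (X i * z)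
  have hf : ∀ i, ContDiff ℝ 1 (f i) := fun i => contDiff_invEval φ _
  have hD : ∀ i, Continuous (D i) := fun i => continuous_fderiv_invariant (hf i) (X i)
  have hDs : ∀ i, HasCompactSupport (mean (D i)) := fun i =>
    hasCompactSupport_mean φ.hasCompactSupport φ.tsupport_subset fun z hz => by
      have : f i =ᶠ[nhds z] fun _ => 0 := by
        filter_upwards [(isClosed_tsupport φ).isOpen_compl.mem_nhds hz] with w hw
        exact invEval_eq_zero φ _ hw
      simp [D, this.fderiv_eq]
  have hRc : Continuous fun r => (R r : ℂ) := Complex.continuous_ofReal.comp hR.continuous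
  have hR'c : ∀ i, Continuous fun r => (fderiv ℝ R r (rePart n (X i)) : ℂ) := fun i =>
    Complex.continuous_ofReal.comp
      ((hR.continuous_fderiv one_ne_zero).clm_apply continuous_const)
  have hint : ∀ {g h : (Fin n → ℝ) → ℂ}, Continuous g → Continuous h → HasCompactSupport h →
      Integrable fun s => g (chart v a s) * h (chart v a s) := fun hg hh hc =>
    integrable_chart hv a (hg.mul hh) hc.mul_left
  have hparts : ∀ i, ∫ s, (R (chart v a s) : ℂ) * mean (D i) (chart v a s) =
      ∫ s, (fderiv ℝ R (chart v a s) (rePart n (X i)) : ℂ) * mean (f i) (chart v a s) := by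
    intro i
    obtain ⟨e, he⟩ := Submodule.mem_span_range_iff_exists_fun ℝ |>.1 (hX i)
    have h1 : ∀ s, HasLineDerivAt ℝ (fun s => R (chart v a s))
        (fderiv ℝ R (chart v a s) (rePart n (X i))) s e := by
      intro s
      have := (hR.differentiable one_ne_zero (chart v a s)).hasFDerivAt.hasLineDerivAt
        (rePart n (X i))
      simpa only [HasLineDerivAt, chart_add_smul, he] using this
    have h2 : ∀ s, HasLineDerivAt ℝ (fun s => mean (f i) (chart v a s))
        (-mean (D i) (chart v a s)) s e := by
      intro s
      have := hasLineDerivAt_mean (hf i) (X i) (chart v a s)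
      simp only [HasLineDerivAt, chart_add_smul, he] at this ⊢
      exact this
    have key := integral_bilinear_hasLineDerivAt_right_eq_neg_left_of_integrable
      (μ := (volume : Measure (Fin p → ℝ))) (B := ContinuousLinearMap.lsmul ℝ ℝ (E := ℂ))
      (f := fun s => R (chart v a s))
      (f' := fun s => fderiv ℝ R (chart v a s) (rePart n (X i)))
      (g := fun s => mean (f i) (chart v a s)) (g' := fun s => -mean (D i) (chart v a s)) (v := e)
      (by
        simpa only [ContinuousLinearMap.lsmul_apply, Complex.real_smul] using
          hint (hR'c i) (continuous_mean (hf i).continuous) (hasCompactSupport_mean_invEval φ _))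
      (by
        simp only [ContinuousLinearMap.lsmul_apply, Complex.real_smul, mul_neg]
        exact (hint hRc (continuous_mean (hD i)) (hDs i)).neg)
      (by
        simpa only [ContinuousLinearMap.lsmul_apply, Complex.real_smul] using
          hint hRc (continuous_mean (hf i).continuous) (hasCompactSupport_mean_invEval φ _))
      (fun s _ => h1 s) (fun s _ => h2 s)
    simp only [ContinuousLinearMap.lsmul_apply, Complex.real_smul, mul_neg, integral_neg,
      neg_inj] at key
    exact key
  have hl : ∀ r, mean (invEval (TestForm.d n k φ) X) r =
      ∑ i : Fin (k + 1), (-1) ^ i.val * mean (D i) r := by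
    intro r
    have : invEval (TestForm.d n k φ) X = fun z => ∑ i : Fin (k + 1), (-1) ^ i.val * D i z :=
      funext fun z => invEval_d φ X z
    rw [this, mean_sum]
    · simp only [mean_const_mul]
    · intro i
      have := hD i
      fun_prop
  simp only [hl, mean_wedgeForm, Finset.mul_sum]
  rw [integral_finsetSum, integral_finsetSum]
  · refine Finset.sum_congr rfl fun i _ => ?_
    rw [integral_const_mul, ← hparts i, ← integral_const_mul]
    refine integral_congr_ae (Filter.Eventually.of_forall fun s => ?_)
    ring
  · intro i _
    exact (hint (hR'c i) (continuous_mean (hf i).continuous)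
      (hasCompactSupport_mean_invEval φ _)).const_mul _
  · intro i _
    refine ((hint hRc (continuous_mean (hD i)) (hDs i)).const_mul ((-1) ^ i.val)).congr ?_
    exact Filter.Eventually.of_forall fun s => by ring

namespace FacetSystem

variable {n : ℕ} {ι : Type} [Fintype ι] {σ : Set (Fin n → ℝ)} (S : FacetSystem ι σ)

/-- A smooth approximation to the indicator function of a polyhedron. -/
def cutoff (ε : ℝ) (r : Fin n → ℝ) : ℝ := ∏ j, step ((S.functional j r - S.bound j) / ε)

open Classical in
/-- The coefficient of the `j`-th normal covector in the derivative of the cutoff function. -/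
def cutoffDeriv (ε : ℝ) (j : ι) (r : Fin n → ℝ) : ℝ :=
  ε⁻¹ * deriv step ((S.functional j r - S.bound j) / ε) *
    ∏ i ∈ Finset.univ.erase j, step ((S.functional i r - S.bound i) / ε)

theorem contDiff_cutoff (ε : ℝ) : ContDiff ℝ 1 (S.cutoff ε) := by
  unfold cutoff
  refine contDiff_prod fun j _ => contDiff_step.comp ?_
  exact ((S.functional j).contDiff.sub contDiff_const).div_const _

theorem continuous_cutoffDeriv (ε : ℝ) (j : ι) : Continuous (S.cutoffDeriv ε j) := by
  have hstep : Continuous step := contDiff_step.continuous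
  have hds := continuous_deriv_step
  unfold cutoffDeriv
  fun_prop

theorem fderiv_cutoff (ε : ℝ) (r : Fin n → ℝ) :
    fderiv ℝ (S.cutoff ε) r = ∑ j, S.cutoffDeriv ε j r • S.functional j := by
  classical
  have h1 : ∀ j, HasFDerivAt (fun r => step ((S.functional j r - S.bound j) / ε))
      ((ε⁻¹ * deriv step ((S.functional j r - S.bound j) / ε)) • S.functional j) r := by
    intro j
    have h2 : HasFDerivAt (fun r => (S.functional j r - S.bound j) / ε)
        (ε⁻¹ • S.functional j) r := by
      simpa only [div_eq_mul_inv] using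
        ((S.functional j).hasFDerivAt.sub_const (S.bound j)).mul_const ε⁻¹
    have h3 := ((contDiff_step.differentiable one_ne_zero
      ((S.functional j r - S.bound j) / ε)).hasDerivAt).comp_hasFDerivAt r h2
    refine h3.congr_fderiv ?_
    rw [smul_smul, mul_comm]
  have h := HasFDerivAt.finsetProd (u := Finset.univ) (fun j _ => h1 j)
  refine h.fderiv.trans (Finset.sum_congr rfl fun j _ => ?_)
  rw [smul_smul, cutoffDeriv, mul_comm]

theorem tendsto_integral_cutoff {p : ℕ} {v : Fin p → Fin n → ℤ} (hv : IsLatticeBasis σ v)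
    {a : Fin n → ℝ} (ha : a ∈ σ) {g : (Fin n → ℝ) → ℂ} (hg : Continuous g)
    (hc : HasCompactSupport g) (hσ : IsClosed σ) :
    Filter.Tendsto (fun ε => ∫ s, (S.cutoff ε (chart v a s) : ℂ) * g (chart v a s))
      (nhdsWithin 0 (Set.Ioi 0)) (nhds (∫ s in chart v a ⁻¹' σ, g (chart v a s))) := by
  classical
  have hmeas : MeasurableSet (chart v a ⁻¹' σ) :=
    (hσ.preimage (continuous_chart v a)).measurableSet
  rw [← integral_indicator hmeas]
  refine tendsto_integral_filter_of_dominated_convergence (fun s => ‖g (chart v a s)‖) ?_ ?_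
    (integrable_chart hv.linearIndependent a hg hc).norm ?_
  · refine Filter.Eventually.of_forall fun ε => Continuous.aestronglyMeasurable ?_
    have := (S.contDiff_cutoff ε).continuous
    fun_prop
  · refine Filter.Eventually.of_forall fun ε => Filter.Eventually.of_forall fun s => ?_
    rw [norm_mul, Complex.norm_real, cutoff, norm_prod]
    exact mul_le_of_le_one_left (norm_nonneg _)
      (Finset.prod_le_one (fun _ _ => norm_nonneg _) fun _ _ => abs_step_le _)
  · refine Filter.Eventually.of_forall fun s => ?_
    have h1 : Filter.Tendsto (fun ε => S.cutoff ε (chart v a s)) (nhdsWithin 0 (Set.Ioi 0))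
        (nhds (∏ j, if 0 ≤ S.functional j (chart v a s) - S.bound j then 1 else 0)) := by
      exact tendsto_finsetProd _ fun j _ => tendsto_step_div _
    have h2 := ((Complex.continuous_ofReal.tendsto _).comp h1).mul_const (g (chart v a s))
    have h3 : s ∈ chart v a ⁻¹' σ ↔
        ∀ j ∈ Finset.univ, 0 ≤ S.functional j (chart v a s) - S.bound j := by
      simp only [Set.mem_preimage, S.mem_iff a ha, chart_sub_mem hv a s, true_and, sub_nonneg,
        Finset.mem_univ, forall_const]
    have h4 : (chart v a ⁻¹' σ).indicator (fun s => g (chart v a s)) s =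
        ((∏ j, if 0 ≤ S.functional j (chart v a s) - S.bound j then (1 : ℝ) else 0 : ℝ) : ℂ) *
          g (chart v a s) := by
      rw [Set.indicator_apply, prod_indicator]
      split_ifs with hc1 hc2 hc2
      · simp
      · exact absurd (h3.1 hc1) hc2
      · exact absurd (h3.2 hc2) hc1
      · simp
    rw [h4]
    exact h2

theorem chart_consBasis {n q : ℕ} (w : Fin n → ℤ) (v : Fin q → Fin n → ℤ) (a : Fin n → ℝ)
    (t : ℝ) (y : Fin q → ℝ) :
    chart (consBasis w v) a (Fin.cons t y) = chart v a y + t • intCast n w := by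
  simp only [chart, Fin.sum_univ_succ, consBasis, Fin.cons_zero, Fin.cons_succ]
  abel

/-- Integration over a lattice basis `(w, v)` splits off the first coordinate. -/
theorem integral_chart_consBasis {n q : ℕ} (w : Fin n → ℤ) (v : Fin q → Fin n → ℤ)
    (a : Fin n → ℝ) (g : (Fin n → ℝ) → ℂ) :
    ∫ s, g (chart (consBasis w v) a s) =
      ∫ x : ℝ × (Fin q → ℝ), g (chart v a x.2 + x.1 • intCast n w) := by
  have h := (volume_preserving_piFinSuccAbove (fun _ : Fin (q + 1) => ℝ) 0).symm
  rw [← h.integral_comp (MeasurableEquiv.measurableEmbedding _)]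
  refine integral_congr_ae (Filter.Eventually.of_forall fun x => ?_)
  simp only
  rw [← chart_consBasis, ← Fin.insertNth_zero']
  rfl

/-- The derivative of the cutoff function concentrates on the facets. -/
theorem tendsto_integral_cutoffDeriv {q : ℕ} (j : ι) {v : Fin q → Fin n → ℤ}
    (hv : IsLatticeBasis (S.facet j) v) {a : Fin n → ℝ} (ha : a ∈ S.facet j)
    (hτ : IsRationalPolyhedron (S.facet j)) {g : (Fin n → ℝ) → ℂ} (hg : Continuous g)
    (hc : HasCompactSupport g) :
    Filter.Tendsto (fun ε => ∫ s, (S.cutoffDeriv ε j (chart (consBasis (S.normal j) v) a s) : ℂ) *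
        g (chart (consBasis (S.normal j) v) a s))
      (nhdsWithin 0 (Set.Ioi 0)) (nhds (∫ y in chart v a ⁻¹' S.facet j, g (chart v a y))) := by
  classical
  let w := S.normal j
  let h : ℝ × (Fin q → ℝ) → ℂ := fun x => g (chart v a x.2 + x.1 • intCast n w)
  have hB := S.isLatticeBasis_consBasis j hv
  have hvj : ∀ k, S.functional j (intCast n (v k)) = 0 := fun k =>
    ((S.mem_lattice_facet_iff j _).1
      (hv.span_eq ▸ Submodule.subset_span (Set.mem_range_self k))).2
  have hchart : ∀ i y, S.functional i (chart v a y) - S.bound i =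
      (∑ k, y k * S.functional i (intCast n (v k))) + (S.functional i a - S.bound i) := by
    intro i y
    simp only [chart, map_add, map_sum, map_smul, smul_eq_mul]
    ring
  have hjchart : ∀ y, S.functional j (chart v a y) - S.bound j = 0 := by
    intro y
    rw [hchart, ha.2]
    simp [hvj]
  have key := tendsto_integral_concentrate (Finset.univ.erase j)
    (b := fun i y => S.functional i (chart v a y) - S.bound i)
    (fun i => by fun_prop) (fun i => S.functional i (intCast n w)) (fun i hi => ?_) (h := h)
    (by fun_prop) ?_
  · refine Filter.Tendsto.congr (f₁ := _) (fun ε => ?_) (key.trans_eq ?_)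
    · rw [integral_chart_consBasis (S.normal j) v a
        (fun r => (S.cutoffDeriv ε j r : ℂ) * g r)]
      refine integral_congr_ae (Filter.Eventually.of_forall fun x => ?_)
      simp only [h, cutoffDeriv, map_add, map_smul, smul_eq_mul]
      have h1 : S.functional j (chart v a x.2) + x.1 * S.functional j (intCast n (S.normal j)) -
          S.bound j = x.1 := by
        rw [S.functional_normal]
        linarith [hjchart x.2]
      have h2 : ∀ i, S.functional i (chart v a x.2) +
          x.1 * S.functional i (intCast n (S.normal j)) - S.bound i =
          S.functional i (chart v a x.2) - S.bound i +
            x.1 * S.functional i (intCast n w) := fun i => by ring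
      rw [h1]
      simp only [h2]
      rfl
    · have hset : chart v a ⁻¹' S.facet j =
          {y | ∀ i ∈ Finset.univ.erase j, 0 ≤ S.functional i (chart v a y) - S.bound i} := by
        ext y
        simp only [Set.mem_preimage, S.mem_facet_iff j ha, chart_sub_mem hv a y, true_and,
          Finset.mem_erase, Finset.mem_univ, and_true, sub_nonneg]
        rfl
      rw [hset]
      simp [h]
  · have hne : i ≠ j := (Finset.mem_erase.1 hi).1
    have hcen := S.center_mem_facet j
    obtain ⟨y₀, hy₀⟩ := Submodule.mem_span_range_iff_exists_fun ℝ |>.1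
      ((hv.span_real hτ ⟨a, ha⟩).symm ▸ sub_mem_vectorSpan hcen ha)
    have hy₀' : chart v a y₀ = S.center j := by rw [chart, hy₀]; abel
    have hl := ae_affine_ne_zero
      (Fintype.linearCombination ℝ (fun k => S.functional i (intCast n (v k))))
      (S.functional i a - S.bound i) (y₀ := y₀) (by
        have := hchart i y₀
        rw [hy₀'] at this
        simp only [Fintype.linearCombination_apply, smul_eq_mul]
        rw [← this]
        exact (sub_pos.2 (S.lt_functional_center j i hne)).ne')
    filter_upwards [hl] with y hy
    rw [hchart]
    simpa only [Fintype.linearCombination_apply, smul_eq_mul] using hy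
  · have hcomp := hc.comp_isClosedEmbedding (isClosedEmbedding_chart hB.linearIndependent a)
    have hK := hcomp.isCompact.image (f := fun s : Fin (q + 1) → ℝ => (s 0, Fin.tail s))
      (by unfold Fin.tail; fun_prop)
    refine HasCompactSupport.intro hK fun x hx => ?_
    by_contra hne
    refine hx ⟨Fin.cons x.1 x.2, subset_tsupport _ ?_, by simp⟩
    rw [Function.mem_support, Function.comp_apply, chart_consBasis]
    exact hne

theorem wedgeForm_sum_smul {n k : ℕ} {ι : Type*} (s : Finset ι) (c : ι → ℝ)
    (m : ι → (Fin n → ℝ) →L[ℝ] ℝ) (Ψ : (Fin n → ℂ) [⋀^Fin k]→L[ℝ] ℂ)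
    (X : Fin (k + 1) → Fin n → ℂ) :
    wedgeForm (∑ j ∈ s, c j • m j) Ψ X = ∑ j ∈ s, (c j : ℂ) * wedgeForm (m j) Ψ X := by
  simp only [wedgeForm_apply, Finset.mul_sum]
  rw [Finset.sum_comm]
  refine Finset.sum_congr rfl fun i _ => ?_
  rw [sum_apply]
  simp only [smul_apply, smul_eq_mul]
  push_cast
  rw [Finset.sum_mul, Finset.mul_sum]
  exact Finset.sum_congr rfl fun j _ => by ring

theorem continuous_wedgeForm {k : ℕ} (φ : TestForm n k) (m : (Fin n → ℝ) →L[ℝ] ℝ)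
    (X : Fin (k + 1) → Fin n → ℂ) : Continuous fun z => wedgeForm m (invForm φ z) X := by
  simp only [wedgeForm_apply, invForm_apply]
  have : ∀ i : Fin (k + 1), Continuous (invEval φ (i.removeNth X)) := fun i =>
    (contDiff_invEval φ _).continuous
  fun_prop

theorem hasCompactSupport_mean_wedgeForm {k : ℕ} (φ : TestForm n k) (m : (Fin n → ℝ) →L[ℝ] ℝ)
    (X : Fin (k + 1) → Fin n → ℂ) :
    HasCompactSupport (mean fun z => wedgeForm m (invForm φ z) X) :=
  hasCompactSupport_mean φ.hasCompactSupport φ.tsupport_subset fun z hz => by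
    simp [wedgeForm_apply, invForm_apply, invEval_eq_zero φ _ hz]

/-- Stokes' theorem on a rational polyhedron, for torus averages of forms. -/
theorem setIntegral_mean_d {q : ℕ} (hσ : IsRationalPolyhedron σ) {v : Fin (q + 1) → Fin n → ℤ}
    (hv : IsLatticeBasis σ v) {a : Fin n → ℝ} (ha : a ∈ σ) {u : ι → Fin q → Fin n → ℤ}
    (hu : ∀ j, IsLatticeBasis (S.facet j) (u j)) {b : ι → Fin n → ℝ} (hb : ∀ j, b j ∈ S.facet j)
    (φ : TestForm n (2 * q + 1)) :
    ∫ s in chart v a ⁻¹' σ,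
        mean (invEval (TestForm.d n (2 * q + 1) φ) (latticeFrame v)) (chart v a s) =
      ∑ j, ∫ s in chart (u j) (b j) ⁻¹' S.facet j,
        mean (invEval φ (Fin.cons (imVec (S.normal j)) (latticeFrame (u j))))
          (chart (u j) (b j) s) := by
  have hne : σ.Nonempty := ⟨a, ha⟩
  have hli := hv.linearIndependent
  have hfrat : ∀ j, IsRationalPolyhedron (S.facet j) := fun j =>
    (S.isFace_facet j).isRationalPolyhedron hσ
  have h1 := S.tendsto_integral_cutoff hv ha
    (continuous_mean_invEval (TestForm.d n (2 * q + 1) φ) (latticeFrame v))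
    (hasCompactSupport_mean_invEval _ _) hσ.isPolyhedron.isClosed
  have hframe : ∀ i : Fin (2 * q + 1 + 1), rePart n (latticeFrame v i) ∈
      Submodule.span ℝ (Set.range fun j => intCast n (v j)) := by
    intro i
    rw [rePart_latticeFrame]
    split_ifs
    · exact Submodule.subset_span ⟨_, rfl⟩
    · exact zero_mem _
  let W : ι → (Fin n → ℂ) → ℂ := fun j z =>
    wedgeForm (S.functional j) (invForm φ z) (latticeFrame v)
  have hWc : ∀ j, Continuous (W j) := fun j => continuous_wedgeForm φ _ _
  have hW : ∀ j, W j = invEval φ (Fin.cons (imVec (S.normal j)) (latticeFrame (u j))) := by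
    intro j
    ext z
    have hB := S.isLatticeBasis_consBasis j (hu j)
    have e1 := map_latticeFrame_congr hli (hv.span_eq.trans hB.span_eq.symm)
      (wedgeForm (S.functional j) (invForm φ z))
    have e2 := wedgeForm_consBasis (S.functional j) (invForm φ z) (S.normal j) (u j) (fun k =>
      ((S.mem_lattice_facet_iff j _).1
        ((hu j).span_eq ▸ Submodule.subset_span (Set.mem_range_self k))).2)
    rw [S.functional_normal, Complex.ofReal_one, one_mul] at e2
    exact e1.symm.trans e2
  have h2 : ∀ ε, ∫ s, (S.cutoff ε (chart v a s) : ℂ) *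
      mean (invEval (TestForm.d n (2 * q + 1) φ) (latticeFrame v)) (chart v a s) =
      ∑ j, ∫ s, (S.cutoffDeriv ε j (chart (consBasis (S.normal j) (u j)) (b j) s) : ℂ) *
        mean (W j) (chart (consBasis (S.normal j) (u j)) (b j) s) := by
    intro ε
    rw [integral_mul_mean_d hli a φ (latticeFrame v) hframe (S.contDiff_cutoff ε)]
    have e1 : ∀ s, mean (fun z => wedgeForm (fderiv ℝ (S.cutoff ε) (chart v a s)) (invForm φ z)
        (latticeFrame v)) (chart v a s) =
        ∑ j, (S.cutoffDeriv ε j (chart v a s) : ℂ) * mean (W j) (chart v a s) := by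
      intro s
      simp only [fderiv_cutoff, wedgeForm_sum_smul]
      rw [mean_sum]
      · simp only [mean_const_mul]
        rfl
      · intro j
        exact continuous_const.mul (hWc j)
    simp only [e1]
    rw [integral_finsetSum]
    · refine Finset.sum_congr rfl fun j _ => ?_
      have hB := S.isLatticeBasis_consBasis j (hu j)
      refine (integral_chart_congr hli (hv.span_eq.trans hB.span_eq.symm) ?_
        (fun r => (S.cutoffDeriv ε j r : ℂ) * mean (W j) r)).symm
      rw [hv.span_real hσ hne]
      exact sub_mem_vectorSpan (hb j).1 ha
    · intro j _
      have e2 := (S.continuous_cutoffDeriv ε j)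
      have e3 := continuous_mean (hWc j)
      exact integrable_chart hli a (g := fun r => (S.cutoffDeriv ε j r : ℂ) * mean (W j) r)
        (by fun_prop) (hasCompactSupport_mean_wedgeForm φ _ _).mul_left
  refine tendsto_nhds_unique h1 ?_
  simp only [h2]
  refine tendsto_finsetSum _ fun j _ => ?_
  rw [hW]
  exact S.tendsto_integral_cutoffDeriv j (hu j) (hb j) (hfrat j) (continuous_mean_invEval φ _)
    (hasCompactSupport_mean_invEval φ _)

end FacetSystem

/-! ### The boundary currents are additive -/

theorem imVec_add {n : ℕ} (w w' : Fin n → ℤ) : imVec (w + w') = imVec w + imVec w' := by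
  ext i
  simp [imVec, mul_add]

theorem imVec_eq_latticeFrame {n q : ℕ} (v : Fin q → Fin n → ℤ) (k : Fin q) :
    imVec (v k) = latticeFrame v ⟨2 * k + 1, by omega⟩ := by
  ext i
  have h1 : (2 * (k : ℕ) + 1) % 2 = 1 := by omega
  have h2 : (⟨(2 * (k : ℕ) + 1) / 2, by omega⟩ : Fin q) = k := Fin.ext (by simp only; omega)
  simp only [imVec, latticeFrame, h1, h2, pow_one]

/-- The value of a form on the frame `(iw, v_1, iv_1, …)`, as an additive function of `w`. -/
def frameHom {n q : ℕ} (v : Fin q → Fin n → ℤ) (Ψ : (Fin n → ℂ) [⋀^Fin (2 * q + 1)]→L[ℝ] ℂ) :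
    (Fin n → ℤ) →+ ℂ :=
  AddMonoidHom.mk' (fun w => Ψ (Fin.cons (imVec w) (latticeFrame v))) fun w w' => by
    rw [imVec_add]
    exact Ψ.toMultilinearMap.cons_add _ _ _

theorem frameHom_apply {n q : ℕ} (v : Fin q → Fin n → ℤ)
    (Ψ : (Fin n → ℂ) [⋀^Fin (2 * q + 1)]→L[ℝ] ℂ) (w : Fin n → ℤ) :
    frameHom v Ψ w = Ψ (Fin.cons (imVec w) (latticeFrame v)) := rfl

theorem frameHom_eq_zero {n q : ℕ} (v : Fin q → Fin n → ℤ)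
    (Ψ : (Fin n → ℂ) [⋀^Fin (2 * q + 1)]→L[ℝ] ℂ) {w : Fin n → ℤ}
    (hw : w ∈ Submodule.span ℤ (Set.range v)) : frameHom v Ψ w = 0 := by
  refine Submodule.span_induction (p := fun w _ => frameHom v Ψ w = 0) ?_ (map_zero _) ?_ ?_ hw
  · rintro _ ⟨k, rfl⟩
    rw [frameHom_apply, imVec_eq_latticeFrame]
    exact Ψ.map_eq_zero_of_eq _ (i := 0) (j := Fin.succ ⟨2 * k + 1, by omega⟩)
      (by rw [Fin.cons_zero, Fin.cons_succ])
      (Fin.succ_ne_zero _).symm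
  · intro x y _ _ hx hy
    rw [map_add, hx, hy, add_zero]
  · intro t x _ hx
    rw [map_zsmul, hx, smul_zero]

theorem circleAverage_add {n q : ℕ} (v : Fin q → Fin n → ℤ)
    (hv : LinearIndependent ℝ fun j => intCast n (v j)) (a : Fin n → ℝ) (w w' : Fin n → ℤ)
    (τ : Set (Fin n → ℝ)) :
    circleAverage v hv a (w + w') τ = circleAverage v hv a w τ + circleAverage v hv a w' τ := by
  ext φ
  rw [add_apply]
  simp only [circleAverage_eq]
  rw [← mul_add, ← integral_add]
  · congr 1
    refine integral_congr_ae (Filter.Eventually.of_forall fun s => ?_)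
    simp only
    rw [← mean_add (contDiff_invEval φ _).continuous (contDiff_invEval φ _).continuous]
    exact congrArg (fun f => mean f _) (funext fun z => (frameHom v (invForm φ z)).map_add w w')
  · exact (integrable_chart hv a (continuous_mean_invEval φ _)
      (hasCompactSupport_mean_invEval φ _)).integrableOn
  · exact (integrable_chart hv a (continuous_mean_invEval φ _)
      (hasCompactSupport_mean_invEval φ _)).integrableOn

/-- For `w` in `H_τ` the frame `(iw, v_1, iv_1, …)` is linearly dependent. -/
theorem circleAverage_eq_zero {n q : ℕ} {τ : Set (Fin n → ℝ)} {v : Fin q → Fin n → ℤ}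
    (hv : IsLatticeBasis τ v) (a : Fin n → ℝ) {w : Fin n → ℤ} (hw : w ∈ lattice τ) :
    circleAverage v hv.linearIndependent a w τ = 0 := by
  ext φ
  rw [circleAverage_eq]
  have : invEval φ (Fin.cons (imVec w) (latticeFrame v)) = fun _ => 0 := funext fun z =>
    frameHom_eq_zero v (invForm φ z) (hv.span_eq ▸ hw)
  simp [this, mean]

theorem circleAverage_congr {n q : ℕ} {τ : Set (Fin n → ℝ)} {v : Fin q → Fin n → ℤ}
    (hv : IsLatticeBasis τ v) (a : Fin n → ℝ) {w w' : Fin n → ℤ}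
    (h : (Submodule.Quotient.mk w : NormalLattice τ) = Submodule.Quotient.mk w') :
    circleAverage v hv.linearIndependent a w τ = circleAverage v hv.linearIndependent a w' τ := by
  rw [← sub_add_cancel w w', circleAverage_add,
    circleAverage_eq_zero hv a ((Submodule.Quotient.eq _).1 h), zero_add]

theorem boundaryCurrent_mk {n q : ℕ} {τ : Set (Fin n → ℝ)}
    (h : τ.Nonempty ∧ ∃ v : Fin q → Fin n → ℤ, IsLatticeBasis τ v) (w : Fin n → ℤ) :
    boundaryCurrent q τ (Submodule.Quotient.mk w) =
      circleAverage h.2.choose h.2.choose_spec.linearIndependent h.1.some w τ := by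
  rw [boundaryCurrent, dif_pos h]
  exact circleAverage_congr h.2.choose_spec _ (Quotient.out_eq' _)

/-- The map `u ↦ 𝒜_τ(u)`, as a homomorphism on `N(τ)`. -/
def boundaryHom {n : ℕ} (q : ℕ) (τ : Set (Fin n → ℝ)) :
    NormalLattice τ →+ Current n (2 * q + 1) :=
  AddMonoidHom.mk' (boundaryCurrent q τ) fun u u' => by
    obtain ⟨w, rfl⟩ := Submodule.Quotient.mk_surjective _ u
    obtain ⟨w', rfl⟩ := Submodule.Quotient.mk_surjective _ u'
    by_cases h : τ.Nonempty ∧ ∃ v : Fin q → Fin n → ℤ, IsLatticeBasis τ v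
    · rw [← Submodule.Quotient.mk_add, boundaryCurrent_mk h, boundaryCurrent_mk h,
        boundaryCurrent_mk h, circleAverage_add]
    · simp only [boundaryCurrent, dif_neg h, add_zero]

/-- The `ℂ`-linear extension of `u ↦ 𝒜_τ(u)` to `N(τ)_ℂ`. -/
def boundaryMap {n : ℕ} (q : ℕ) (τ : Set (Fin n → ℝ)) :
    NormalSpace τ →ₗ[ℂ] Current n (2 * q + 1) :=
  LinearMap.liftBaseChange ℂ (boundaryHom q τ).toIntLinearMap

theorem boundaryMap_tmul {n q : ℕ} (τ : Set (Fin n → ℝ)) (c : ℂ) (u : NormalLattice τ) :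
    boundaryMap q τ (c ⊗ₜ u) = c • boundaryCurrent q τ u := by
  simp [boundaryMap, boundaryHom]

theorem boundaryMap_eq_zero {n q : ℕ} {τ : Set (Fin n → ℝ)} {K : Set (Fin n → ℂ)}
    (φ : TestForm n (2 * q + 1)) (hφ : tsupport φ ⊆ K) (hτ : τ ∩ Log '' K = ∅)
    (c : NormalSpace τ) : boundaryMap q τ c φ = 0 := by
  induction c using TensorProduct.induction_on with
  | zero => simp
  | add x y hx hy => rw [map_add, add_apply, hx, hy, add_zero]
  | tmul c u =>
    obtain ⟨w, rfl⟩ := Submodule.Quotient.mk_surjective _ u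
    rw [boundaryMap_tmul, smul_apply]
    by_cases h : τ.Nonempty ∧ ∃ v : Fin q → Fin n → ℤ, IsLatticeBasis τ v
    · rw [boundaryCurrent_mk h, circleAverage_eq, setIntegral_eq_zero_of_forall_eq_zero, mul_zero,
        smul_zero]
      intro s hs
      refine mean_eq_zero (K := K) (fun z hz => invEval_eq_zero φ _ fun h => hz (hφ h)) fun hK => ?_
      have hmem : chart _ _ s ∈ τ ∩ Log '' K := ⟨hs, hK⟩
      rwa [hτ] at hmem
    · simp [boundaryCurrent, dif_neg h]

/-- The boundary of the current of a rational polyhedron. -/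
theorem polyhedronCurrent_d {n q : ℕ} {σ : Set (Fin n → ℝ)} (hσ : IsRationalPolyhedron σ)
    (hne : σ.Nonempty) (hd : dim σ = q + 1) {ι : Type} [Fintype ι] (S : FacetSystem ι σ)
    (φ : TestForm n (2 * q + 1)) :
    polyhedronCurrent (q + 1) σ (TestForm.d n (2 * q + 1) φ) =
      ∑ j, boundaryCurrent q (S.facet j) (primitiveGenerator σ (S.facet j)) φ := by
  have h : σ.Nonempty ∧ ∃ v : Fin (q + 1) → Fin n → ℤ, IsLatticeBasis σ v :=
    ⟨hne, exists_isLatticeBasis hσ hne hd⟩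
  have hf : ∀ j, (S.facet j).Nonempty ∧ ∃ v : Fin q → Fin n → ℤ, IsLatticeBasis (S.facet j) v :=
    fun j => ⟨⟨_, S.center_mem_facet j⟩, exists_isLatticeBasis
      ((S.isFace_facet j).isRationalPolyhedron hσ) ⟨_, S.center_mem_facet j⟩
      (by have := S.dim_facet j; omega)⟩
  have key := S.setIntegral_mean_d hσ h.2.choose_spec h.1.some_mem
    (fun j => (hf j).2.choose_spec) (fun j => (hf j).1.some_mem) φ
  rw [polyhedronCurrent, dif_pos h]
  refine (fiberAverage_eq _ _ _ _ _).trans ?_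
  rw [key, Finset.mul_sum]
  refine Finset.sum_congr rfl fun j _ => ?_
  rw [S.primitiveGenerator_facet, boundaryCurrent_mk (hf j), circleAverage_eq]

/-! ### Nondegeneracy of the boundary currents -/

/-- The exterior product of real covectors. -/
def wedge {E : Type*} [NormedAddCommGroup E] [NormedSpace ℝ E] :
    (k : ℕ) → (Fin k → E →L[ℝ] ℝ) → E [⋀^Fin k]→L[ℝ] ℂ
  | 0, _ => ContinuousAlternatingMap.constOfIsEmpty ℝ E (Fin 0) 1
  | k + 1, α => ContinuousAlternatingMap.alternatizeUncurryFin
      ((α 0).smulRight (wedge k (Fin.tail α)))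

/-- On vectors that are triangular with respect to the covectors, the exterior product is the
product of the diagonal values. -/
theorem wedge_apply {E : Type*} [NormedAddCommGroup E] [NormedSpace ℝ E] {k : ℕ}
    (α : Fin k → E →L[ℝ] ℝ) (X : Fin k → E) (h : ∀ i j, i < j → α i (X j) = 0) :
    wedge k α X = ((∏ i, α i (X i) : ℝ) : ℂ) := by
  induction k with
  | zero => simp [wedge]
  | succ k ih =>
    rw [wedge, ContinuousAlternatingMap.alternatizeUncurryFin_apply, Fin.sum_univ_succ,
      Finset.sum_eq_zero, add_zero]
    · have := ih (Fin.tail α) (Fin.tail X) fun i j hij => h _ _ (Fin.succ_lt_succ_iff.2 hij)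
      rw [Fin.prod_univ_succ]
      simp only [Fin.val_zero, pow_zero, one_smul, ContinuousLinearMap.smulRight_apply,
        ContinuousAlternatingMap.smul_apply, Fin.removeNth_zero, this, Complex.real_smul]
      push_cast
      rfl
    · intro i _
      rw [ContinuousLinearMap.smulRight_apply, h 0 i.succ (Fin.succ_pos i)]
      simp

theorem contDiffAt_wedge {E F : Type*} [NormedAddCommGroup E] [NormedSpace ℝ E]
    [NormedAddCommGroup F] [NormedSpace ℝ F] {k : ℕ} {m : WithTop ℕ∞}
    {α : F → Fin k → E →L[ℝ] ℝ} {z : F}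
    (h : ∀ i, ContDiffAt ℝ m (fun z => α z i) z) : ContDiffAt ℝ m (fun z => wedge k (α z)) z := by
  induction k with
  | zero => exact contDiffAt_const
  | succ k ih =>
    have h1 := ih (α := fun z => Fin.tail (α z)) fun i => h i.succ
    exact (ContinuousAlternatingMap.alternatizeUncurryFinCLM ℝ E ℂ).contDiff.contDiffAt.comp z
      (isBoundedBilinearMap_smulRight.contDiff.contDiffAt.comp z ((h 0).prodMk h1))

/-- Multiplication by `z⁻¹`, which trivializes the tangent bundle of the torus. -/
def invMul {n : ℕ} (z : Fin n → ℂ) : (Fin n → ℂ) →L[ℝ] (Fin n → ℂ) :=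
  (ContinuousLinearMap.mul ℝ (Fin n → ℂ)).flip z⁻¹

theorem invMul_mul {n : ℕ} {z : Fin n → ℂ} (hz : z ∈ torus n) (X : Fin n → ℂ) :
    invMul z (X * z) = X := by
  ext i
  have : (z i)⁻¹ * (X i * z i) = X i := by
    rw [mul_left_comm, inv_mul_cancel₀ (hz i), mul_one]
  simpa [invMul] using this

theorem contDiffAt_invMul {n : ℕ} {m : WithTop ℕ∞} {z : Fin n → ℂ} (hz : z ∈ torus n) :
    ContDiffAt ℝ m invMul z := by
  refine (ContinuousLinearMap.mul ℝ (Fin n → ℂ)).flip.contDiff.contDiffAt.comp z ?_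
  refine contDiffAt_pi.2 fun i => ?_
  have h1 : ContDiffAt ℝ m (fun w : ℂ => w⁻¹) (z i) := contDiffAt_inv ℝ (hz i)
  exact h1.comp z (contDiff_apply ℝ ℂ i).contDiffAt

/-- A test form equal to an invariant decomposable form times a bump function over a
neighbourhood of `r`. -/
theorem exists_testForm {n k : ℕ} (r : Fin n → ℝ) {U : Set (Fin n → ℝ)} (hU : U ∈ nhds r)
    (α : Fin k → (Fin n → ℂ) →L[ℝ] ℝ) :
    ∃ (φ : TestForm n k) (χ : (Fin n → ℂ) → ℝ), Continuous χ ∧ (∀ z, 0 ≤ χ z) ∧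
      χ (polarPoint r 0) = 1 ∧ HasCompactSupport χ ∧ tsupport χ ⊆ torus n ∧
      Log '' tsupport φ ⊆ U ∧
      ∀ X : Fin k → Fin n → ℂ, (∀ i j, i < j → α i (X j) = 0) → ∀ z,
        invEval φ X z = ((∏ i, α i (X i) : ℝ) : ℂ) * χ z := by
  have hr : polarPoint r 0 ∈ torus n := polarPoint_mem_torus r 0
  have hn : (torus n : Set (Fin n → ℂ)) ∩ Log ⁻¹' U ∈ nhds (polarPoint r 0) := by
    refine Filter.inter_mem ((torus n).isOpen.mem_nhds hr) ?_
    refine ((continuousOn_Log n).continuousAt ((torus n).isOpen.mem_nhds hr)).preimage_mem_nhds ?_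
    rwa [Log_polarPoint]
  obtain ⟨χ, h1, h2, h3, h4, h5⟩ := exists_contDiff_tsupport_subset (n := ⊤) hn
  let f : (Fin n → ℂ) → (Fin n → ℂ) [⋀^Fin k]→L[ℝ] ℂ :=
    fun z => χ z • wedge k fun i => (α i).comp (invMul z)
  have hf : tsupport f ⊆ tsupport χ := closure_mono fun z hz hχ => hz (by
    ext X
    simp [f, hχ])
  have hsmooth : ContDiff ℝ ((⊤ : ℕ∞) : WithTop ℕ∞) f := by
    refine contDiff_iff_contDiffAt.2 fun z => ?_
    by_cases hz : z ∈ tsupport χ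
    · refine h3.contDiffAt.smul (contDiffAt_wedge fun i => ?_)
      exact contDiffAt_const.clm_comp (contDiffAt_invMul (h1 hz).1)
    · have : f =ᶠ[nhds z] fun _ => 0 :=
        notMem_tsupport_iff_eventuallyEq.1 fun h => hz (hf h)
      exact contDiffAt_const.congr_of_eventuallyEq this
  refine ⟨⟨f, hsmooth, h2.mono' ((subset_tsupport f).trans hf), hf.trans fun z hz => (h1 hz).1⟩,
    χ, h3.continuous, fun z => (h4 ⟨z, rfl⟩).1, h5, h2, fun z hz => (h1 hz).1, ?_, ?_⟩
  · rintro _ ⟨z, hz, rfl⟩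
    exact (h1 (hf hz)).2
  · intro X hX z
    change (χ z • wedge k fun i => (α i).comp (invMul z)) (fun j => X j * z) = _
    by_cases hz : z ∈ tsupport χ
    · have hXz : ∀ j, invMul z (X j * z) = X j := fun j => invMul_mul (h1 hz).1 _
      rw [ContinuousAlternatingMap.smul_apply, wedge_apply]
      · simp only [ContinuousLinearMap.comp_apply, hXz, Complex.real_smul]
        rw [mul_comm]
      · intro i j hij
        rw [ContinuousLinearMap.comp_apply, hXz, hX i j hij]
    · rw [image_eq_zero_of_notMem_tsupport hz]
      simp

/-- Coordinatewise imaginary part. -/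
def imPart (n : ℕ) : (Fin n → ℂ) →L[ℝ] (Fin n → ℝ) :=
  ContinuousLinearMap.pi fun i => Complex.imCLM.comp (ContinuousLinearMap.proj i)

@[simp] theorem imPart_apply {n : ℕ} (X : Fin n → ℂ) (i : Fin n) : imPart n X i = (X i).im := rfl

@[simp] theorem imPart_imVec {n : ℕ} (w : Fin n → ℤ) : imPart n (imVec w) = intCast n w := by
  ext i
  simp [imVec]

theorem imPart_latticeFrame {n p : ℕ} (v : Fin p → Fin n → ℤ) (k : Fin (2 * p)) :
    imPart n (latticeFrame v k) =
      if (k : ℕ) % 2 = 0 then 0 else intCast n (v ⟨k / 2, by omega⟩) := by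
  ext i
  rcases Nat.mod_two_eq_zero_or_one k with h | h <;> simp [latticeFrame, h]

/-- Covectors on which the frames `(iw, v_1, iv_1, …, v_q, iv_q)` are triangular for all `w`: the
first is `m ∘ Im`, for a functional `m` that vanishes on `v`, and the others are dual to the rest of
the frame, so that the product of the diagonal values is `m(w)`. -/
theorem exists_dual_covectors {n q : ℕ} {v : Fin q → Fin n → ℤ}
    (hv : LinearIndependent ℝ fun j => intCast n (v j)) (m : (Fin n → ℝ) →L[ℝ] ℝ)
    (hm : ∀ j, m (intCast n (v j)) = 0) :
    ∃ α : Fin (2 * q + 1) → (Fin n → ℂ) →L[ℝ] ℝ, ∀ w,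
      (∀ i j, i < j → α i ((Fin.cons (imVec w) (latticeFrame v) :
        Fin (2 * q + 1) → Fin n → ℂ) j) = 0) ∧
      ∏ i, α i ((Fin.cons (imVec w) (latticeFrame v) : Fin (2 * q + 1) → Fin n → ℂ) i) =
        m (intCast n w) := by
  obtain ⟨L, hL⟩ := LinearMap.exists_leftInverse_of_injective
    (Fintype.linearCombination ℝ fun j => intCast n (v j))
    (LinearMap.ker_eq_bot.2 (linearIndependent_iff_injective_fintypeLinearCombination.1 hv))
  have hLv : ∀ j k, L (intCast n (v j)) k = if j = k then 1 else 0 := by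
    intro j k
    have := congrFun (LinearMap.congr_fun hL (Pi.single j 1)) k
    simpa [Fintype.linearCombination_apply, Pi.single_apply, eq_comm] using this
  let L' : (Fin n → ℝ) →L[ℝ] (Fin q → ℝ) := LinearMap.toContinuousLinearMap L
  let β : Fin (2 * q) → (Fin n → ℂ) →L[ℝ] ℝ := fun i =>
    ((ContinuousLinearMap.proj (R := ℝ) (φ := fun _ : Fin q => ℝ) ⟨i / 2, by omega⟩).comp L').comp
      (if (i : ℕ) % 2 = 0 then rePart n else imPart n)
  have hβ : ∀ i j, β i (latticeFrame v j) = if j = i then 1 else 0 := by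
    intro i j
    have h1 : β i (latticeFrame v j) = L ((if (i : ℕ) % 2 = 0 then rePart n else imPart n)
      (latticeFrame v j)) ⟨i / 2, by omega⟩ := rfl
    rw [h1]
    split_ifs with hi hij hij
    · subst hij
      rw [rePart_latticeFrame, if_pos hi, hLv, if_pos rfl]
    · rw [rePart_latticeFrame]
      split_ifs with hj
      · rw [hLv, if_neg]
        intro h
        have := congrArg Fin.val h
        simp only at this
        exact hij (Fin.ext (by omega))
      · simp
    · subst hij
      rw [imPart_latticeFrame, if_neg hi, hLv, if_pos rfl]
    · rw [imPart_latticeFrame]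
      split_ifs with hj
      · simp
      · rw [hLv, if_neg]
        intro h
        have := congrArg Fin.val h
        simp only at this
        exact hij (Fin.ext (by omega))
  refine ⟨Fin.cons (m.comp (imPart n)) β, fun w => ⟨fun i j => ?_, ?_⟩⟩
  · refine Fin.cases (fun hij => absurd hij (Fin.not_lt_zero i)) (fun j => ?_) j
    refine Fin.cases (fun _ => ?_) (fun i hij => ?_) i
    · rw [Fin.cons_zero, Fin.cons_succ, ContinuousLinearMap.comp_apply, imPart_latticeFrame]
      split_ifs
      · exact map_zero m
      · exact hm _
    · rw [Fin.cons_succ, Fin.cons_succ, hβ, if_neg]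
      exact (Fin.succ_lt_succ_iff.1 hij).ne'
  · rw [Fin.prod_univ_succ]
    simp [hβ]

/-- A bump function around a point over the relative interior of `τ` has nonzero integral over
`τ`. -/
theorem integral_mean_ne_zero {n q : ℕ} {τ : Set (Fin n → ℝ)} (hτ : IsRationalPolyhedron τ)
    {v : Fin q → Fin n → ℤ} (hv : IsLatticeBasis τ v) {a r : Fin n → ℝ} (ha : a ∈ τ)
    (hr : IsRelInterior τ r) {χ : (Fin n → ℂ) → ℝ} (hχ : Continuous χ) (h0 : ∀ z, 0 ≤ χ z)
    (h1 : χ (polarPoint r 0) = 1) (hc : HasCompactSupport χ) (ht : tsupport χ ⊆ torus n) :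
    ∫ s in chart v a ⁻¹' τ, mean (fun z => (χ z : ℂ)) (chart v a s) ≠ 0 := by
  let g : (Fin n → ℝ) → ℝ := fun r => ∫ x : UnitAddTorus (Fin n), χ (polarPoint r x)
  have hg : ∀ r, mean (fun z => (χ z : ℂ)) r = (g r : ℂ) := fun r => integral_ofReal
  have hmean : Continuous (mean fun z => (χ z : ℂ)) :=
    continuous_mean (Complex.continuous_ofReal.comp hχ)
  have hgc : Continuous g := by
    have := Complex.continuous_re.comp hmean
    simpa [Function.comp_def, hg] using this
  have hg0 : ∀ r, 0 ≤ g r := fun r => integral_nonneg fun x => h0 _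
  have hgr : 0 < g r := by
    refine (integral_pos_iff_support_of_nonneg (fun x => h0 _)
      ((hχ.comp (continuous_polarPoint_right r)).integrable_of_hasCompactSupport
        (HasCompactSupport.of_compactSpace _))).2 ?_
    refine Measure.measure_pos_of_mem_nhds (x := 0) _ ?_
    refine (isOpen_ne_fun (hχ.comp (continuous_polarPoint_right r)) continuous_const).mem_nhds ?_
    simp [h1]
  have hint : Integrable fun s => g (chart v a s) := by
    have := (integrable_chart hv.linearIndependent a hmean
      (hasCompactSupport_mean hc ht fun z hz => by
        rw [image_eq_zero_of_notMem_tsupport hz, Complex.ofReal_zero])).re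
    simpa [hg] using this
  simp only [hg]
  rw [show ∫ s in chart v a ⁻¹' τ, (g (chart v a s) : ℂ) =
    ((∫ s in chart v a ⁻¹' τ, g (chart v a s) : ℝ) : ℂ) from integral_ofReal,
    Complex.ofReal_ne_zero]
  refine ((setIntegral_pos_iff_support_of_nonneg_ae
    (Filter.Eventually.of_forall fun s => hg0 _) hint.integrableOn).2 ?_).ne'
  have hra : r - a ∈ Submodule.span ℝ (Set.range fun j => intCast n (v j)) := by
    rw [hv.span_real hτ ⟨a, ha⟩]
    exact sub_mem_vectorSpan hr.1 ha
  obtain ⟨s₀, hs₀⟩ := Submodule.mem_span_range_iff_exists_fun ℝ |>.1 hra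
  have hs₀' : chart v a s₀ = r := by rw [chart, hs₀]; abel
  refine Measure.measure_pos_of_mem_nhds (x := s₀) _ (Filter.inter_mem ?_ ?_)
  · refine (isOpen_ne_fun (hgc.comp (continuous_chart v a)) continuous_const).mem_nhds ?_
    change g (chart v a s₀) ≠ 0
    rw [hs₀']
    exact hgr.ne'
  · have hlim : Filter.Tendsto (fun s => chart v a s - r) (nhds s₀) (nhds 0) := by
      have : Continuous fun s => chart v a s - r := by fun_prop
      simpa [hs₀'] using this.tendsto s₀
    filter_upwards [hlim.eventually hr.2] with s hs
    have h2 : chart v a s - r ∈ vectorSpan ℝ τ := by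
      have := sub_mem (chart_sub_mem hv a s) (sub_mem_vectorSpan hr.1 ha)
      simpa using this
    have := hs h2
    rwa [add_sub_cancel] at this

/-- The normal lattice has no torsion, because `H_τ ∩ ℤ^n` is saturated in `ℤ^n`. -/
instance isTorsionFree_normalLattice {n : ℕ} (τ : Set (Fin n → ℝ)) :
    Module.IsTorsionFree ℤ (NormalLattice τ) := by
  refine Module.IsTorsionFree.of_smul_eq_zero fun t u h => ?_
  obtain ⟨w, rfl⟩ := Submodule.Quotient.mk_surjective _ u
  refine or_iff_not_imp_left.2 fun ht => ?_
  rw [← Submodule.Quotient.mk_smul, Submodule.Quotient.mk_eq_zero] at h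
  rw [Submodule.Quotient.mk_eq_zero]
  have h1 : intCast n (t • w) ∈ vectorSpan ℝ τ := h
  rw [map_zsmul, ← Int.cast_smul_eq_zsmul ℝ] at h1
  exact (Submodule.smul_mem_iff (vectorSpan ℝ τ) (Int.cast_ne_zero.2 ht)).1 h1

/-- The functional on `ℝ^n` induced by a functional on `N(τ)`. -/
theorem exists_real_functional {n : ℕ} {τ : Set (Fin n → ℝ)} (μ : NormalLattice τ →ₗ[ℤ] ℤ) :
    ∃ m : (Fin n → ℝ) →L[ℝ] ℝ, ∀ w, m (intCast n w) = μ (Submodule.Quotient.mk w) := by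
  refine ⟨dotCLM fun i => μ (Submodule.Quotient.mk (Pi.single i 1)), fun w => ?_⟩
  have h : w = ∑ i, w i • (Pi.single i 1 : Fin n → ℤ) := by
    ext j
    simp [Finset.sum_apply, Pi.single_apply]
  have h2 : μ (Submodule.Quotient.mk w) =
      ∑ i, w i • μ (Submodule.Quotient.mk (Pi.single i 1)) := by
    conv_lhs => rw [h]
    rw [← Submodule.mkQ_apply, map_sum, map_sum]
    simp only [map_smul, Submodule.mkQ_apply]
  rw [h2, dotCLM_apply, dotProduct]
  push_cast
  refine Finset.sum_congr rfl fun i _ => ?_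
  rw [intCast_apply, smul_eq_mul]
  push_cast
  rw [mul_comm]

/-- A vector of `N(τ)_ℂ` is determined by the values of its current on test forms supported over any
given neighbourhood of a relative interior point of `τ`. -/
theorem eq_zero_of_boundaryMap {n q : ℕ} {τ : Set (Fin n → ℝ)} (hτ : IsRationalPolyhedron τ)
    (hd : dim τ = q) {r : Fin n → ℝ} (hr : IsRelInterior τ r) {U : Set (Fin n → ℝ)}
    (hU : U ∈ nhds r) {c : NormalSpace τ}
    (hc : ∀ φ : TestForm n (2 * q + 1), Log '' tsupport φ ⊆ U → boundaryMap q τ c φ = 0) :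
    c = 0 := by
  have h : τ.Nonempty ∧ ∃ v : Fin q → Fin n → ℤ, IsLatticeBasis τ v :=
    ⟨⟨r, hr.1⟩, exists_isLatticeBasis hτ ⟨r, hr.1⟩ hd⟩
  let b := Module.Free.chooseBasis ℤ (NormalLattice τ)
  refine (Algebra.TensorProduct.basis ℂ b).repr.map_eq_zero_iff.1 (Finsupp.ext fun i => ?_)
  obtain ⟨m, hm⟩ := exists_real_functional (b.coord i)
  have hv := h.2.choose_spec
  obtain ⟨α, hα⟩ := exists_dual_covectors hv.linearIndependent m fun j => by
    rw [hm, (Submodule.Quotient.mk_eq_zero _).2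
      (hv.span_eq ▸ Submodule.subset_span (Set.mem_range_self j)), map_zero, Int.cast_zero]
  obtain ⟨φ, χ, hχ, h0, h1, hcs, ht, hs, hφ⟩ := exists_testForm r hU α
  let K : ℂ := (2 * Real.pi : ℂ) ^ (q + 1) *
    ∫ s in chart h.2.choose h.1.some ⁻¹' τ,
      mean (fun z => (χ z : ℂ)) (chart h.2.choose h.1.some s)
  have hK : K ≠ 0 := mul_ne_zero
    (pow_ne_zero _ (mul_ne_zero two_ne_zero (Complex.ofReal_ne_zero.2 Real.pi_ne_zero)))
    (integral_mean_ne_zero hτ hv h.1.some_mem hr hχ h0 h1 hcs ht)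
  -- The test form computes the `i`-th coordinate, up to the factor `K`.
  have key : ∀ c : NormalSpace τ,
      boundaryMap q τ c φ = K * (Algebra.TensorProduct.basis ℂ b).repr c i := by
    intro c
    induction c using TensorProduct.induction_on with
    | zero => simp
    | add x y hx hy => rw [map_add, map_add, add_apply, hx, hy, Finsupp.add_apply, mul_add]
    | tmul c u =>
      obtain ⟨w, rfl⟩ := Submodule.Quotient.mk_surjective _ u
      rw [boundaryMap_tmul, smul_apply, boundaryCurrent_mk h, circleAverage_eq,
        Algebra.TensorProduct.basis_repr_tmul]
      have h3 : invEval φ (Fin.cons (imVec w) (latticeFrame h.2.choose)) =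
          fun z => ((m (intCast n w) : ℝ) : ℂ) * χ z := by
        funext z
        rw [hφ _ (hα w).1, (hα w).2]
      simp only [h3, mean_const_mul, integral_const_mul, hm, K, Module.Basis.coord_apply]
      simp
      ring
  have := (key c).symm.trans (hc φ hs)
  simpa [hK] using this

/-! ### The boundary of the current of a weighted complex -/

namespace WeightedComplex

variable {n p : ℕ} (C : WeightedComplex n p)

theorem isFace_of_subset {τ σ : Set (Fin n → ℝ)} (hτ : τ ∈ C.cells) (hσ : σ ∈ C.cells)
    (h : τ ⊆ σ) : IsFace τ σ := by
  have := (C.inter_isFace σ hσ τ hτ (by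
    rw [Set.inter_eq_right.2 h]
    exact C.nonempty τ hτ)).1
  rwa [Set.inter_eq_right.2 h] at this

theorem exists_maximal {τ : Set (Fin n → ℝ)} (hτ : τ ∈ C.cells) :
    ∃ σ, Maximal (· ∈ C.cells) σ ∧ IsFace τ σ := by
  obtain ⟨x, hx⟩ := C.nonempty τ hτ
  obtain ⟨σ, hσ, hmax⟩ := (C.locallyFinite {x} isCompact_singleton).exists_le_maximal
    (a := τ) ⟨hτ, x, hx, rfl⟩
  refine ⟨σ, ⟨hmax.1.1, fun ρ hρ hle => hmax.2 ⟨hρ, x, hle (hσ hx), rfl⟩ hle⟩, ?_⟩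
  exact C.isFace_of_subset hτ hmax.1.1 hσ

/-- Every cell is a face of a maximal cell, hence rational. -/
theorem isRationalPolyhedron {τ : Set (Fin n → ℝ)} (hτ : τ ∈ C.cells) :
    IsRationalPolyhedron τ := by
  obtain ⟨σ, hσ, h⟩ := C.exists_maximal hτ
  exact h.isRationalPolyhedron (C.isRational_of_maximal σ hσ)

/-- A relative interior point of a cell lies in no other cell of the same dimension. -/
theorem eq_of_isRelInterior {τ τ' : Set (Fin n → ℝ)} (hτ : τ ∈ C.cells) (hτ' : τ' ∈ C.cells)
    (hd : dim τ = dim τ') {r : Fin n → ℝ} (hr : IsRelInterior τ r) (hr' : r ∈ τ') : τ = τ' := by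
  obtain ⟨h1, h2⟩ := C.inter_isFace τ hτ τ' hτ' ⟨r, hr.1, hr'⟩
  rw [h1.eq_of_isRelInterior hr ⟨hr.1, hr'⟩] at h2
  exact h2.eq_of_dim_eq hd

/-- A relative interior point of a cell has a neighbourhood which meets no other cell of the same
dimension. -/
theorem exists_nhds {τ : Set (Fin n → ℝ)} (hτ : τ ∈ C.cells) {r : Fin n → ℝ}
    (hr : IsRelInterior τ r) :
    ∃ U ∈ nhds r, ∀ τ' ∈ C.cells, dim τ' = dim τ → (τ' ∩ U).Nonempty → τ' = τ := by
  have hfin := (C.locallyFinite _ (isCompact_closedBall r 1)).subset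
    (fun τ' h => h.1 : {τ' | (τ' ∈ C.cells ∧ (τ' ∩ Metric.closedBall r 1).Nonempty) ∧
      dim τ' = dim τ ∧ τ' ≠ τ} ⊆ _)
  refine ⟨Metric.closedBall r 1 ∩ ⋂ τ' ∈ {τ' | (τ' ∈ C.cells ∧
    (τ' ∩ Metric.closedBall r 1).Nonempty) ∧ dim τ' = dim τ ∧ τ' ≠ τ}, τ'ᶜ,
    Filter.inter_mem (Metric.closedBall_mem_nhds r one_pos)
      ((Filter.biInter_mem hfin).2 fun τ' h => ?_), ?_⟩
  · refine (C.isPolyhedron τ' h.1.1).isClosed.isOpen_compl.mem_nhds fun hr' => h.2.2 ?_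
    exact (C.eq_of_isRelInterior hτ h.1.1 h.2.1.symm hr hr').symm
  · rintro τ' hτ' hd ⟨x, hx, hxU, hxI⟩
    by_contra hne
    exact Set.mem_iInter₂.1 hxI τ' ⟨⟨hτ', x, hx, hxU⟩, hd, hne⟩ hx

open Classical in
/-- The boundary of the current of a maximal cell, as a sum over the cells that meet the image of
the support of the test form. -/
theorem polyhedronCurrent_d_eq_sum {q : ℕ} (C : WeightedComplex n (q + 1))
    {σ : Set (Fin n → ℝ)} (hσ : σ ∈ C.cellsOfDim (q + 1)) (φ : TestForm n (2 * q + 1))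
    (T : Finset (Set (Fin n → ℝ)))
    (hT : ∀ τ, τ ∈ T ↔ τ ∈ C.cellsOfDim q ∧ (τ ∩ Log '' tsupport φ).Nonempty) :
    polyhedronCurrent (q + 1) σ (TestForm.d n (2 * q + 1) φ) =
      ∑ τ ∈ T with IsFace τ σ, boundaryCurrent q τ (primitiveGenerator σ τ) φ := by
  have hr := C.isRationalPolyhedron hσ.1
  have hne := C.nonempty σ hσ.1
  obtain ⟨ι, _, ⟨S⟩⟩ := exists_facetSystem hr hne
  rw [polyhedronCurrent_d hr hne hσ.2 S φ,
    ← Finset.sum_image (g := S.facet)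
      (f := fun τ => boundaryCurrent q τ (primitiveGenerator σ τ) φ)
      fun _ _ _ _ h => S.facet_injective h]
  symm
  refine Finset.sum_subset (fun τ hτ => ?_) fun τ hτ hτT => ?_
  · obtain ⟨h1, h2⟩ := Finset.mem_filter.1 hτ
    have h3 : dim τ = q := ((hT τ).1 h1).1.2
    obtain ⟨j, hj⟩ := S.exists_facet_eq hr.isPolyhedron.convex h2 (by rw [h3, hσ.2])
    exact Finset.mem_image.2 ⟨j, Finset.mem_univ j, hj.symm⟩
  · obtain ⟨j, -, rfl⟩ := Finset.mem_image.1 hτ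
    have h1 := S.isFace_facet j
    have h2 : S.facet j ∈ C.cellsOfDim q :=
      ⟨C.face_mem σ hσ.1 _ h1, by have := S.dim_facet j; have := hσ.2; omega⟩
    have h3 : S.facet j ∩ Log '' tsupport φ = ∅ := by
      by_contra h
      exact hτT (Finset.mem_filter.2
        ⟨(hT _).2 ⟨h2, Set.nonempty_iff_ne_empty.2 h⟩, h1⟩)
    have := boundaryMap_eq_zero φ subset_rfl h3 (1 ⊗ₜ primitiveGenerator σ (S.facet j))
    rwa [boundaryMap_tmul, one_smul] at this

/-- The boundary of the current of a complex. Only finitely many cells meet the image of the support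
of `φ`, and the sums over pairs `τ ⊂ σ` may be interchanged. -/
theorem current_d {q : ℕ} (C : WeightedComplex n (q + 1)) (φ : TestForm n (2 * q + 1)) :
    Current.d C.current φ =
      -∑ᶠ (τ) (_ : τ ∈ C.cellsOfDim q), boundaryMap q τ (C.balancingSum τ) φ := by
  classical
  have hK : IsCompact (Log '' tsupport φ) :=
    isCompact_Log_image φ.hasCompactSupport φ.tsupport_subset
  have hfin : ∀ d, {τ | τ ∈ C.cellsOfDim d ∧ (τ ∩ Log '' tsupport φ).Nonempty}.Finite := fun d =>
    (C.locallyFinite _ hK).subset fun τ h => ⟨h.1.1, h.2⟩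
  let T := (hfin q).toFinset
  let R := (hfin (q + 1)).toFinset
  have hT : ∀ τ, τ ∈ T ↔ τ ∈ C.cellsOfDim q ∧ (τ ∩ Log '' tsupport φ).Nonempty := fun τ =>
    (hfin q).mem_toFinset
  have hR : ∀ σ, σ ∈ R ↔ σ ∈ C.cellsOfDim (q + 1) ∧ (σ ∩ Log '' tsupport φ).Nonempty := fun σ =>
    (hfin (q + 1)).mem_toFinset
  -- A cell with a face meeting a set meets this set itself.
  have hTR : ∀ τ ∈ T, ∀ σ ∈ C.cellsOfDim (q + 1), IsFace τ σ → σ ∈ R := fun τ hτ σ hσ h =>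
    (hR σ).2 ⟨hσ, ((hT τ).1 hτ).2.mono (Set.inter_subset_inter_left _ h.subset)⟩
  have h1 : C.current (TestForm.d n (2 * q + 1) φ) = ∑ σ ∈ R, C.weight σ *
      ∑ τ ∈ T with IsFace τ σ, boundaryCurrent q τ (primitiveGenerator σ τ) φ := by
    refine (finsum_cond_eq_sum_of_cond_iff _ fun {σ} hσ => ⟨fun h => ?_, fun h =>
      ((hR σ).1 h).1⟩).trans (Finset.sum_congr rfl fun σ hσ => ?_)
    · by_contra hσR
      rw [C.polyhedronCurrent_d_eq_sum h φ T hT, Finset.filter_false_of_mem, Finset.sum_empty,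
        mul_zero] at hσ
      · exact hσ rfl
      · exact fun τ hτ hf => hσR (hTR τ hτ σ h hf)
    · rw [C.polyhedronCurrent_d_eq_sum ((hR σ).1 hσ).1 φ T hT]
  have h2 : ∑ᶠ (τ) (_ : τ ∈ C.cellsOfDim q), boundaryMap q τ (C.balancingSum τ) φ =
      ∑ τ ∈ T, ∑ σ ∈ R with IsFace τ σ,
        C.weight σ * boundaryCurrent q τ (primitiveGenerator σ τ) φ := by
    refine (finsum_cond_eq_sum_of_cond_iff _ fun {τ} hτ => ⟨fun h => ?_, fun h =>
      ((hT τ).1 h).1⟩).trans (Finset.sum_congr rfl fun τ hτ => ?_)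
    · by_contra hτT
      refine hτ (boundaryMap_eq_zero φ subset_rfl ?_ _)
      by_contra hne
      exact hτT ((hT τ).2 ⟨h, Set.nonempty_iff_ne_empty.2 hne⟩)
    · have : C.balancingSum τ =
          ∑ σ ∈ R with IsFace τ σ, C.weight σ ⊗ₜ[ℤ] primitiveGenerator σ τ :=
        finsum_cond_eq_sum_of_cond_iff _ fun {σ} _ => by
          rw [Finset.mem_filter]
          exact ⟨fun h => ⟨hTR τ hτ σ h.1 h.2, h.2⟩, fun h => ⟨((hR σ).1 h.1).1, h.2⟩⟩
      rw [this, map_sum, sum_apply]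
      simp only [boundaryMap_tmul, smul_apply, smul_eq_mul]
  have h3 : Current.d C.current φ = -C.current (TestForm.d n (2 * q + 1) φ) := by
    change (-1 : ℂ) ^ (2 * q + 1) • C.current (TestForm.d n (2 * q + 1) φ) = _
    rw [pow_succ, pow_mul]
    simp
  rw [h3, h1, h2]
  simp only [Finset.mul_sum, Finset.sum_filter, mul_ite, mul_zero]
  rw [Finset.sum_comm]

theorem boundaryMap_injective {q : ℕ} (C : WeightedComplex n p) {τ : Set (Fin n → ℝ)}
    (hτ : τ ∈ C.cellsOfDim q) : Function.Injective (boundaryMap q τ) := by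
  have hr := C.isRationalPolyhedron hτ.1
  obtain ⟨r, hrel⟩ := exists_isRelInterior hr.isPolyhedron.convex (C.nonempty τ hτ.1)
  refine (injective_iff_map_eq_zero _).2 fun c hc => ?_
  refine eq_zero_of_boundaryMap hr hτ.2 hrel Filter.univ_mem fun φ _ => ?_
  rw [hc, zero_apply]

/-- Test forms supported near a relative interior point of `τ` see only the term of `τ` in the
boundary. -/
theorem isBalanced_of_isClosed {q : ℕ} (C : WeightedComplex n (q + 1))
    (h : C.current.IsClosed) : C.IsBalanced := by
  have h' : ∀ φ, Current.d C.current φ = 0 := fun φ =>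
    congrArg (fun T : Current n (2 * q + 1) => T φ) h
  intro τ hτ hd
  replace hd : dim τ = q := by omega
  have hr := C.isRationalPolyhedron hτ
  obtain ⟨r, hrel⟩ := exists_isRelInterior hr.isPolyhedron.convex (C.nonempty τ hτ)
  obtain ⟨U, hU, hUτ⟩ := C.exists_nhds hτ hrel
  refine eq_zero_of_boundaryMap hr hd hrel hU fun φ hφ => ?_
  have h1 := C.current_d φ
  rw [h' φ, finsum_cond_eq_sum_of_cond_iff (t := {τ}), Finset.sum_singleton] at h1
  · exact neg_eq_zero.1 h1.symm
  · intro τ' hne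
    rw [Finset.mem_singleton]
    refine ⟨fun hτ' => hUτ τ' hτ'.1 (hτ'.2.trans hd.symm) ?_, fun e => e ▸ ⟨hτ, hd⟩⟩
    by_contra hempty
    refine hne (boundaryMap_eq_zero φ subset_rfl ?_ _)
    exact Set.not_nonempty_iff_eq_empty.1 fun hn =>
      hempty (hn.mono (Set.inter_subset_inter_right _ hφ))

theorem isClosed_of_isBalanced {q : ℕ} (C : WeightedComplex n (q + 1))
    (h : C.IsBalanced) : C.current.IsClosed := by
  change (Current.d C.current : Current n (2 * q + 1)) = 0
  ext φ
  rw [current_d, zero_apply, neg_eq_zero]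
  refine finsum_mem_eq_zero_of_forall_eq_zero fun τ hτ => ?_
  rw [h τ hτ.1 (by rw [hτ.2]), map_zero, zero_apply]

end WeightedComplex

end TropCurr

end

theorem theorem2 (n : ℕ) :
    (∀ (p : ℕ) (C : TropCurr.WeightedComplex n p), C.IsBalanced ↔ C.current.IsClosed) ∧
    (∀ (q : ℕ) (C : TropCurr.WeightedComplex n (q + 1)),
      ∃ A : ∀ τ : Set (Fin n → ℝ), TropCurr.NormalSpace τ →ₗ[ℂ] TropCurr.Current n (2 * q + 1),
        (∀ τ ∈ C.cellsOfDim q, Function.Injective (A τ) ∧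
          ∀ u : TropCurr.NormalLattice τ, A τ (1 ⊗ₜ[ℤ] u) = TropCurr.boundaryCurrent q τ u) ∧
        ∀ φ : TropCurr.TestForm n (2 * q + 1),
          TropCurr.Current.d C.current φ =
            -∑ᶠ (τ) (_ : τ ∈ C.cellsOfDim q), A τ (C.balancingSum τ) φ) := by
  refine ⟨fun p C => ?_, fun q C => ⟨TropCurr.boundaryMap q, fun τ hτ =>
    ⟨C.boundaryMap_injective hτ, fun u => ?_⟩, C.current_d⟩⟩
  · cases p with
    -- There are no cells of dimension `-1`, and currents of dimension `0` are closed.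
    | zero => exact ⟨fun _ => trivial, fun _ τ _ hd => absurd hd (Nat.succ_ne_zero _)⟩
    | succ q => exact ⟨C.isClosed_of_isBalanced, C.isBalanced_of_isClosed⟩
  · rw [TropCurr.boundaryMap_tmul, one_smul]
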